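/- **Setup.** Let $r,k,s_1,\dots,s_k\ge 0$ be integers and let $\Gamma$ be the quiver with vertices $(l)$ for $1\le l\le r$ and $(i;j)$ for $1\le i\le k$, $0\le j\le s_i$, with one arrow $(l)\to(i;0)$ for all $l,i$, one arrow $(i;j+1)\to(i;j)$ for $0\le j<s_i$, and no other arrows. Let $\mu=(\mu^1,\dots,\mu^k)$ be non-zero partitions $\mu^i=(\mu^i_1\ge\dots\ge\mu^i_{s_i+1}\ge 0)$, and let $v_\mu$ be the dimension vector with $(v_\mu)_{(l)}=1$ and $(v_\mu)_{(i;j)}=|\mu^i|-\sum_{f=1}^{j}\mu^i_f$. Assume that $v_\mu$ is a fundamental imaginary root: it is non-zero, has connected support, and satisfies $(e_x,v_\mu)\le 0$ for every vertex $x$, where $(\cdot,\cdot)$ is the symmetric bilinear form of the Cartan matrix ($c_{xx}=2$, and $-c_{xy}$ is the number of edges joining $x\neq y$). This implies $|\mu^i|+\mu^i_1\le r$ for all $i$. The Kac polynomial $A_{\Gamma,v}(t)\in\mathbb Z[t]$ is the polynomial whose value at $q$, for every finite field $\mathbb F_q$, is the number of isomorphism classes of absolutely indecomposable representations of $\Gamma$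 over $\mathbb F_q$ of dimension vector $v$. Let $\tilde\mu^i=(r-|\mu^i|,\mu^i_1,\dots,\mu^i_{s_i+1})$. Divide $\{1,\dots,r\}$ into consecutive intervals of lengths $\mu^i_{s_i+1},\dots,\mu^i_1,r-|\mu^i|$ (in this order), and let $S_{\tilde\mu^i}\subset S_r$ be the set of $w$ such that $w^{-1}(a)<w^{-1}(b)$ whenever $a<b$ lie in the same interval. Put $S_{\tilde\mu}=\prod_i S_{\tilde\mu^i}$. For $w=(w_1,\dots,w_k)\in (S_r)^k$ the inversion graph $K_w$ is the multigraph on $\{1,\dots,r\}$ with one edge of colour $t$ joining $i$ and $j$ for each $t$ and each $j<i$ with $w_t(i)<w_t(j)$. Put $$R_w(q)=\sum_{K}(q-1)^{e(K)-r+1},$$ the sum being over the connected subgraphs $K$ of $K_w$ that contain all $r$ vertices, where $e(K)$ is the number of edges of $K$. The Tutte polynomial of a finite multigraph $K=(V,E)$ is $T_K(x,y)=\sum_{A\subseteq E}(x-1)^{k(A)-k(E)}(y-1)^{k(A)+|A|-|V|}$, with $k(A)$ the number of connected components of $(V,A)$. For a linear order of $E$ and a spanning tree $T$, the external activity $e(T)$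 is the number of edges $e\in E\setminus T$ that are the smallest edge of the unique cycle of $T\cup\{e\}$. **Theorem.** The Kac polynomial $A_{\Gamma,v_\mu}$ exists, and the following hold. 1. For every $w\in(S_r)^k$: if $K_w$ is connected, then $R_w(q)=T_{K_w}(1,q)$; if $K_w$ is not connected, then $R_w(q)=0$. 2. $$A_{\Gamma,v_\mu}(q)=\sum_{w\in S_{\tilde\mu}}R_w(q)=\sum_{w\in S_{\tilde\mu},\ K_w\text{ connected}}T_{K_w}(1,q).$$ 3. For every $w\in(S_r)^k$ with $K_w$ connected and every linear order of the edges of $K_w$, $T_{K_w}(1,q)=\sum_T q^{e(T)}$, the sum being over the spanning trees $T$ of $K_w$. 4. For any choice of a linear order of the edges of each $K_w$ and every $m\ge 0$, the coefficient of $q^m$ in $A_{\Gamma,v_\mu}(q)$ is the number of pairs $(w,T)$ with $w\in S_{\tilde\mu}$, $K_w$ connected, and $T$ a spanning tree of $K_w$ with $e(T)=m$. In particular, all coefficients of $A_{\Gamma,v_\mu}$ are non-negative. -/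

import Mathlib

noncomputable section

namespace Supernova

open Polynomial

/-! ### Quiver representations and Kac polynomials -/

section Representations

variable {I : Type*} [Quiver I]

/-- A representation of a quiver over `κ` on the graded vector space `⨁ i, κ ^ (n i)`:
a matrix for every arrow. -/
def MatRep (κ : Type*) (n : I → Type*) : Type _ :=
  ∀ ⦃i j : I⦄, (i ⟶ j) → Matrix (n j) (n i) κ

/-- The space of representations of dimension vector `v` over `κ`. -/
abbrev Rep (κ : Type*) (v : I → ℕ) : Type _ :=
  MatRep κ (fun i : I => Fin (v i))

/-- Two representations are isomorphic: there are mutually inverse families of linear maps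
`g i`, `h i` such that `g` intertwines the two representations. -/
def Isomorphic {κ : Type*} [Field κ] {n m : I → Type*}
    [∀ i, Fintype (n i)] [∀ i, DecidableEq (n i)] [∀ i, Fintype (m i)] [∀ i, DecidableEq (m i)]
    (φ : MatRep κ n) (ψ : MatRep κ m) : Prop :=
  ∃ (g : ∀ i, Matrix (m i) (n i) κ) (h : ∀ i, Matrix (n i) (m i) κ),
    (∀ i, g i * h i = 1) ∧ (∀ i, h i * g i = 1) ∧
      ∀ ⦃i j : I⦄ (a : i ⟶ j), g j * φ a = ψ a * g i

/-- The direct sum of two representations. -/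
def directSum {κ : Type*} [Field κ] {n m : I → Type*} (φ : MatRep κ n) (ψ : MatRep κ m) :
    MatRep κ (fun i => n i ⊕ m i) :=
  fun _ _ a => Matrix.fromBlocks (φ a) 0 0 (ψ a)

/-- A representation is indecomposable if it is non-zero and it is not isomorphic to a direct sum
of two non-zero representations. -/
def Indecomposable {κ : Type*} [Field κ] {v : I → ℕ} (φ : Rep κ v) : Prop :=
  v ≠ 0 ∧ ∀ (v₁ v₂ : I → ℕ) (φ₁ : Rep κ v₁) (φ₂ : Rep κ v₂),
    Isomorphic φ (directSum φ₁ φ₂) → v₁ = 0 ∨ v₂ = 0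

/-- Extension of scalars of a representation. -/
def extendScalars {κ : Type*} [Field κ] (L : Type*) [Field L] [Algebra κ L] {n : I → Type*}
    (φ : MatRep κ n) : MatRep L n :=
  fun _ _ a => (φ a).map (algebraMap κ L)

/-- A representation is absolutely indecomposable if it stays indecomposable over every finite
extension of the base field (the base field itself included). -/
def AbsolutelyIndecomposable {κ : Type} [Field κ] {v : I → ℕ} (φ : Rep κ v) : Prop :=
  ∀ (L : Type) [Field L] [Algebra κ L], FiniteDimensional κ L →
    Indecomposable (extendScalars L φ)

/-- Isomorphism as an equivalence relation on representations of dimension vector `v`. -/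
def isoSetoid (κ : Type*) [Field κ] (v : I → ℕ) : Setoid (Rep κ v) where
  r φ ψ := Isomorphic φ ψ
  iseqv :=
    { refl := fun _ => ⟨fun _ => 1, fun _ => 1, by simp, by simp, by simp⟩
      symm := by
        rintro φ ψ ⟨g, h, hgh, hhg, hc⟩
        refine ⟨h, g, hhg, hgh, fun i j a => ?_⟩
        calc h j * ψ a = h j * ((ψ a * g i) * h i) := by
              rw [Matrix.mul_assoc, hgh, Matrix.mul_one]
          _ = (h j * g j) * φ a * h i := by rw [← hc a]; simp only [Matrix.mul_assoc]
          _ = φ a * h i := by rw [hhg, Matrix.one_mul]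
      trans := by
        rintro φ ψ χ ⟨g, h, hgh, hhg, hc⟩ ⟨g', h', hgh', hhg', hc'⟩
        refine ⟨fun i => g' i * g i, fun i => h i * h' i, fun i => ?_, fun i => ?_,
          fun i j a => ?_⟩
        · calc g' i * g i * (h i * h' i) = g' i * ((g i * h i) * h' i) := by
                simp only [Matrix.mul_assoc]
            _ = 1 := by rw [hgh, Matrix.one_mul, hgh']
        · calc h i * h' i * (g' i * g i) = h i * ((h' i * g' i) * g i) := by
                simp only [Matrix.mul_assoc]
            _ = 1 := by rw [hhg', Matrix.one_mul, hhg]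
        · rw [Matrix.mul_assoc, hc a, ← Matrix.mul_assoc, hc' a, Matrix.mul_assoc] }

/-- The number of isomorphism classes of absolutely indecomposable representations of dimension
vector `v` over `κ`. -/
def numAbsolutelyIndecomposable (κ : Type) [Field κ] (v : I → ℕ) : ℕ :=
  Nat.card {c : Quotient (isoSetoid κ v) //
    ∃ φ : Rep κ v, AbsolutelyIndecomposable φ ∧ Quotient.mk (isoSetoid κ v) φ = c}

/-- The polynomial `A` is a Kac polynomial for the dimension vector `v`: for every finite field
with `q` elements, `A(q)` is the number of isomorphism classes of absolutely indecomposable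
representations. (At most one polynomial has this property.) -/
def IsKacPolynomial (v : I → ℕ) (A : ℤ[X]) : Prop :=
  ∀ (F : Type) [Field F] [Fintype F],
    A.eval (Fintype.card F : ℤ) = (numAbsolutelyIndecomposable F v : ℤ)

open Classical in
/-- The Kac polynomial of the quiver for the dimension vector `v` (`0` if there were none). -/
def kacPolynomial (v : I → ℕ) : ℤ[X] :=
  if h : ∃ A : ℤ[X], IsKacPolynomial v A then h.choose else 0

end Representations

/-! ### Fundamental imaginary roots -/

section Roots

variable {I : Type*} [Quiver I] [Fintype I] [DecidableEq I]

/-- The Cartan matrix of a quiver without loops: `2` on the diagonal, and minus the number of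
edges joining `i` and `j` off the diagonal. -/
def cartan (i j : I) : ℤ :=
  if i = j then 2 else -((Nat.card (i ⟶ j) : ℤ) + (Nat.card (j ⟶ i) : ℤ))

/-- The symmetric bilinear form given by the Cartan matrix. -/
def cartanForm (u v : I → ℤ) : ℤ := ∑ i, ∑ j, cartan i j * u i * v j

/-- The simple graph of adjacent vertices of a quiver. -/
def underlyingSimpleGraph (I : Type*) [Quiver I] : SimpleGraph I :=
  SimpleGraph.fromRel (fun i j => Nonempty (i ⟶ j))

/-- The set `M` of fundamental imaginary roots. -/
def IsFundamentalImaginary (u : I → ℕ) : Prop :=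
  u ≠ 0 ∧ ((underlyingSimpleGraph I).induce {i | u i ≠ 0}).Connected ∧
    ∀ i, cartanForm (Pi.single i 1) (fun j => (u j : ℤ)) ≤ 0

end Roots

/-! ### Complete bipartite supernova quivers -/

/-- The vertices: `Sum.inl l` is the vertex `(l)` at the tip of a short leg, and
`Sum.inr ⟨i, j⟩` is the vertex `(i; j)`, `0 ≤ j ≤ s i`, of the `i`-th long leg. -/
abbrev Vertex (r k : ℕ) (s : Fin k → ℕ) : Type := Fin r ⊕ (Σ i : Fin k, Fin (s i + 1))

/-- The pairs of vertices joined by an arrow: `(l) → (i; 0)` for all `l` and `i`, and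
`(i; j + 1) → (i; j)`. -/
def IsArrow {r k : ℕ} {s : Fin k → ℕ} : Vertex r k s → Vertex r k s → Prop
  | Sum.inl _, Sum.inr ⟨_, j⟩ => (j : ℕ) = 0
  | Sum.inr ⟨i, j⟩, Sum.inr ⟨i', j'⟩ => i = i' ∧ (j : ℕ) = (j' : ℕ) + 1
  | _, Sum.inl _ => False

/-- There is exactly one arrow `x → y` for every pair with `IsArrow x y`, and no other arrow. -/
instance supernovaQuiver (r k : ℕ) (s : Fin k → ℕ) : Quiver (Vertex r k s) where
  Hom x y := PLift (IsArrow x y)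

/-- The dimension vector of a multipartition, where `μ i 0 ≥ μ i 1 ≥ ⋯ ≥ μ i (s i)` are the parts
of the `i`-th partition: it is `1` at `(l)`, and at `(i; j)` it is the size of the `i`-th partition
minus its first `j` parts, that is, the sum of the remaining parts. -/
def dimVec (r : ℕ) {k : ℕ} {s : Fin k → ℕ} (μ : ∀ i, Fin (s i + 1) → ℕ) : Vertex r k s → ℕ
  | Sum.inl _ => 1
  | Sum.inr ⟨i, j⟩ => ∑ f ∈ Finset.Ici j, μ i f

/-! ### Permutations in row echelon form -/

/-- For a composition `c` with parts `c 0, …, c (d - 1)`, the rows are divided into consecutive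
blocks: the topmost block has `c (d - 1)` rows, the next one `c (d - 2)`, …, the last one `c 0`.
Rows are numbered from `0`. -/
def SameBlock {d : ℕ} (c : Fin d → ℕ) (a b : ℕ) : Prop :=
  ∃ p : Fin d,
    (∑ f ∈ Finset.Ioi p, c f ≤ a ∧ a < ∑ f ∈ Finset.Ici p, c f) ∧
      (∑ f ∈ Finset.Ioi p, c f ≤ b ∧ b < ∑ f ∈ Finset.Ici p, c f)

open Classical in
/-- The permutations whose permutation matrix `(δ_{a, w(b)})` is in row echelon form with respect
to `c`: the inverse of `w` is increasing on every block. -/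
def echelonPerms (r : ℕ) {d : ℕ} (c : Fin d → ℕ) : Finset (Equiv.Perm (Fin r)) :=
  Finset.univ.filter fun w =>
    ∀ a b : Fin r, a < b → SameBlock c a b → w.symm a < w.symm b

/-- The partition `(r - |μ|, μ 0, μ 1, …)` of `r`, for a partition `μ` with `|μ| ≤ r`. -/
def completed (r : ℕ) {d : ℕ} (μ : Fin d → ℕ) : Fin (d + 1) → ℕ :=
  Fin.cons (r - ∑ f, μ f) μ

/-- The product, over the legs, of the sets of permutations in row echelon form with respect to
the completed partitions. -/
def echelonTuples (r : ℕ) {k : ℕ} {s : Fin k → ℕ} (μ : ∀ i, Fin (s i + 1) → ℕ) :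
    Finset (Fin k → Equiv.Perm (Fin r)) :=
  Fintype.piFinset fun i => echelonPerms r (completed r (μ i))

/-! ### Multigraphs and their Tutte polynomials -/

section Multigraphs

variable {α β : Type*}

/-- The adjacency graph of the spanning subgraph of `G` (all vertices of `G` are kept) with edge
set `A`. It has the same connected components as that subgraph. -/
def spanningSubgraph (G : Graph α β) (A : Set β) : SimpleGraph G.vertexSet :=
  SimpleGraph.fromRel fun x y => ∃ e ∈ A, G.IsLink e x y

/-- The spanning subgraph with edge set `A` is connected. -/
def ConnectedBy (G : Graph α β) (A : Set β) : Prop := (spanningSubgraph G A).Connected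

/-- The multigraph `G` is connected. -/
def IsConnected (G : Graph α β) : Prop := ConnectedBy G G.edgeSet

/-- The number `k(A)` of connected components of the spanning subgraph with edge set `A`. -/
def numComponents (G : Graph α β) (A : Set β) : ℕ :=
  Nat.card (spanningSubgraph G A).ConnectedComponent

variable [Fintype β]

open Classical in
/-- The finite sets of edges of `G`. -/
def edgeSubsets (G : Graph α β) : Finset (Finset β) :=
  Finset.univ.filter fun A => (A : Set β) ⊆ G.edgeSet

/-- The Tutte polynomial `∑_A (x - 1) ^ (k(A) - k(E)) (y - 1) ^ (k(A) + |A| - |V|)` of a finite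
multigraph, with `x = X 0` and `y = X 1`. (Both differences of exponents are non-negative.) -/
def tuttePolynomial (G : Graph α β) : MvPolynomial (Fin 2) ℤ :=
  ∑ A ∈ edgeSubsets G,
    (MvPolynomial.X 0 - 1) ^ (numComponents G A - numComponents G G.edgeSet) *
      (MvPolynomial.X 1 - 1) ^ (numComponents G A + A.card - Nat.card G.vertexSet)

/-- The specialization `T_G(1, q)` of the Tutte polynomial, as a polynomial in `q`. -/
def tutteOne (G : Graph α β) : ℤ[X] :=
  MvPolynomial.aeval (fun i : Fin 2 => if i = 0 then (1 : ℤ[X]) else X) (tuttePolynomial G)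

open Classical in
/-- The sum of `(q - 1) ^ b₁(A)` over the connected spanning subgraphs of `G`, with edge set `A`
and first Betti number `b₁(A) = |A| - |V| + 1`. -/
def bettiSum (G : Graph α β) : ℤ[X] :=
  ∑ A ∈ (edgeSubsets G).filter (fun A : Finset β => ConnectedBy G (A : Set β)),
    (X - 1) ^ (A.card + 1 - Nat.card G.vertexSet)

open Classical in
/-- The (edge sets of) spanning trees of `G`: connected spanning subgraphs with `|V| - 1` edges. -/
def spanningTrees (G : Graph α β) : Finset (Finset β) :=
  (edgeSubsets G).filter fun A =>
    ConnectedBy G (A : Set β) ∧ A.card + 1 = Nat.card G.vertexSet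

open Classical in
/-- The edges of the unique cycle of `A ∪ {e}`, where `A` is a spanning tree and `e` is an edge
outside `A`: those edges whose removal from `A ∪ {e}` leaves a spanning tree. -/
def fundamentalCycle (G : Graph α β) (A : Finset β) (e : β) : Finset β :=
  (insert e A).filter fun f => (insert e A).erase f ∈ spanningTrees G

open Classical in
/-- The external activity of a spanning tree `A` for a linear order of the edges: the number of
edges of `G` outside `A` that are the smallest edge of the cycle that they close with `A`. -/
def externalActivity (G : Graph α β) (ord : LinearOrder β) (A : Finset β) : ℕ :=
  (Finset.univ.filter fun e => e ∈ G.edgeSet ∧ e ∉ A ∧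
    ∀ f ∈ fundamentalCycle G A e, ord.le e f).card

end Multigraphs

/-! ### Inversion graphs -/

/-- The edges of the inversion graph of `w = (w 0, …, w (k - 1))`: triples `(t, i, j)`
(colour `t`, end points `i` and `j`) with `j < i` and `w t i < w t j`. -/
abbrev InversionEdge {r k : ℕ} (w : Fin k → Equiv.Perm (Fin r)) : Type :=
  {e : Fin k × Fin r × Fin r // e.2.2 < e.2.1 ∧ w e.1 e.2.1 < w e.1 e.2.2}

/-- The inversion graph of a tuple of permutations of `Fin r`: a multigraph with vertex set
`Fin r`. -/
def inversionGraph {r k : ℕ} (w : Fin k → Equiv.Perm (Fin r)) :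
    Graph (Fin r) (InversionEdge w) where
  vertexSet := Set.univ
  IsLink e x y := (x = e.1.2.1 ∧ y = e.1.2.2) ∨ (x = e.1.2.2 ∧ y = e.1.2.1)
  edgeSet := Set.univ
  isLink_symm := fun _ _ => ⟨fun _ _ h => h.symm.imp And.symm And.symm⟩
  eq_or_eq_of_isLink_of_isLink := by
    rintro e x y v w (⟨rfl, rfl⟩ | ⟨rfl, rfl⟩) (⟨rfl, rfl⟩ | ⟨rfl, rfl⟩) <;> simp
  edge_mem_iff_exists_isLink := fun e =>
    ⟨fun _ => ⟨e.1.2.1, e.1.2.2, Or.inl ⟨rfl, rfl⟩⟩, fun _ => Set.mem_univ _⟩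
  left_mem_of_isLink := fun _ _ _ _ => Set.mem_univ _

/-- The polynomial `R_w(q)` of a tuple of permutations: the sum of `(q - 1) ^ b₁(K)` over the
connected spanning subgraphs `K` of the inversion graph; it is an empty sum if the inversion graph
is not connected. -/
def rPoly {r k : ℕ} (w : Fin k → Equiv.Perm (Fin r)) : ℤ[X] := bettiSum (inversionGraph w)

end Supernova

end

noncomputable section

namespace Supernova

open Polynomial

/-! ### Activities in a configuration of vectors -/

section Activity

open Classical

variable {β K M : Type*} [Field K] [AddCommGroup M] [Module K M]

/-! All spaces at the vertices (l) are lines, so on each leg the maps from the tips assemble to one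
linear map κ^r → V(i;0). In an indecomposable representation this map is onto and all maps along the
leg are injective; otherwise a summand supported on that leg splits off
(`not_indecomposable_of_chain`). A representation with these properties amounts to a k-tuple of
flags in κ^r: on each leg, the kernel of the map and the preimages of the images of the V(i;j).
Isomorphism becomes the action of the diagonal torus (`isomorphic_iff_torus`), and idempotent
endomorphisms become the sets S of coordinates whose coordinate projection preserves all flags. So
indecomposability means that only the empty set and the full set are such S
(`indecomposable_iff_flagsLinked`). This criterion does not change under field extension
(`absolutelyIndecomposable_iff`). A torus element fixing such a linked tuple of flags is a scalar,
so the number of isomorphism classes is the number of linked tuples divided by (q - 1)^(r - 1)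
(`card_linkedFlags`).

Reduced echelon form puts the flags of a given type in bijection with words of given content
together with a field element for each inversion of the word (`exists_isNormal`,
`IsNormal.eq_of_normalFlag_eq`). The projection to S preserves the flag exactly when no non-zero
entry joins S to its complement (`IsNormal.flagStable_iff`). Linked tuples are thus the tuples of
words with entries whose support is a connected spanning subgraph of the inversion graph. A subgraph
with edge set A supports (q - 1)^|A| families of entries, and division by (q - 1)^(r - 1) gives R_w.

One mismatch remains: the flags begin with the kernel, of dimension r - |μ|, while the theorem puts
the block of that size at the other end. The order of the steps is irrelevant (`card_linked_eq`): by
inversion over the lattice of set partitions it suffices to count tuples whose entries stay inside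
the classes of a partition. That count is a product over the legs, and each factor is a sum of
products of q-multinomial coefficients, which do not see the order of the letters
(`sum_gradedInv_eq`).

On the graph side, setting x = 1 in the Tutte polynomial keeps only the connected spanning
subgraphs. The boundary vectors of the edges realize the cycle matroid. Every spanning set lies
between T and T together with its active elements for exactly one base T, and expanding q^e(T) in
powers of q - 1 gives the sum over spanning trees (`sum_spansAll_eq_sum_isBase`). -/

/-- The vectors of the configuration `v` with index in `A` span `U`. -/
def SpansAll (K : Type*) {M : Type*} [Field K] [AddCommGroup M] [Module K M] (v : β → M)
    (U : Submodule K M) (A : Finset β) : Prop :=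
  Submodule.span K (v '' (A : Set β)) = U

/-- The vectors of the configuration `v` with index in `A` form a basis of `U`. -/
def IsBase (K : Type*) {M : Type*} [Field K] [AddCommGroup M] [Module K M] (v : β → M)
    (U : Submodule K M) (A : Finset β) : Prop :=
  SpansAll K v U A ∧ A.card = Module.finrank K U

/-- The externally active elements of a base. -/
def activeSet (K : Type*) {M : Type*} [Field K] [AddCommGroup M] [Module K M] (v : β → M)
    (U : Submodule K M) (E : Finset β) (ord : LinearOrder β) (T : Finset β) : Finset β :=
  E.filter fun e => e ∉ T ∧ ∀ f ∈ insert e T, IsBase K v U ((insert e T).erase f) → ord.le e f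

variable {v : β → M} {U : Submodule K M}

lemma SpansAll.finrank_le_card {A : Finset β} (h : SpansAll K v U A) :
    Module.finrank K U ≤ A.card := by
  have h1 := finrank_span_finset_le_card (R := K) (A.image v)
  rw [Finset.coe_image, Set.finrank, h] at h1
  exact h1.trans Finset.card_image_le

lemma SpansAll.mono {A B : Finset β} (h : SpansAll K v U A) (hAB : A ⊆ B)
    (hB : ∀ e ∈ B, v e ∈ U) : SpansAll K v U B := by
  apply le_antisymm
  · rw [Submodule.span_le]
    rintro _ ⟨e, he, rfl⟩
    exact hB e he
  · rw [← h]
    exact Submodule.span_mono (Set.image_mono (by exact_mod_cast hAB))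

lemma SpansAll.mem {A : Finset β} (h : SpansAll K v U A) {e : β} (he : e ∈ A) : v e ∈ U := by
  rw [← h]
  exact Submodule.subset_span ⟨e, he, rfl⟩

lemma SpansAll.erase {A : Finset β} (h : SpansAll K v U A) {e : β}
    (h2 : v e ∈ Submodule.span K (v '' ((A.erase e : Finset β) : Set β))) :
    SpansAll K v U (A.erase e) := by
  apply le_antisymm
  · rw [← h]
    exact Submodule.span_mono (Set.image_mono (by exact_mod_cast Finset.erase_subset e A))
  · rw [← h, Submodule.span_le]
    rintro _ ⟨f, hf, rfl⟩
    by_cases hfe : f = e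
    · subst hfe
      exact h2
    · exact Submodule.subset_span ⟨f, by simpa [hfe] using hf, rfl⟩

/-- While a spanning set is not of the right size its vectors are dependent, so one of them lies in
the span of the others and can be dropped. -/
lemma SpansAll.exists_isBase {A : Finset β} (h : SpansAll K v U A) :
    ∃ T ⊆ A, IsBase K v U T := by
  induction A using Finset.strongInduction with
  | H A ih =>
    by_cases h1 : A.card = Module.finrank K U
    · exact ⟨A, subset_rfl, h, h1⟩
    · have h2 : ¬ LinearIndependent K (fun a : (A : Set β) => v a) := by
        intro hli
        apply h1
        have := finrank_span_eq_card hli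
        have hr : Set.range (fun a : (A : Set β) => v a) = v '' (A : Set β) := by
          ext; simp
        rw [hr, h] at this
        rw [this]
        simp
      rw [linearIndependent_iff_notMem_span] at h2
      push Not at h2
      obtain ⟨⟨e, he⟩, h3⟩ := h2
      have he' : e ∈ A := he
      have h4 : SpansAll K v U (A.erase e) := by
        apply h.erase
        refine Submodule.span_mono ?_ h3
        rintro _ ⟨⟨f, hf⟩, hfe, rfl⟩
        have hf' : f ∈ A := hf
        refine ⟨f, ?_, rfl⟩
        have : f ≠ e := by rintro rfl; simp at hfe
        simp [this, hf']
      obtain ⟨T, hT, hb⟩ := ih _ (Finset.erase_ssubset he') h4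
      exact ⟨T, hT.trans (Finset.erase_subset _ _), hb⟩

/-- Expand `v e` in the vectors of `T'`. If only elements of `T` occurred, `T` without `e` would
already span `U`, with too few elements. So some `f` outside `T` occurs, and solving for `v f` shows
that `e` can replace it in `T'`. -/
lemma IsBase.exchange {T T' : Finset β} (hT : IsBase K v U T) (hT' : IsBase K v U T') {e : β}
    (he : e ∈ T) (he' : e ∉ T') :
    ∃ f ∈ T', f ∉ T ∧ IsBase K v U ((insert e T').erase f) := by
  have h1 : v e ∈ Submodule.span K (v '' (T' : Set β)) := by
    rw [hT'.1]; exact hT.1.mem he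
  rw [Submodule.mem_span_image_finset_iff_exists_fun] at h1
  obtain ⟨c₀, hc₀⟩ := h1
  obtain ⟨c, hc⟩ : ∃ c : β → K, ∑ f ∈ T', c f • v f = v e := by
    refine ⟨fun f => if h : f ∈ T' then c₀ ⟨f, h⟩ else 0, ?_⟩
    rw [← Finset.sum_coe_sort, ← hc₀]
    simp
  have h2 : ∃ f ∈ T', f ∉ T ∧ c f ≠ 0 := by
    by_contra! hcon
    have h3 : v e ∈ Submodule.span K (v '' ((T.erase e : Finset β) : Set β)) := by
      rw [← hc]
      refine Submodule.sum_mem _ fun f hf => ?_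
      by_cases hfT : f ∈ T
      · refine Submodule.smul_mem _ _ (Submodule.subset_span ⟨f, ?_, rfl⟩)
        have : f ≠ e := by rintro rfl; exact he' hf
        simp [this, hfT]
      · rw [hcon f hf hfT, zero_smul]
        exact Submodule.zero_mem _
    have h4 := (hT.1.erase h3).finrank_le_card
    rw [← hT.2, Finset.card_erase_of_mem he] at h4
    have := Finset.card_pos.2 ⟨e, he⟩
    omega
  obtain ⟨f, hf, hfT, hcf⟩ := h2
  have hfe : f ≠ e := by rintro rfl; exact hfT he
  refine ⟨f, hf, hfT, ?_, ?_⟩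
  · apply SpansAll.erase
    · refine hT'.1.mono (Finset.subset_insert _ _) ?_
      intro g hg
      rcases Finset.mem_insert.1 hg with rfl | hg
      · exact hT.1.mem he
      · exact hT'.1.mem hg
    · have h5 : v f = (c f)⁻¹ • (v e - ∑ g ∈ T'.erase f, c g • v g) := by
        rw [← hc, ← Finset.add_sum_erase _ _ hf, add_sub_cancel_right, smul_smul,
          inv_mul_cancel₀ hcf, one_smul]
      rw [h5]
      refine Submodule.smul_mem _ _ (Submodule.sub_mem _ (Submodule.subset_span ⟨e, ?_, rfl⟩)
        (Submodule.sum_mem _ fun g hg => Submodule.smul_mem _ _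
          (Submodule.subset_span ⟨g, ?_, rfl⟩)))
      · simp [hfe.symm]
      · have := Finset.mem_erase.1 hg
        simp [this.1, this.2]
  · rw [Finset.card_erase_of_mem (Finset.mem_insert_of_mem hf), Finset.card_insert_of_notMem he',
      Nat.add_sub_cancel, hT'.2]

/-- Take a base inside `A` of largest weight. If some `e` in `A \ T` could replace a smaller element
of `T`, the weight would grow; so `e` is the smallest element of the circuit it closes. -/
lemma exists_isBase_active {E A : Finset β} (ord : LinearOrder β) (hAE : A ⊆ E)
    (h : SpansAll K v U A) : ∃ T ⊆ A, IsBase K v U T ∧ A \ T ⊆ activeSet K v U E ord T := by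
  let _ := ord
  -- An element weighs the number of smaller elements of `A`, which is strictly increasing on `A`.
  let wt : Finset β → ℕ := fun T => ∑ f ∈ T, (A.filter fun g => g < f).card
  obtain ⟨T₀, hT₀, hb₀⟩ := h.exists_isBase
  obtain ⟨T, hT, hmax⟩ := Finset.exists_max_image
    (A.powerset.filter fun T => IsBase K v U T) wt ⟨T₀, by simp [hT₀, hb₀]⟩
  simp only [Finset.mem_filter, Finset.mem_powerset] at hT hmax
  refine ⟨T, hT.1, hT.2, fun e he => ?_⟩
  rw [Finset.mem_sdiff] at he
  simp only [activeSet, Finset.mem_filter]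
  refine ⟨hAE he.1, he.2, fun f hf hb => ?_⟩
  by_contra hlt
  have hlt : f < e := lt_of_not_ge hlt
  have hfT : f ∈ T := by
    rcases Finset.mem_insert.1 hf with rfl | hf
    · exact absurd hlt (lt_irrefl _)
    · exact hf
  have h1 := hmax ((insert e T).erase f) ⟨?_, hb⟩
  · have h2 : wt ((insert e T).erase f) + (A.filter fun g => g < f).card
        = wt T + (A.filter fun g => g < e).card := by
      simp only [wt]
      rw [Finset.sum_erase_add _ _ hf, Finset.sum_insert he.2, add_comm]
    have h3 : (A.filter fun g => g < f).card < (A.filter fun g => g < e).card := by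
      apply Finset.card_lt_card
      refine ⟨fun g hg => ?_, fun hsub => ?_⟩
      · simp only [Finset.mem_filter] at hg ⊢
        exact ⟨hg.1, hg.2.trans hlt⟩
      · have := hsub (Finset.mem_filter.2 ⟨hT.1 hfT, hlt⟩)
        simp at this
    omega
  · intro g hg
    rw [Finset.mem_erase, Finset.mem_insert] at hg
    rcases hg with ⟨_, rfl | hg⟩
    · exact he.1
    · exact hT.1 hg

/-- Let `e` be the largest element in which the two bases differ. Exchanging it into the base that
lacks it removes some `f` of the symmetric difference; activity gives `e ≤ f` and maximality gives
`f ≤ e`, which is absurd. -/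
lemma isBase_active_unique {E A T T' : Finset β} (ord : LinearOrder β)
    (hT : T ⊆ A) (hb : IsBase K v U T) (ha : A \ T ⊆ activeSet K v U E ord T)
    (hT' : T' ⊆ A) (hb' : IsBase K v U T') (ha' : A \ T' ⊆ activeSet K v U E ord T') :
    T = T' := by
  let _ := ord
  by_contra hne
  have hD : (symmDiff T T').Nonempty := by
    rw [Finset.nonempty_iff_ne_empty]
    intro h0
    exact hne (symmDiff_eq_bot.1 h0)
  obtain ⟨e, he, hmax⟩ := Finset.exists_max_image _ id hD
  have key : ∀ S S' : Finset β, IsBase K v U S → IsBase K v U S' → S ⊆ A →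
      A \ S' ⊆ activeSet K v U E ord S' → e ∈ S → e ∉ S' →
      (∀ f ∈ S', f ∉ S → f ≤ e) → False := by
    intro S S' hS hS' hSA haS' heS heS' hm
    obtain ⟨f, hf, hfS, hbf⟩ := hS.exchange hS' heS heS'
    have h1 := haS' (Finset.mem_sdiff.2 ⟨hSA heS, heS'⟩)
    simp only [activeSet, Finset.mem_filter] at h1
    have h2 : e ≤ f := h1.2.2 f (Finset.mem_insert_of_mem hf) (by convert hbf)
    have h3 : e = f := le_antisymm h2 (hm f hf hfS)
    exact heS' (h3 ▸ hf)
  rcases Finset.mem_symmDiff.1 he with ⟨h1, h2⟩ | ⟨h1, h2⟩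
  · exact key T T' hb hb' hT ha' h1 h2 fun f hf hfS =>
      hmax f (Finset.mem_symmDiff.2 (Or.inr ⟨hf, hfS⟩))
  · exact key T' T hb' hb hT' ha h1 h2 fun f hf hfS =>
      hmax f (Finset.mem_symmDiff.2 (Or.inl ⟨hf, hfS⟩))

/-- The expansion over bases of the generating function of the spanning sets by nullity. -/
theorem sum_spansAll_eq_sum_isBase {R : Type*} [CommRing R] (y : R) (E : Finset β)
    (hE : ∀ e ∈ E, v e ∈ U) (ord : LinearOrder β) :
    ∑ A ∈ E.powerset.filter (fun A => SpansAll K v U A),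
        (y - 1) ^ (A.card - Module.finrank K U) =
      ∑ T ∈ E.powerset.filter (fun T => IsBase K v U T),
        y ^ (activeSet K v U E ord T).card := by
  -- Binomial expansion of `((y - 1) + 1)`: the right side becomes a sum over pairs of a base `T`
  -- and a set `B` of active elements.
  have h1 : ∀ T : Finset β, y ^ (activeSet K v U E ord T).card =
      ∑ B ∈ (activeSet K v U E ord T).powerset, (y - 1) ^ B.card := by
    intro T
    have := Finset.sum_pow_mul_eq_add_pow (y - 1) 1 (activeSet K v U E ord T)
    simp only [one_pow, mul_one, sub_add_cancel] at this
    exact this.symm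
  simp only [h1]
  rw [Finset.sum_sigma']
  symm
  -- A pair `(T, B)` goes to the spanning set `T ∪ B`; conversely `T` is the unique base in `A` with
  -- `A \ T` active.
  refine Finset.sum_bij' (fun p _ => p.1 ∪ p.2)
    (fun A hA => ⟨(exists_isBase_active (v := v) (U := U) ord
      (Finset.mem_powerset.1 (Finset.mem_filter.1 hA).1) (Finset.mem_filter.1 hA).2).choose,
      A \ (exists_isBase_active (v := v) (U := U) ord
      (Finset.mem_powerset.1 (Finset.mem_filter.1 hA).1) (Finset.mem_filter.1 hA).2).choose⟩)
    ?_ ?_ ?_ ?_ ?_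
  · rintro ⟨T, B⟩ hp
    simp only [Finset.mem_sigma, Finset.mem_filter, Finset.mem_powerset] at hp ⊢
    have hsub : T ∪ B ⊆ E := Finset.union_subset hp.1.1
      (hp.2.trans (Finset.filter_subset _ _))
    exact ⟨hsub, hp.1.2.1.mono Finset.subset_union_left fun e he => hE e (hsub he)⟩
  · intro A hA
    simp only [Finset.mem_filter, Finset.mem_powerset] at hA
    have h := (exists_isBase_active (E := E) ord hA.1 hA.2).choose_spec
    simp only [Finset.mem_sigma, Finset.mem_filter, Finset.mem_powerset]
    exact ⟨⟨h.1.trans hA.1, h.2.1⟩, h.2.2⟩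
  · rintro ⟨T, B⟩ hp
    simp only [Finset.mem_sigma, Finset.mem_filter, Finset.mem_powerset] at hp
    have hsub : T ∪ B ⊆ E := Finset.union_subset hp.1.1
      (hp.2.trans (Finset.filter_subset _ _))
    have hspan : SpansAll K v U (T ∪ B) :=
      hp.1.2.1.mono Finset.subset_union_left fun e he => hE e (hsub he)
    have h := (exists_isBase_active (E := E) ord hsub hspan).choose_spec
    have hdis : Disjoint T B := by
      rw [Finset.disjoint_left]
      intro e he heB
      have := hp.2 heB
      simp only [activeSet, Finset.mem_filter] at this
      exact this.2.1 he
    have hdiff : (T ∪ B) \ T = B := by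
      rw [Finset.union_sdiff_left, Finset.sdiff_eq_self_of_disjoint hdis.symm]
    have heq := isBase_active_unique ord h.1 h.2.1 h.2.2 Finset.subset_union_left hp.1.2
      (by rw [hdiff]; exact hp.2)
    dsimp only
    rw [heq, hdiff]
  · intro A hA
    simp only [Finset.mem_filter, Finset.mem_powerset] at hA
    exact Finset.union_sdiff_of_subset
      (exists_isBase_active (E := E) ord hA.1 hA.2).choose_spec.1
  · rintro ⟨T, B⟩ hp
    simp only [Finset.mem_sigma, Finset.mem_filter, Finset.mem_powerset] at hp
    have hdis : Disjoint T B := by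
      rw [Finset.disjoint_left]
      intro e he heB
      have := hp.2 heB
      simp only [activeSet, Finset.mem_filter] at this
      exact this.2.1 he
    dsimp only
    rw [Finset.card_union_of_disjoint hdis, hp.1.2.2, Nat.add_sub_cancel_left]

end Activity

/-! ### Connected spanning subgraphs of multigraphs -/

section Cycle

open Classical

variable {α β : Type*} (G : Graph α β)

/-- Walk-free form of connectivity: a set that no edge leaves is empty or full. It matches both the
vanishing of linear forms on boundaries and the stable sets of coordinates of a flag. -/
lemma connectedBy_iff_saturated (A : Set β) :
    ConnectedBy G A ↔ Nonempty G.vertexSet ∧ ∀ S : Set G.vertexSet,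
      (∀ e ∈ A, ∀ x y : G.vertexSet, G.IsLink e x y → (x ∈ S ↔ y ∈ S)) →
        ∀ x y, x ∈ S → y ∈ S := by
  unfold ConnectedBy
  rw [SimpleGraph.connected_iff, and_comm]
  refine and_congr_right fun _ => ⟨fun h S hS x y hx => ?_, fun h x y => ?_⟩
  · obtain ⟨p⟩ := h x y
    induction p with
    | nil => exact hx
    | cons hadj p ih =>
      apply ih
      rw [spanningSubgraph, SimpleGraph.fromRel_adj] at hadj
      rcases hadj.2 with ⟨e, he, hl⟩ | ⟨e, he, hl⟩
      · exact (hS e he _ _ hl).1 hx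
      · exact (hS e he _ _ hl).2 hx
  · refine h {z | (spanningSubgraph G A).Reachable x z} ?_ x y (SimpleGraph.Reachable.refl _)
    intro e he u v huv
    by_cases huv' : u = v
    · rw [huv']
    have hadj : (spanningSubgraph G A).Adj u v := by
      rw [spanningSubgraph, SimpleGraph.fromRel_adj]
      exact ⟨huv', Or.inl ⟨e, he, huv⟩⟩
    exact ⟨fun hu => hu.trans hadj.reachable, fun hv => hv.trans hadj.symm.reachable⟩

lemma ConnectedBy.mono {A B : Set β} (h : ConnectedBy G A) (hAB : A ⊆ B) : ConnectedBy G B := by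
  rw [connectedBy_iff_saturated] at h ⊢
  exact ⟨h.1, fun S hS => h.2 S fun e he => hS e (hAB he)⟩

lemma numComponents_eq_one_iff [Finite G.vertexSet] (A : Set β) :
    numComponents G A = 1 ↔ ConnectedBy G A := by
  unfold numComponents ConnectedBy
  rw [Nat.card_eq_one_iff_unique, SimpleGraph.connected_iff_exists_forall_reachable]
  constructor
  · rintro ⟨hs, ⟨c⟩⟩
    induction c using SimpleGraph.ConnectedComponent.ind with
    | h v => exact ⟨v, fun w => SimpleGraph.ConnectedComponent.exact (Subsingleton.elim _ _)⟩
  · rintro ⟨v, hv⟩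
    refine ⟨⟨fun a b => ?_⟩, ⟨(spanningSubgraph G A).connectedComponentMk v⟩⟩
    induction a using SimpleGraph.ConnectedComponent.ind with
    | h x =>
      induction b using SimpleGraph.ConnectedComponent.ind with
      | h y => exact SimpleGraph.ConnectedComponent.sound ((hv x).symm.trans (hv y))

/-- The boundary of an edge, for some orientation. -/
def boundary (e : β) : G.vertexSet → ℚ :=
  if h : ∃ p : G.vertexSet × G.vertexSet, G.IsLink e p.1 p.2 then
    Pi.single h.choose.1 1 - Pi.single h.choose.2 1 else 0

/-- The chosen end points may come in either order, so the boundary is determined only up to a sign,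
which spans do not see. -/
lemma boundary_eq {e : β} {x y : G.vertexSet} (h : G.IsLink e x y) :
    boundary G e = Pi.single x 1 - Pi.single y 1 ∨
      boundary G e = Pi.single y 1 - Pi.single x 1 := by
  have hex : ∃ p : G.vertexSet × G.vertexSet, G.IsLink e p.1 p.2 := ⟨(x, y), h⟩
  rw [boundary, dif_pos hex]
  have hs := hex.choose_spec
  generalize hex.choose = p at hs
  have h1 := G.eq_or_eq_of_isLink_of_isLink hs h
  have h2 := G.eq_or_eq_of_isLink_of_isLink h hs
  have hs' : G.IsLink e p.2 p.1 :=
    (G.isLink_symm ((G.edge_mem_iff_exists_isLink e).2 ⟨_, _, hs⟩)).symm _ _ hs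
  have h' : G.IsLink e y x :=
    (G.isLink_symm ((G.edge_mem_iff_exists_isLink e).2 ⟨_, _, hs⟩)).symm _ _ h
  have h3 := G.eq_or_eq_of_isLink_of_isLink hs' h
  have h4 := G.eq_or_eq_of_isLink_of_isLink h' hs
  simp only [Subtype.coe_inj] at h1 h2 h3 h4
  obtain ⟨p1, p2⟩ := p
  dsimp only at *
  rcases h1 with rfl | rfl <;> rcases h3 with rfl | rfl <;> simp_all

variable [Fintype G.vertexSet]

/-- The sum of the coordinates. -/
def coordSum : (G.vertexSet → ℚ) →ₗ[ℚ] ℚ := ∑ x, LinearMap.proj x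

lemma coordSum_apply (z : G.vertexSet → ℚ) : coordSum G z = ∑ x, z x := by
  simp [coordSum]

lemma boundary_mem (e : β) : boundary G e ∈ LinearMap.ker (coordSum G) := by
  rw [LinearMap.mem_ker, coordSum_apply, boundary]
  split_ifs <;> simp

lemma finrank_ker_coordSum [Nonempty G.vertexSet] :
    Module.finrank ℚ (LinearMap.ker (coordSum G)) + 1 = Nat.card G.vertexSet := by
  have h := LinearMap.finrank_range_add_finrank_ker (coordSum G)
  have hs : LinearMap.range (coordSum G) = ⊤ := by
    rw [LinearMap.range_eq_top]
    intro c
    obtain ⟨x⟩ := ‹Nonempty G.vertexSet›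
    exact ⟨Pi.single x c, by simp [coordSum_apply]⟩
  rw [hs, finrank_top, Module.finrank_self, Module.finrank_pi] at h
  rw [Nat.card_eq_fintype_card]
  omega

/-- A saturated set `S` gives the linear form summing the coordinates in `S`. It kills all
boundaries, hence the whole sum-zero space, hence `S` cannot separate two vertices. Conversely
connectivity puts every difference of two unit vectors into the span, and these differences
generate. -/
lemma spansAll_iff_connectedBy [Nonempty G.vertexSet] (A : Finset β)
    (hA : (A : Set β) ⊆ G.edgeSet) :
    SpansAll ℚ (boundary G) (LinearMap.ker (coordSum G)) A ↔ ConnectedBy G (A : Set β) := by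
  rw [connectedBy_iff_saturated]
  constructor
  · intro h
    refine ⟨inferInstance, fun S hS x y hx => ?_⟩
    by_contra hy
    let L : (G.vertexSet → ℚ) →ₗ[ℚ] ℚ := ∑ z ∈ Finset.univ.filter (· ∈ S), LinearMap.proj z
    have hL : ∀ z w : G.vertexSet, L (Pi.single z 1 - Pi.single w 1) =
        (if z ∈ S then 1 else 0) - (if w ∈ S then 1 else 0) := by
      intro z w
      simp [L, Finset.sum_sub_distrib, Pi.single_apply]
    have h1 : LinearMap.ker (coordSum G) ≤ LinearMap.ker L := by
      rw [← h, Submodule.span_le]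
      rintro _ ⟨e, he, rfl⟩
      obtain ⟨u, v, huv⟩ := (G.edge_mem_iff_exists_isLink e).1 (hA he)
      have hu := G.left_mem_of_isLink huv
      have hv := G.left_mem_of_isLink ((G.isLink_symm (hA he)).symm _ _ huv)
      have hiff := hS e he ⟨u, hu⟩ ⟨v, hv⟩ huv
      rw [SetLike.mem_coe, LinearMap.mem_ker]
      rcases boundary_eq G (x := ⟨u, hu⟩) (y := ⟨v, hv⟩) huv with h2 | h2 <;>
        rw [h2, hL] <;> simp [hiff]
    have h2 : (Pi.single x 1 - Pi.single y 1 : G.vertexSet → ℚ) ∈ LinearMap.ker (coordSum G) := by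
      simp [coordSum_apply]
    have h3 := h1 h2
    rw [LinearMap.mem_ker, hL] at h3
    simp [hx, hy] at h3
  · rintro ⟨-, h⟩
    apply le_antisymm
    · rw [Submodule.span_le]
      rintro _ ⟨e, -, rfl⟩
      exact boundary_mem G e
    · obtain ⟨x₀⟩ := ‹Nonempty G.vertexSet›
      set W := Submodule.span ℚ (boundary G '' (A : Set β))
      have hall : ∀ y, (Pi.single y 1 - Pi.single x₀ 1 : G.vertexSet → ℚ) ∈ W := by
        intro y
        -- The vertices whose difference to `x₀` lies in the span form a saturated set containing
        -- `x₀`.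
        refine h {y | (Pi.single y 1 - Pi.single x₀ 1 : G.vertexSet → ℚ) ∈ W} ?_ x₀ y ?_
        · intro e he u v huv
          have hm : boundary G e ∈ W := Submodule.subset_span ⟨e, he, rfl⟩
          have hd : (Pi.single u 1 - Pi.single v 1 : G.vertexSet → ℚ) ∈ W := by
            rcases boundary_eq G huv with h2 | h2
            · rwa [h2] at hm
            · rw [h2] at hm
              simpa using W.neg_mem hm
          constructor
          · intro hu
            have := W.sub_mem hu hd
            simpa using this
          · intro hv
            have := W.add_mem hv hd
            simpa using this
        · simp
      intro z hz
      rw [LinearMap.mem_ker, coordSum_apply] at hz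
      -- The terms at the base point `x₀` cancel because the coordinates of `z` sum to zero.
      have hz' : z = ∑ y, z y • (Pi.single y 1 - Pi.single x₀ 1 : G.vertexSet → ℚ) := by
        simp only [smul_sub, Finset.sum_sub_distrib, ← Finset.sum_smul, hz, zero_smul, sub_zero]
        ext w
        simp [Pi.single_apply]
      rw [hz']
      exact W.sum_mem fun y _ => W.smul_mem _ (hall y)

variable [Fintype β]

omit [Fintype G.vertexSet] in
lemma edgeSubsets_eq : edgeSubsets G =
    (Finset.univ.filter fun e => e ∈ G.edgeSet).powerset := by
  ext A
  simp only [edgeSubsets, Finset.mem_filter, Finset.mem_univ, true_and, Finset.mem_powerset]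
  constructor
  · intro h e he
    simpa using h he
  · intro h e he
    simpa using h he

omit [Fintype G.vertexSet] in
lemma mem_edgeSubsets (A : Finset β) : A ∈ edgeSubsets G ↔ (A : Set β) ⊆ G.edgeSet := by
  simp [edgeSubsets]

lemma mem_spanningTrees_iff [Nonempty G.vertexSet] (A : Finset β)
    (hA : (A : Set β) ⊆ G.edgeSet) :
    A ∈ spanningTrees G ↔ IsBase ℚ (boundary G) (LinearMap.ker (coordSum G)) A := by
  simp only [spanningTrees, Finset.mem_filter, mem_edgeSubsets, hA, true_and, IsBase,
    spansAll_iff_connectedBy G A hA, ← finrank_ker_coordSum G, Nat.add_right_cancel_iff]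

/-- Removing `f` from the tree with `e` added leaves a tree exactly when it leaves a base, so the
fundamental cycle is the circuit used for matroid activity. -/
lemma externalActivity_eq [Nonempty G.vertexSet] (ord : LinearOrder β) (A : Finset β)
    (hA : (A : Set β) ⊆ G.edgeSet) :
    externalActivity G ord A = (activeSet ℚ (boundary G) (LinearMap.ker (coordSum G))
      (Finset.univ.filter fun e => e ∈ G.edgeSet) ord A).card := by
  unfold externalActivity activeSet
  congr 1
  ext e
  simp only [Finset.mem_filter, Finset.mem_univ, true_and]
  refine and_congr_right fun he => and_congr_right fun heA => forall_congr' fun f => ?_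
  have hsub : (((insert e A).erase f : Finset β) : Set β) ⊆ G.edgeSet := by
    intro g hg
    have := Finset.mem_of_mem_erase (Finset.mem_coe.1 hg)
    rcases Finset.mem_insert.1 this with rfl | h
    · exact he
    · exact hA h
  simp only [fundamentalCycle, Finset.mem_filter, and_imp]
  refine imp_congr (by simp) (imp_congr ?_ Iff.rfl)
  convert mem_spanningTrees_iff G _ hsub

/-- The generating function of connected spanning subgraphs by first Betti number is the
generating function of spanning trees by external activity. -/
theorem bettiSum_eq_sum_externalActivity [Nonempty G.vertexSet] (ord : LinearOrder β) :
    bettiSum G = ∑ A ∈ spanningTrees G, (X : ℤ[X]) ^ externalActivity G ord A := by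
  have h := sum_spansAll_eq_sum_isBase (K := ℚ) (v := boundary G)
    (U := LinearMap.ker (coordSum G)) (X : ℤ[X]) (Finset.univ.filter fun e => e ∈ G.edgeSet)
    (fun e _ => boundary_mem G e) ord
  have hE : ∀ A ∈ (Finset.univ.filter fun e => e ∈ G.edgeSet).powerset,
      (A : Set β) ⊆ G.edgeSet := by
    intro A hA
    rwa [← edgeSubsets_eq, mem_edgeSubsets] at hA
  unfold bettiSum
  rw [edgeSubsets_eq]
  calc _ = _ := ?_
    _ = _ := h
    _ = _ := ?_
  · have : (Finset.univ.filter fun e => e ∈ G.edgeSet).powerset.filter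
          (fun A : Finset β => ConnectedBy G (A : Set β)) =
        (Finset.univ.filter fun e => e ∈ G.edgeSet).powerset.filter
          (fun A => SpansAll ℚ (boundary G) (LinearMap.ker (coordSum G)) A) :=
      Finset.filter_congr fun A hA => (spansAll_iff_connectedBy G A (hE A hA)).symm
    rw [this]
    refine Finset.sum_congr rfl fun A _ => ?_
    rw [← finrank_ker_coordSum G, Nat.add_sub_add_right]
  · have : spanningTrees G = (Finset.univ.filter fun e => e ∈ G.edgeSet).powerset.filter
        (fun A => IsBase ℚ (boundary G) (LinearMap.ker (coordSum G)) A) := by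
      ext A
      simp only [Finset.mem_filter]
      constructor
      · intro hA
        have h1 : A ∈ edgeSubsets G := (Finset.mem_filter.1 hA).1
        have h2 := (mem_edgeSubsets G A).1 h1
        rw [edgeSubsets_eq] at h1
        exact ⟨h1, (mem_spanningTrees_iff G A h2).1 hA⟩
      · rintro ⟨h1, h2⟩
        exact (mem_spanningTrees_iff G A (hE A h1)).2 h2
    rw [this]
    refine Finset.sum_congr rfl fun A hA => ?_
    rw [externalActivity_eq G ord A (hE A (Finset.mem_filter.1 hA).1)]

omit [Fintype G.vertexSet] in
theorem bettiSum_eq_zero (h : ¬ IsConnected G) : bettiSum G = 0 := by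
  unfold bettiSum
  apply Finset.sum_eq_zero
  intro A hA
  rw [Finset.mem_filter, mem_edgeSubsets] at hA
  exact absurd (ConnectedBy.mono G hA.2 hA.1) h

/-- At x = 1 the first factor is a power of 0 with exponent k(A) - 1, which vanishes unless `A` is
connected. -/
theorem tutteOne_eq_bettiSum (h : IsConnected G) : tutteOne G = bettiSum G := by
  have hk : numComponents G G.edgeSet = 1 := (numComponents_eq_one_iff G _).2 h
  have : Nonempty G.vertexSet := ((connectedBy_iff_saturated G _).1 h).1
  unfold tutteOne tuttePolynomial bettiSum
  rw [map_sum, Finset.sum_filter]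
  refine Finset.sum_congr rfl fun A _ => ?_
  simp only [map_mul, map_pow, map_sub, MvPolynomial.aeval_X, map_one, if_true, sub_self]
  rw [if_neg (by decide), hk]
  by_cases hc : ConnectedBy G (A : Set β)
  · have h1 := (numComponents_eq_one_iff G (A : Set β)).2 hc
    rw [if_pos hc, h1, Nat.sub_self, pow_zero, one_mul, add_comm]
  · have h1 : numComponents G (A : Set β) ≠ 1 :=
      fun h1 => hc ((numComponents_eq_one_iff G _).1 h1)
    have h2 : numComponents G (A : Set β) ≠ 0 := by
      unfold numComponents
      have : Nonempty (spanningSubgraph G (A : Set β)).ConnectedComponent :=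
        ⟨(spanningSubgraph G _).connectedComponentMk (Classical.arbitrary _)⟩
      exact Nat.card_pos.ne'
    rw [if_neg hc, zero_pow (by omega), zero_mul]

end Cycle

/-! ### Echelon normal forms of flags of coordinate spaces -/

section Flags

open Classical

variable {F : Type*} [Field F] {r : ℕ}

/-- The positions of the last non-zero coordinates of the non-zero vectors of `W`. -/
def leads (W : Submodule F (Fin r → F)) : Finset (Fin r) :=
  Finset.univ.filter fun c => ∃ x ∈ W, x c ≠ 0 ∧ ∀ d, c < d → x d = 0

lemma mem_leads {W : Submodule F (Fin r → F)} {c : Fin r} :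
    c ∈ leads W ↔ ∃ x ∈ W, x c ≠ 0 ∧ ∀ d, c < d → x d = 0 := by
  simp [leads]

lemma leads_mono {W W' : Submodule F (Fin r → F)} (h : W ≤ W') : leads W ⊆ leads W' := by
  intro c hc
  obtain ⟨x, hx, h'⟩ := mem_leads.1 hc
  exact mem_leads.2 ⟨x, h hx, h'⟩

lemma exists_mem_leads {W : Submodule F (Fin r → F)} {x : Fin r → F} (hx : x ∈ W) (h0 : x ≠ 0) :
    ∃ c ∈ leads W, x c ≠ 0 := by
  obtain ⟨c₀, hc₀⟩ := Function.ne_iff.1 h0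
  obtain ⟨c, hc, hmax⟩ := Finset.exists_max_image (Finset.univ.filter fun c => x c ≠ 0) id
    ⟨c₀, by simpa using hc₀⟩
  simp only [Finset.mem_filter, Finset.mem_univ, true_and, id] at hc hmax
  refine ⟨c, mem_leads.2 ⟨x, hx, hc, fun d hd => ?_⟩, hc⟩
  by_contra h
  exact absurd (hmax d h) (not_le.2 hd)

/-- Otherwise the last non-zero coordinate of `x - y` would be a lead at which `x` and `y` differ.
-/
lemma eq_of_eqOn_leads {W : Submodule F (Fin r → F)} {x y : Fin r → F} (hx : x ∈ W) (hy : y ∈ W)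
    (h : ∀ c ∈ leads W, x c = y c) : x = y := by
  by_contra hne
  obtain ⟨c, hc, h'⟩ := exists_mem_leads (W.sub_mem hx hy) (sub_ne_zero.2 hne)
  exact h' (by simp [h c hc])

/-! ### Families of vectors with prescribed last non-zero coordinates. -/

section Unitriangular

variable {C : Finset (Fin r)} {u : Fin r → Fin r → F}

/-- Take the largest `c` with `y c ≠ 0`: only `u c` contributes to coordinate `c`, and nothing
reaches beyond it. -/
lemma exists_top_term (hu : ∀ c ∈ C, u c c ≠ 0) (hu' : ∀ c ∈ C, ∀ d, c < d → u c d = 0)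
    (y : Fin r → F) (hy : ∃ c ∈ C, y c ≠ 0) :
    ∃ c ∈ C, (∑ b ∈ C, y b • u b) c ≠ 0 ∧ ∀ d, c < d → (∑ b ∈ C, y b • u b) d = 0 := by
  obtain ⟨c₀, hc₀, hy₀⟩ := hy
  obtain ⟨c, hc, hmax⟩ := Finset.exists_max_image (C.filter fun c => y c ≠ 0) id
    ⟨c₀, by simp [hc₀, hy₀]⟩
  simp only [Finset.mem_filter, id, and_imp] at hc hmax
  have hz : ∀ b ∈ C, ∀ d, c ≤ d → b ≠ d → y b * u b d = 0 := by
    intro b hb d hd hbd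
    by_cases hyb : y b = 0
    · rw [hyb, zero_mul]
    · have h1 := (hmax b hb hyb).trans hd
      rw [hu' b hb d (lt_of_le_of_ne h1 hbd), mul_zero]
  refine ⟨c, hc.1, ?_, fun d hd => ?_⟩
  · rw [Finset.sum_apply, Finset.sum_eq_single_of_mem c hc.1]
    · simpa using ⟨hc.2, hu c hc.1⟩
    · intro b hb hbc
      simpa using hz b hb c le_rfl hbc
  · rw [Finset.sum_apply]
    refine Finset.sum_eq_zero fun b hb => ?_
    by_cases hbd : b = d
    · subst hbd
      have : y b = 0 := by
        by_contra h
        exact absurd (hmax b hb h) (not_le.2 hd)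
      simp [this]
    · simpa using hz b hb d hd.le hbd

lemma leads_span (hu : ∀ c ∈ C, u c c ≠ 0) (hu' : ∀ c ∈ C, ∀ d, c < d → u c d = 0) :
    leads (Submodule.span F (u '' (C : Set (Fin r)))) = C := by
  ext c
  rw [mem_leads]
  constructor
  · rintro ⟨x, hx, hc, hd⟩
    rw [Submodule.mem_span_image_finset_iff_exists_fun] at hx
    obtain ⟨y, hy⟩ := hx
    obtain ⟨y', hy'⟩ : ∃ y' : Fin r → F, ∑ b ∈ C, y' b • u b = x := by
      refine ⟨fun b => if h : b ∈ C then y ⟨b, h⟩ else 0, ?_⟩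
      rw [← Finset.sum_coe_sort, ← hy]
      simp
    have hne : ∃ b ∈ C, y' b ≠ 0 := by
      by_contra! h
      apply hc
      rw [← hy', Finset.sum_apply]
      exact Finset.sum_eq_zero fun b hb => by simp [h b hb]
    obtain ⟨b, hb, h1, h2⟩ := exists_top_term hu hu' y' hne
    rw [hy'] at h1 h2
    rcases lt_trichotomy b c with h | h | h
    · exact absurd (h2 c h) hc
    · exact h ▸ hb
    · exact absurd (hd b h) h1
  · intro hc
    exact ⟨u c, Submodule.subset_span ⟨c, hc, rfl⟩, hu c hc, hu' c hc⟩

lemma linearIndependent_of_triangular (hu : ∀ c ∈ C, u c c ≠ 0)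
    (hu' : ∀ c ∈ C, ∀ d, c < d → u c d = 0) :
    LinearIndependent F (fun c : C => u c) := by
  rw [Fintype.linearIndependent_iff]
  intro g hg
  by_contra! hne
  obtain ⟨⟨c, hc⟩, h⟩ := hne
  have hs : ∑ b ∈ C, (if h : b ∈ C then g ⟨b, h⟩ else 0) • u b = 0 := by
    rw [← Finset.sum_coe_sort, ← hg]
    simp
  obtain ⟨b, -, h1, -⟩ := exists_top_term hu hu' (fun b => if h : b ∈ C then g ⟨b, h⟩ else 0)
    ⟨c, hc, by simpa [hc] using h⟩
  rw [hs] at h1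
  exact h1 rfl

lemma finrank_span_triangular (hu : ∀ c ∈ C, u c c ≠ 0)
    (hu' : ∀ c ∈ C, ∀ d, c < d → u c d = 0) :
    Module.finrank F (Submodule.span F (u '' (C : Set (Fin r)))) = C.card := by
  have h := finrank_span_eq_card (linearIndependent_of_triangular hu hu')
  have hr : Set.range (fun c : C => u c) = u '' (C : Set (Fin r)) := by
    ext; simp
  rw [hr] at h
  simpa using h

end Unitriangular

/-- Restriction to the lead coordinates is injective on `W`, and one vector of `W` for each lead
gives a triangular, hence independent, family. -/
lemma finrank_eq_card_leads (W : Submodule F (Fin r → F)) :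
    Module.finrank F W = (leads W).card := by
  apply le_antisymm
  · let R : W →ₗ[F] (leads W → F) := LinearMap.funLeft F F (Subtype.val) ∘ₗ W.subtype
    have hR : Function.Injective R := by
      intro x y hxy
      refine Subtype.ext (eq_of_eqOn_leads x.2 y.2 fun c hc => ?_)
      exact congrFun hxy ⟨c, hc⟩
    have := LinearMap.finrank_le_finrank_of_injective hR
    simpa using this
  · have h : ∀ c : Fin r, ∃ x : Fin r → F, c ∈ leads W →
        x ∈ W ∧ x c ≠ 0 ∧ ∀ d, c < d → x d = 0 := by
      intro c
      by_cases hc : c ∈ leads W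
      · obtain ⟨x, hx, h⟩ := mem_leads.1 hc
        exact ⟨x, fun _ => ⟨hx, h⟩⟩
      · exact ⟨0, fun h => absurd h hc⟩
    choose u hu using h
    rw [← finrank_span_triangular (C := leads W) (fun c hc => (hu c hc).2.1)
      (fun c hc => (hu c hc).2.2)]
    apply Submodule.finrank_mono
    rw [Submodule.span_le]
    rintro _ ⟨c, hc, rfl⟩
    exact (hu c hc).1

/-- Rows of the reduced echelon form. Restriction to the lead coordinates is bijective on `W`; take
the preimage of a unit vector. Its last non-zero coordinate is a lead, so it must be `c`. -/
lemma exists_reduced {W : Submodule F (Fin r → F)} {c : Fin r} (hc : c ∈ leads W) :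
    ∃ u ∈ W, u c = 1 ∧ (∀ d ∈ leads W, d ≠ c → u d = 0) ∧ ∀ d, c < d → u d = 0 := by
  let R : W →ₗ[F] (leads W → F) := LinearMap.funLeft F F (Subtype.val) ∘ₗ W.subtype
  have hR : Function.Injective R := by
    intro x y hxy
    refine Subtype.ext (eq_of_eqOn_leads x.2 y.2 fun c hc => ?_)
    exact congrFun hxy ⟨c, hc⟩
  have hS : Function.Surjective R := by
    rw [← LinearMap.injective_iff_surjective_of_finrank_eq_finrank]
    · exact hR
    · rw [finrank_eq_card_leads]
      simp
  obtain ⟨⟨u, hu⟩, h⟩ := hS (Pi.single ⟨c, hc⟩ 1)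
  have hval : ∀ d (hd : d ∈ leads W), u d = (Pi.single ⟨c, hc⟩ 1 : leads W → F) ⟨d, hd⟩ :=
    fun d hd => congrFun h ⟨d, hd⟩
  have h1 : u c = 1 := by rw [hval c hc, Pi.single_eq_same]
  have h2 : ∀ d ∈ leads W, d ≠ c → u d = 0 := by
    intro d hd hdc
    rw [hval d hd, Pi.single_eq_of_ne]
    simpa using hdc
  refine ⟨u, hu, h1, h2, ?_⟩
  obtain ⟨e, he, hmax⟩ := Finset.exists_max_image (Finset.univ.filter fun d => u d ≠ 0) id
    ⟨c, by simp [h1]⟩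
  simp only [Finset.mem_filter, Finset.mem_univ, true_and, id] at he hmax
  have hel : e ∈ leads W := mem_leads.2 ⟨u, hu, he, fun d hd => by
    by_contra h
    exact absurd (hmax d h) (not_le.2 hd)⟩
  have hec : e = c := by
    by_contra h
    exact he (h2 e hel h)
  intro d hd
  by_contra h
  exact absurd (hmax d h) (not_le.2 (hec ▸ hd))

variable {Λ : Type*} (ρ : Λ → ℕ) (m : Λ → ℕ)

/-- Flags of type `m`, with steps ordered by `ρ`. -/
structure IsFlag [Fintype Λ] (E : Λ → Submodule F (Fin r → F)) : Prop where
  mono : ∀ a b, ρ a ≤ ρ b → E a ≤ E b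
  finrank : ∀ a, Module.finrank F (E a) = ∑ b with ρ b ≤ ρ a, m b

/-- Words of content `m` together with coordinates on their inversions. -/
structure IsNormal (x : (Fin r → Λ) × (Fin r → Fin r → F)) : Prop where
  content : ∀ b, (Finset.univ.filter fun c => x.1 c = b).card = m b
  supp : ∀ c d, x.2 c d ≠ 0 → d < c ∧ ρ (x.1 c) < ρ (x.1 d)

/-- The rows of the normal form. -/
def normalVec (f : Fin r → Fin r → F) (c : Fin r) : Fin r → F := Pi.single c 1 + f c

/-- The flag with the given normal form. -/
def normalFlag (x : (Fin r → Λ) × (Fin r → Fin r → F)) (a : Λ) : Submodule F (Fin r → F) :=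
  Submodule.span F (normalVec x.2 ''
    ((Finset.univ.filter fun c => ρ (x.1 c) ≤ ρ a : Finset (Fin r)) : Set (Fin r)))

/-- The flag is stable under the projection to the coordinates in `S`. -/
def FlagStable (E : Λ → Submodule F (Fin r → F)) (S : Set (Fin r)) : Prop :=
  ∀ a, ∀ x ∈ E a, S.indicator x ∈ E a

variable {ρ m}

namespace IsNormal

variable {x y : (Fin r → Λ) × (Fin r → Fin r → F)}

lemma diag (hx : IsNormal ρ m x) (c : Fin r) : x.2 c c = 0 := by
  by_contra h
  exact lt_irrefl _ (hx.supp c c h).1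

lemma normalVec_self (hx : IsNormal ρ m x) (c : Fin r) : normalVec x.2 c c = 1 := by
  simp [normalVec, hx.diag c]

lemma normalVec_of_lt (hx : IsNormal ρ m x) {c d : Fin r} (h : c < d) :
    normalVec x.2 c d = 0 := by
  have : x.2 c d = 0 := by
    by_contra h'
    exact absurd (hx.supp c d h').1 (not_lt.2 h.le)
  simp [normalVec, this, Pi.single_eq_of_ne h.ne']

lemma normalVec_of_le (hx : IsNormal ρ m x) {c d : Fin r} (hcd : d ≠ c)
    (h : ρ (x.1 d) ≤ ρ (x.1 c)) : normalVec x.2 c d = 0 := by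
  have : x.2 c d = 0 := by
    by_contra h'
    exact absurd (hx.supp c d h').2 (not_lt.2 h)
  simp [normalVec, this, Pi.single_eq_of_ne hcd]

lemma leads_normalFlag (hx : IsNormal ρ m x) (a : Λ) :
    leads (normalFlag ρ x a) = Finset.univ.filter fun c => ρ (x.1 c) ≤ ρ a :=
  leads_span (fun c _ => by simp [hx.normalVec_self c]) fun _ _ _ hd => hx.normalVec_of_lt hd

lemma normalVec_mem (x : (Fin r → Λ) × (Fin r → Fin r → F)) {c : Fin r} {a : Λ}
    (h : ρ (x.1 c) ≤ ρ a) : normalVec x.2 c ∈ normalFlag ρ x a :=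
  Submodule.subset_span ⟨c, by simpa using h, rfl⟩

lemma isFlag [Fintype Λ] (hx : IsNormal ρ m x) : IsFlag ρ m (normalFlag ρ x) where
  mono a b hab := by
    refine Submodule.span_mono (Set.image_mono fun c hc => ?_)
    simp only [Finset.coe_filter, Finset.mem_univ, true_and, Set.mem_ofPred_eq] at hc ⊢
    exact hc.trans hab
  finrank a := by
    rw [finrank_eq_card_leads, hx.leads_normalFlag,
      Finset.card_eq_sum_card_fiberwise (f := x.1)
        (t := Finset.univ.filter fun b => ρ b ≤ ρ a)]
    · refine Finset.sum_congr rfl fun b hb => ?_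
      rw [← hx.content b, Finset.filter_filter]
      congr 1
      ext c
      simp only [Finset.mem_filter, Finset.mem_univ, true_and] at hb ⊢
      exact ⟨fun h => h.2, fun h => ⟨h ▸ hb, h⟩⟩
    · intro c hc
      simpa using hc

/-- The leads of a step are the positions whose letter does not exceed that step, so the flag
determines the word. A row is then the only vector of its step with the given values at the leads.
-/
lemma eq_of_normalFlag_eq (hρ : Function.Injective ρ) (hx : IsNormal ρ m x) (hy : IsNormal ρ m y)
    (h : normalFlag ρ x = normalFlag ρ y) : x = y := by
  have hl : ∀ c a, ρ (x.1 c) ≤ ρ a ↔ ρ (y.1 c) ≤ ρ a := by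
    intro c a
    have := hx.leads_normalFlag a
    rw [h, hy.leads_normalFlag a] at this
    have := Finset.ext_iff.1 this c
    simpa using this.symm
  have h1 : x.1 = y.1 := by
    funext c
    exact hρ (le_antisymm ((hl c _).2 le_rfl) ((hl c _).1 le_rfl))
  refine Prod.ext h1 ?_
  have h2 : ∀ c, normalVec x.2 c = normalVec y.2 c := by
    intro c
    have hxm := normalVec_mem (ρ := ρ) x (le_refl (ρ (x.1 c)))
    have hym := normalVec_mem (ρ := ρ) y (c := c) (a := x.1 c) (by rw [h1])
    rw [← h] at hym
    refine eq_of_eqOn_leads hxm hym fun d hd => ?_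
    rw [hx.leads_normalFlag] at hd
    simp only [Finset.mem_filter, Finset.mem_univ, true_and] at hd
    by_cases hdc : d = c
    · rw [hdc, hx.normalVec_self, hy.normalVec_self]
    · rw [hx.normalVec_of_le hdc hd, hy.normalVec_of_le hdc (by rwa [h1] at hd)]
  funext c
  have := h2 c
  simpa [normalVec] using this

/-- On the leads of its own step row `c` is a unit vector. If the step is stable, the projected row
therefore equals the row (for `c ∈ S`) or zero (for `c ∉ S`), so no non-zero entry crosses `S`.
Conversely, if no entry crosses, every row lies entirely inside or outside `S`. -/
lemma flagStable_iff (hx : IsNormal ρ m x) (S : Set (Fin r)) :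
    FlagStable (normalFlag ρ x) S ↔ ∀ c d, x.2 c d ≠ 0 → (c ∈ S ↔ d ∈ S) := by
  constructor
  · intro hS c d hcd
    by_contra hne
    have hdc : d ≠ c := by rintro rfl; exact hne Iff.rfl
    have hm := normalVec_mem (ρ := ρ) x (le_refl (ρ (x.1 c)))
    have hi := hS _ _ hm
    by_cases hc : c ∈ S
    · have hd : d ∉ S := fun h => hne (by simp [hc, h])
      have heq := eq_of_eqOn_leads hm hi fun e he => by
        rw [hx.leads_normalFlag] at he
        simp only [Finset.mem_filter, Finset.mem_univ, true_and] at he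
        by_cases hec : e = c
        · rw [hec, Set.indicator_of_mem hc]
        · rw [Set.indicator_apply, hx.normalVec_of_le hec he, ite_self]
      have := congrFun heq d
      rw [Set.indicator_of_notMem hd] at this
      simp [normalVec, Pi.single_eq_of_ne hdc, hcd] at this
    · have hd : d ∈ S := by
        by_contra h
        exact hne (by simp [hc, h])
      have heq := eq_of_eqOn_leads hi (Submodule.zero_mem _) fun e he => by
        rw [hx.leads_normalFlag] at he
        simp only [Finset.mem_filter, Finset.mem_univ, true_and] at he
        by_cases hec : e = c
        · rw [hec, Set.indicator_of_notMem hc, Pi.zero_apply]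
        · rw [Set.indicator_apply, hx.normalVec_of_le hec he, ite_self, Pi.zero_apply]
      have := congrFun heq d
      rw [Set.indicator_of_mem hd] at this
      simp [normalVec, Pi.single_eq_of_ne hdc, hcd] at this
  · intro h a z hz
    refine Submodule.span_induction (p := fun z _ => S.indicator z ∈ normalFlag ρ x a)
      ?_ ?_ ?_ ?_ hz
    · rintro _ ⟨c, hc, rfl⟩
      have hm : normalVec x.2 c ∈ normalFlag ρ x a := Submodule.subset_span ⟨c, hc, rfl⟩
      have hnz : ∀ d, normalVec x.2 c d ≠ 0 → (c ∈ S ↔ d ∈ S) := by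
        intro d hd
        by_cases hdc : d = c
        · rw [hdc]
        · apply h
          simpa [normalVec, Pi.single_eq_of_ne hdc] using hd
      by_cases hcS : c ∈ S
      · have : S.indicator (normalVec x.2 c) = normalVec x.2 c := by
          rw [Set.indicator_eq_self]
          exact fun d hd => (hnz d hd).1 hcS
        rwa [this]
      · have : S.indicator (normalVec x.2 c) = 0 := by
          rw [Set.indicator_eq_zero', Set.disjoint_left]
          exact fun d hd hdS => hcS ((hnz d hd).2 hdS)
        rw [this]
        exact Submodule.zero_mem _
    · simp
    · intro u v _ _ hu hv
      rw [Set.indicator_add']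
      exact Submodule.add_mem _ hu hv
    · intro t u _ hu
      have : S.indicator (t • u) = t • S.indicator u := by
        ext d
        by_cases hd : d ∈ S <;> simp [hd]
      rw [this]
      exact Submodule.smul_mem _ _ hu

end IsNormal

/-- The letter of a position is the first step having it as a lead, and its row is the reduced
vector of that step. -/
lemma exists_isNormal [Fintype Λ] (hρ : Function.Injective ρ) (hm : ∑ b, m b = r)
    {E : Λ → Submodule F (Fin r → F)} (hE : IsFlag ρ m E) :
    ∃ x, IsNormal ρ m x ∧ normalFlag ρ x = E := by
  have hex : ∀ c : Fin r, ∃ a, c ∈ leads (E a) ∧ ∀ b, c ∈ leads (E b) → ρ a ≤ ρ b := by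
    intro c
    have hne : (Finset.univ : Finset Λ).Nonempty := by
      rw [Finset.nonempty_iff_ne_empty]
      intro h
      rw [h, Finset.sum_empty] at hm
      exact absurd c.2 (by omega)
    obtain ⟨a, -, ha⟩ := Finset.exists_max_image _ ρ hne
    -- The largest step is the whole space because the parts add up to `r`; so every position is a
    -- lead of some step.
    have htop : Finset.univ = leads (E a) := by
      symm
      rw [← Finset.card_eq_iff_eq_univ, ← finrank_eq_card_leads, hE.finrank, Fintype.card_fin,
        ← hm]
      congr 1
      ext b
      simp [ha b (Finset.mem_univ b)]
    obtain ⟨a', ha', hmin⟩ := Finset.exists_min_image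
      (Finset.univ.filter fun a => c ∈ leads (E a)) ρ ⟨a, by simp [← htop]⟩
    simp only [Finset.mem_filter, Finset.mem_univ, true_and] at ha' hmin
    exact ⟨a', ha', hmin⟩
  choose lam hlam hmin using hex
  choose u hu hu1 hu2 hu3 using fun c => exists_reduced (hlam c)
  have hleads : ∀ a, leads (E a) = Finset.univ.filter fun c => ρ (lam c) ≤ ρ a := by
    intro a
    ext c
    simp only [Finset.mem_filter, Finset.mem_univ, true_and]
    exact ⟨hmin c a, fun h => leads_mono (hE.mono _ _ h) (hlam c)⟩
  have hvec : normalVec (fun c => u c - Pi.single c 1) = u := by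
    funext c
    simp [normalVec]
  refine ⟨(lam, fun c => u c - Pi.single c 1), ⟨?_, ?_⟩, ?_⟩
  · have hsum : ∀ a, ∑ b with ρ b ≤ ρ a, (Finset.univ.filter fun c => lam c = b).card =
        ∑ b with ρ b ≤ ρ a, m b := by
      intro a
      rw [← hE.finrank, finrank_eq_card_leads, hleads]
      rw [Finset.card_eq_sum_card_fiberwise (f := lam)
        (t := Finset.univ.filter fun b => ρ b ≤ ρ a)]
      · refine Finset.sum_congr rfl fun b hb => ?_
        rw [Finset.filter_filter]
        congr 1
        ext c
        simp only [Finset.mem_filter, Finset.mem_univ, true_and] at hb ⊢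
        exact ⟨fun h => ⟨h ▸ hb, h⟩, fun h => h.2⟩
      · intro c hc
        simpa using hc
    intro b
    dsimp only
    induction hn : ρ b using Nat.strong_induction_on generalizing b with
    | h n ih =>
      subst hn
      have h := hsum b
      have hb : b ∈ Finset.univ.filter fun b' => ρ b' ≤ ρ b := by simp
      rw [← Finset.add_sum_erase _ _ hb, ← Finset.add_sum_erase _ _ hb] at h
      have h' : ∑ b' ∈ (Finset.univ.filter fun b' => ρ b' ≤ ρ b).erase b,
          (Finset.univ.filter fun c => lam c = b').card =
          ∑ b' ∈ (Finset.univ.filter fun b' => ρ b' ≤ ρ b).erase b, m b' := by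
        refine Finset.sum_congr rfl fun b' hb' => ?_
        simp only [Finset.mem_erase, Finset.mem_filter, Finset.mem_univ, true_and] at hb'
        exact ih (ρ b') (lt_of_le_of_ne hb'.2 fun h => hb'.1 (hρ h)) b' rfl
      omega
  · intro c d hcd
    dsimp only at hcd ⊢
    have hdc : d ≠ c := by
      rintro rfl
      simp [hu1] at hcd
    have hcd' : u c d ≠ 0 := by simpa [Pi.single_eq_of_ne hdc] using hcd
    constructor
    · by_contra h
      exact hcd' (hu3 c d (lt_of_le_of_ne (not_lt.1 h) hdc.symm))
    · by_contra h
      refine hcd' (hu2 c d ?_ hdc)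
      rw [hleads]
      simpa using h
  · funext a
    unfold normalFlag
    dsimp only
    rw [hvec]
    apply Submodule.eq_of_le_of_finrank_eq
    · rw [Submodule.span_le]
      rintro _ ⟨c, hc, rfl⟩
      simp only [Finset.coe_filter, Finset.mem_univ, true_and, Set.mem_ofPred_eq] at hc
      exact hE.mono _ _ hc (hu c)
    · rw [finrank_span_triangular (fun c _ => by simp [hu1]) (fun c _ => hu3 c),
        finrank_eq_card_leads, hleads]

end Flags

/-! ### Inversions of words -/

section Words

open Classical

/-- The `q`-integer `1 + q + ⋯ + q ^ (n - 1)`. -/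
def qInt (q n : ℕ) : ℕ := ∑ i ∈ Finset.range n, q ^ i

/-- The `q`-factorial. -/
def qFactorial (q n : ℕ) : ℕ := ∏ i ∈ Finset.range n, qInt q (i + 1)

lemma qInt_zero (q : ℕ) : qInt q 0 = 0 := by simp [qInt]

lemma qInt_add (q x y : ℕ) : qInt q (x + y) = qInt q x + q ^ x * qInt q y := by
  simp [qInt, Finset.sum_range_add, Finset.mul_sum, pow_add]

lemma qInt_pos {q n : ℕ} (hn : 0 < n) : 0 < qInt q n :=
  Finset.sum_pos' (fun _ _ => Nat.zero_le _) ⟨0, by simpa using hn, by simp⟩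

lemma qFactorial_succ (q n : ℕ) : qFactorial q (n + 1) = qInt q (n + 1) * qFactorial q n := by
  rw [qFactorial, Finset.prod_range_succ, mul_comm, qFactorial]

lemma qFactorial_pos (q n : ℕ) : 0 < qFactorial q n :=
  Finset.prod_pos fun _ _ => qInt_pos (Nat.succ_pos _)

variable {P Λ : Type*} (ρ : Λ → ℕ)

/-- Intervals of lengths `n l`, laid out in the order `ρ`, partition the exponents of the right
side; the interval of `l` starts after those of all smaller letters. -/
lemma sum_qInt (hρ : Function.Injective ρ) (q : ℕ) (n : Λ → ℕ) (s : Finset Λ) :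
    ∑ l ∈ s, q ^ (∑ b ∈ s with ρ b < ρ l, n b) * qInt q (n l) = qInt q (∑ l ∈ s, n l) := by
  induction s using Finset.induction_on_max_value ρ with
  | empty => simp [qInt_zero]
  | insert a s ha hmax ih =>
    have h1 : (insert a s).filter (fun b => ρ b < ρ a) = s := by
      ext b
      simp only [Finset.mem_filter, Finset.mem_insert]
      constructor
      · rintro ⟨rfl | h, h'⟩
        · exact absurd h' (lt_irrefl _)
        · exact h
      · intro h
        refine ⟨Or.inr h, lt_of_le_of_ne (hmax b h) fun h' => ?_⟩
        exact ha (hρ h' ▸ h)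
    have h2 : ∀ l ∈ s, (insert a s).filter (fun b => ρ b < ρ l) =
        s.filter fun b => ρ b < ρ l := by
      intro l hl
      rw [Finset.filter_insert, if_neg (not_lt.2 (hmax l hl))]
    rw [Finset.sum_insert ha, Finset.sum_insert ha, h1, add_comm, add_comm (n a), qInt_add, ← ih]
    congr 1
    exact Finset.sum_congr rfl fun l hl => by rw [h2 l hl]

variable {r : ℕ}

/-- The number of occurrences of each letter of a word on each class of positions. -/
def gradedContent (p : Fin r → P) (lam : Fin r → Λ) (x : P × Λ) : ℕ :=
  ∑ c, if p c = x.1 ∧ lam c = x.2 then 1 else 0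

/-- The size of a class of positions. -/
def classSize (p : Fin r → P) (a : P) : ℕ := ∑ c, if p c = a then 1 else 0

/-- The number of inversions of a word that are contained in a class of positions. -/
def gradedInv (p : Fin r → P) (lam : Fin r → Λ) : ℕ :=
  ∑ c, ∑ d, if d < c ∧ ρ (lam c) < ρ (lam d) ∧ p c = p d then 1 else 0

lemma gradedContent_cons (p : Fin (r + 1) → P) (l : Λ) (lam : Fin r → Λ) (x : P × Λ) :
    gradedContent p (Fin.cons l lam : Fin (r + 1) → Λ) x =
      (if x = (p 0, l) then 1 else 0) + gradedContent (fun c => p c.succ) lam x := by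
  rw [gradedContent, Fin.sum_univ_succ]
  simp only [Fin.cons_zero, Fin.cons_succ, gradedContent]
  congr 1
  obtain ⟨a, b⟩ := x
  simp only [Prod.mk.injEq, eq_comm]

lemma classSize_succ (p : Fin (r + 1) → P) (a : P) :
    classSize p a = (if a = p 0 then 1 else 0) + classSize (fun c => p c.succ) a := by
  rw [classSize, Fin.sum_univ_succ]
  simp only [classSize, eq_comm]

variable [Fintype P] [Fintype Λ]

-- A letter put in front is inverted with exactly the smaller letters behind it in the same class.
omit [Fintype P] in
lemma gradedInv_cons (p : Fin (r + 1) → P) (l : Λ) (lam : Fin r → Λ) :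
    gradedInv ρ p (Fin.cons l lam : Fin (r + 1) → Λ) =
      gradedInv ρ (fun c => p c.succ) lam +
        ∑ b with ρ b < ρ l, gradedContent (fun c => p c.succ) lam (p 0, b) := by
  rw [gradedInv, Fin.sum_univ_succ]
  simp only [Fin.sum_univ_succ, Fin.cons_zero, Fin.cons_succ, Fin.succ_lt_succ_iff, Fin.not_lt_zero,
    false_and, if_false, Finset.sum_const_zero, zero_add, Fin.succ_pos, true_and,
    Finset.sum_add_distrib]
  rw [add_comm]
  congr 1
  unfold gradedContent
  rw [Finset.sum_comm]
  refine Finset.sum_congr rfl fun c _ => ?_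
  by_cases h : p c.succ = p 0
  · simp [h]
  · simp [h]

/-- The generating function of the words of given graded content by inversions is a product of
`q`-multinomial coefficients. -/
lemma sum_gradedInv (hρ : Function.Injective ρ) (q : ℕ) (p : Fin r → P) (n : P × Λ → ℕ) :
    (∑ lam : Fin r → Λ, if gradedContent p lam = n then q ^ gradedInv ρ p lam else 0) *
        ∏ x, qFactorial q (n x) =
      if ∀ a, ∑ b, n (a, b) = classSize p a then ∏ a, qFactorial q (classSize p a) else 0 := by
  induction r generalizing n with
  | zero =>
    rw [Fintype.sum_unique]
    have h1 : gradedContent p (default : Fin 0 → Λ) = 0 := by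
      funext x; simp [gradedContent]
    have h2 : ∀ a, classSize p a = 0 := fun a => by simp [classSize]
    have h3 : (∀ a, ∑ b, n (a, b) = classSize p a) ↔ gradedContent p (default : Fin 0 → Λ) = n := by
      rw [h1]
      constructor
      · intro h
        funext ⟨a, b⟩
        have := h a
        rw [h2, Finset.sum_eq_zero_iff] at this
        exact (this b (Finset.mem_univ b)).symm
      · rintro rfl a
        simp [h2]
    simp only [h3]
    by_cases h : gradedContent p (default : Fin 0 → Λ) = n
    · rw [if_pos h, if_pos h, ← h, h1]
      simp [gradedInv, h2, qFactorial]
    · rw [if_neg h, if_neg h, zero_mul]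
  | succ r ih =>
    set p' : Fin r → P := fun c => p c.succ with hp'
    -- Contribution of the words with first letter `l`. Multiplying by the q-factorials avoids any
    -- division.
    have hterm : ∀ l : Λ,
        (∑ lam : Fin r → Λ, if gradedContent p (Fin.cons l lam : Fin (r + 1) → Λ) = n then
          q ^ gradedInv ρ p (Fin.cons l lam : Fin (r + 1) → Λ) else 0) *
            ∏ x, qFactorial q (n x) =
        q ^ (∑ b with ρ b < ρ l, n (p 0, b)) * qInt q (n (p 0, l)) *
          if ∀ a, ∑ b, n (a, b) = classSize p a then
            ∏ a, qFactorial q (classSize p' a) else 0 := by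
      intro l
      -- If `l` may not occur in the class of position 0, no word starts with it and the q-integer
      -- on the right is 0.
      rcases Nat.eq_zero_or_pos (n (p 0, l)) with h0 | hpos
      · rw [h0, qInt_zero, mul_zero, zero_mul, Finset.sum_eq_zero, zero_mul]
        intro lam _
        rw [if_neg]
        intro h
        have := congrFun h (p 0, l)
        rw [gradedContent_cons, if_pos rfl] at this
        omega
      · set n' : P × Λ → ℕ := Function.update n (p 0, l) (n (p 0, l) - 1) with hn'
        have hnn' : ∀ x, n x = (if x = (p 0, l) then 1 else 0) + n' x := by
          intro x
          by_cases hx : x = (p 0, l)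
          · rw [if_pos hx, hx, hn', Function.update_self]
            omega
          · rw [if_neg hx, hn', Function.update_of_ne hx, zero_add]
        have hiff : ∀ lam : Fin r → Λ,
            gradedContent p (Fin.cons l lam : Fin (r + 1) → Λ) = n ↔ gradedContent p' lam = n' := by
          intro lam
          constructor
          · intro h
            funext x
            have := congrFun h x
            rw [gradedContent_cons, hnn' x] at this
            exact Nat.add_left_cancel this
          · intro h
            funext x
            rw [gradedContent_cons, hnn' x, ← h]
        have hinv : ∀ lam : Fin r → Λ, gradedContent p' lam = n' →
            gradedInv ρ p (Fin.cons l lam : Fin (r + 1) → Λ) =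
              gradedInv ρ p' lam + ∑ b with ρ b < ρ l, n (p 0, b) := by
          intro lam h
          rw [gradedInv_cons]
          congr 1
          refine Finset.sum_congr rfl fun b hb => ?_
          rw [← hp', h, hnn' (p 0, b), if_neg, zero_add]
          intro h'
          simp only [Prod.mk.injEq, true_and] at h'
          simp [h'] at hb
        have hfact : ∏ x, qFactorial q (n x) =
            qInt q (n (p 0, l)) * ∏ x, qFactorial q (n' x) := by
          rw [← Finset.mul_prod_erase _ _ (Finset.mem_univ (p 0, l)),
            ← Finset.mul_prod_erase _ (fun x => qFactorial q (n' x)) (Finset.mem_univ (p 0, l)),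
            ← mul_assoc]
          congr 1
          · have h1 : n (p 0, l) = n' (p 0, l) + 1 := by rw [hnn', if_pos rfl, add_comm]
            rw [h1, qFactorial_succ]
          · refine Finset.prod_congr rfl fun x hx => ?_
            rw [hnn' x, if_neg (Finset.ne_of_mem_erase hx), zero_add]
        have hcompat : (∀ a, ∑ b, n' (a, b) = classSize p' a) ↔
            ∀ a, ∑ b, n (a, b) = classSize p a := by
          refine forall_congr' fun a => ?_
          have h1 : ∑ b, n (a, b) = (if a = p 0 then 1 else 0) + ∑ b, n' (a, b) := by
            simp only [fun b => hnn' (a, b), Finset.sum_add_distrib]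
            congr 1
            by_cases ha : a = p 0 <;> simp [ha]
          rw [h1, classSize_succ, Nat.add_left_cancel_iff]
        simp only [hiff]
        have hsum : (∑ lam : Fin r → Λ, if gradedContent p' lam = n' then
            q ^ gradedInv ρ p (Fin.cons l lam : Fin (r + 1) → Λ) else 0) =
            q ^ (∑ b with ρ b < ρ l, n (p 0, b)) *
              ∑ lam : Fin r → Λ, if gradedContent p' lam = n' then
                q ^ gradedInv ρ p' lam else 0 := by
          rw [Finset.mul_sum]
          refine Finset.sum_congr rfl fun lam _ => ?_
          by_cases h : gradedContent p' lam = n'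
          · rw [if_pos h, if_pos h, hinv lam h, pow_add, mul_comm]
          · rw [if_neg h, if_neg h, mul_zero]
        have := ih p' n'
        simp only [hcompat] at this
        rw [hsum, hfact, ← this]
        ring
    have hsplit : (∑ lam : Fin (r + 1) → Λ, if gradedContent p lam = n then
        q ^ gradedInv ρ p lam else 0) =
        ∑ l : Λ, ∑ lam : Fin r → Λ,
          if gradedContent p (Fin.cons l lam : Fin (r + 1) → Λ) = n then
            q ^ gradedInv ρ p (Fin.cons l lam : Fin (r + 1) → Λ) else 0 := by
      rw [← Fintype.sum_prod_type']
      exact (Fintype.sum_equiv (Fin.consEquiv fun _ => Λ) _ _ fun x => rfl).symm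
    -- Summed over `l`, the q-integers of the letters give that of the size of the class of position
    -- 0, the factor missing from its q-factorial.
    rw [hsplit, Finset.sum_mul, Finset.sum_congr rfl fun l _ => hterm l, ← Finset.sum_mul,
      sum_qInt ρ hρ q (fun b => n (p 0, b)) Finset.univ]
    by_cases hc : ∀ a, ∑ b, n (a, b) = classSize p a
    · rw [if_pos hc, if_pos hc, hc (p 0)]
      rw [← Finset.mul_prod_erase _ _ (Finset.mem_univ (p 0)),
        ← Finset.mul_prod_erase _ (fun a => qFactorial q (classSize p a)) (Finset.mem_univ (p 0)),
        ← mul_assoc]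
      congr 1
      · rw [classSize_succ, if_pos rfl, add_comm, qFactorial_succ]
      · refine Finset.prod_congr rfl fun a ha => ?_
        rw [classSize_succ, if_neg (Finset.ne_of_mem_erase ha), zero_add]
    · rw [if_neg hc, if_neg hc, mul_zero]

/-- The distribution of graded inversions on the words of given content does not depend on the
order of the letters. -/
theorem sum_gradedInv_eq (ρ' : Λ → ℕ) (hρ : Function.Injective ρ) (hρ' : Function.Injective ρ')
    (q : ℕ) (p : Fin r → P) (m : Λ → ℕ) :
    ∑ lam : Fin r → Λ with (∀ b, (Finset.univ.filter fun c => lam c = b).card = m b),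
        q ^ gradedInv ρ p lam =
      ∑ lam : Fin r → Λ with (∀ b, (Finset.univ.filter fun c => lam c = b).card = m b),
        q ^ gradedInv ρ' p lam := by
  have hcont : ∀ (lam : Fin r → Λ) b, (Finset.univ.filter fun c => lam c = b).card =
      ∑ a, gradedContent p lam (a, b) := by
    intro lam b
    unfold gradedContent
    rw [Finset.sum_comm, Finset.card_filter]
    refine Finset.sum_congr rfl fun c _ => ?_
    by_cases h : lam c = b <;> simp [h]
  simp only [hcont]
  -- Split by the graded content `n`. The set of contents that occur does not involve `σ`, and for
  -- each one `sum_gradedInv` gives a value independent of `σ`.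
  have key : ∀ σ : Λ → ℕ, ∑ lam : Fin r → Λ with (∀ b, ∑ a, gradedContent p lam (a, b) = m b),
        q ^ gradedInv σ p lam =
      ∑ n ∈ (Finset.univ.filter fun lam : Fin r → Λ =>
          ∀ b, ∑ a, gradedContent p lam (a, b) = m b).image (gradedContent p),
        ∑ lam : Fin r → Λ, if gradedContent p lam = n then q ^ gradedInv σ p lam else 0 := by
    intro σ
    rw [← Finset.sum_fiberwise_of_maps_to (g := gradedContent p)
      (t := (Finset.univ.filter fun lam : Fin r → Λ =>
          ∀ b, ∑ a, gradedContent p lam (a, b) = m b).image (gradedContent p))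
      (fun lam h => Finset.mem_image_of_mem _ h)]
    refine Finset.sum_congr rfl fun n hn => ?_
    rw [← Finset.sum_filter, Finset.filter_filter]
    refine Finset.sum_congr ?_ fun _ _ => rfl
    ext lam
    simp only [Finset.mem_filter, Finset.mem_univ, true_and, and_iff_right_iff_imp]
    rintro rfl
    obtain ⟨lam', h', h''⟩ := Finset.mem_image.1 hn
    rw [← h'']
    exact (Finset.mem_filter.1 h').2
  rw [key ρ, key ρ']
  refine Finset.sum_congr rfl fun n _ => ?_
  have h1 := sum_gradedInv ρ hρ q p n
  rw [← sum_gradedInv ρ' hρ' q p n] at h1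
  exact Nat.eq_of_mul_eq_mul_right (Finset.prod_pos fun _ _ => qFactorial_pos _ _) h1

end Words

/-! ### Counting connected tuples of normal forms -/

section Counting

open Classical

lemma card_filter_le_eq_add {γ L : Type*} [PartialOrder L] [Fintype L] (C : Finset γ) (u : γ → L)
    (p : L) : (C.filter fun a => u a ≤ p).card = (C.filter fun a => u a = p).card +
      ∑ p' with p' < p, (C.filter fun a => u a = p').card := by
  have h1 : (C.filter fun a => u a ≤ p) =
      (C.filter fun a => u a = p) ∪ C.filter fun a => u a < p := by
    ext a
    simp only [Finset.mem_filter, Finset.mem_union, le_iff_eq_or_lt, and_or_left]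
  have h2 : Disjoint (C.filter fun a => u a = p) (C.filter fun a => u a < p) := by
    rw [Finset.disjoint_filter]
    exact fun a _ h h' => absurd h h'.ne
  rw [h1, Finset.card_union_of_disjoint h2, Nat.add_left_cancel_iff,
    Finset.card_eq_sum_card_fiberwise (f := u) (t := Finset.univ.filter fun p' => p' < p)]
  · refine Finset.sum_congr rfl fun p' hp' => ?_
    rw [Finset.filter_filter]
    congr 1
    ext a
    simp only [Finset.mem_filter, Finset.mem_univ, true_and, and_congr_right_iff,
      and_iff_right_iff_imp] at hp' ⊢
    rintro - rfl
    exact hp'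
  · intro a ha
    simpa using (Finset.mem_filter.1 ha).2

/-- Möbius inversion without a Möbius function: the counts below each element determine, by
induction, the counts at each element. -/
lemma card_filter_eq_of_card_filter_le {α α' L : Type*} [PartialOrder L] [Finite L]
    (A : Finset α) (B : Finset α') (f : α → L) (g : α' → L)
    (h : ∀ p, (A.filter fun a => f a ≤ p).card = (B.filter fun b => g b ≤ p).card) (p : L) :
    (A.filter fun a => f a = p).card = (B.filter fun b => g b = p).card := by
  have _ := Fintype.ofFinite L
  induction p using WellFoundedLT.induction with
  | ind p ih =>
    have h3 := h p
    rw [card_filter_le_eq_add A f, card_filter_le_eq_add B g] at h3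
    have h4 : ∑ p' with p' < p, (A.filter fun a => f a = p').card =
        ∑ p' with p' < p, (B.filter fun b => g b = p').card :=
      Finset.sum_congr rfl fun p' hp' => ih p' (Finset.mem_filter.1 hp').2
    omega

variable {r : ℕ}

instance : Finite (Setoid (Fin r)) :=
  Finite.of_injective (fun s : Setoid (Fin r) => (s : Fin r → Fin r → Prop)) fun s t h => by
    ext a b
    exact iff_of_eq (congrFun (congrFun h a) b)

/-- No proper non-empty set of positions is a union of components of the family of relations. -/
def Linked {ι : Type*} (R : ι → Fin r → Fin r → Prop) : Prop :=
  ∀ S : Set (Fin r), (∀ i c d, R i c d → (c ∈ S ↔ d ∈ S)) → ∀ c d, c ∈ S → d ∈ S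

/-- Expresses linkedness as a condition at the top of the lattice of equivalence relations, where
inversion over set partitions applies. -/
lemma linked_iff {ι : Type*} (R : ι → Fin r → Fin r → Prop) :
    Linked R ↔ Relation.EqvGen.setoid (fun c d => ∃ i, R i c d) = ⊤ := by
  constructor
  · intro h
    rw [eq_top_iff]
    intro c d _
    refine h {d | Relation.EqvGen (fun c d => ∃ i, R i c d) c d} ?_ c d (.refl c)
    intro i a b hab
    exact ⟨fun h => h.trans _ _ _ (.rel _ _ ⟨i, hab⟩),
      fun h => h.trans _ _ _ (.symm _ _ (.rel _ _ ⟨i, hab⟩))⟩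
  · intro h S hS c d hc
    have h1 : Relation.EqvGen.setoid (fun c d => ∃ i, R i c d) ≤ Setoid.ker (· ∈ S) := by
      refine Setoid.eqvGen_le fun a b ⟨i, hab⟩ => ?_
      exact propext (hS i a b hab)
    rw [h] at h1
    have h2 : (c ∈ S) = (d ∈ S) := h1 (x := c) (y := d) trivial
    exact h2 ▸ hc

variable (F : Type*) [Field F] [Fintype F]

omit [Field F] in
lemma card_supported [Zero F] (R : Fin r → Fin r → Prop) :
    (Finset.univ.filter fun f : Fin r → Fin r → F => ∀ c d, f c d ≠ 0 → R c d).card =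
      Fintype.card F ^ ∑ c, ∑ d, if R c d then 1 else 0 := by
  have h : (Finset.univ.filter fun f : Fin r → Fin r → F => ∀ c d, f c d ≠ 0 → R c d) =
      Fintype.piFinset fun c => Fintype.piFinset fun d =>
        if R c d then Finset.univ else {0} := by
    ext f
    simp only [Finset.mem_filter, Finset.mem_univ, true_and, Fintype.mem_piFinset]
    refine forall_congr' fun c => forall_congr' fun d => ?_
    by_cases hR : R c d <;> simp [hR]
  rw [h, Fintype.card_piFinset, ← Finset.prod_pow_eq_pow_sum]
  refine Finset.prod_congr rfl fun c _ => ?_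
  rw [Fintype.card_piFinset, ← Finset.prod_pow_eq_pow_sum]
  refine Finset.prod_congr rfl fun d _ => ?_
  by_cases hR : R c d <;> simp [hR]

/-! ### Normal forms of one flag with entries inside the classes of a partition. -/

section Single

variable {Λ : Type*} [Fintype Λ] (ρ m : Λ → ℕ)

/-- For a fixed word the free entries sit on the inversions inside the classes of `s`. -/
lemma card_isNormal_compatible (s : Setoid (Fin r)) :
    (Finset.univ.filter fun x : (Fin r → Λ) × (Fin r → Fin r → F) =>
        IsNormal ρ m x ∧ ∀ c d, x.2 c d ≠ 0 → s c d).card =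
      ∑ lam : Fin r → Λ with (∀ b, (Finset.univ.filter fun c => lam c = b).card = m b),
        Fintype.card F ^ gradedInv ρ (Quotient.mk s) lam := by
  rw [Finset.card_eq_sum_card_fiberwise (f := Prod.fst)
    (t := Finset.univ.filter fun lam : Fin r → Λ =>
      ∀ b, (Finset.univ.filter fun c => lam c = b).card = m b)]
  · refine Finset.sum_congr rfl fun lam hlam => ?_
    have h0 : gradedInv ρ (Quotient.mk s) lam = ∑ c, ∑ d,
        if d < c ∧ ρ (lam c) < ρ (lam d) ∧ Quotient.mk s c = Quotient.mk s d then 1 else 0 := by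
      unfold gradedInv
      congr!
    have h1 := card_supported F fun c d =>
      d < c ∧ ρ (lam c) < ρ (lam d) ∧ Quotient.mk s c = Quotient.mk s d
    rw [h0]
    refine Eq.trans ?_ (h1.trans (by congr!))
    refine Finset.card_nbij' Prod.snd (fun f => (lam, f)) ?_ ?_ ?_ ?_
    · rintro ⟨lam', f⟩ hx
      simp only [Finset.coe_filter, Finset.mem_filter, Finset.mem_univ, true_and,
        Set.mem_ofPred_eq] at hx ⊢
      obtain ⟨⟨hn, hs⟩, rfl⟩ := hx
      exact fun c d h => ⟨(hn.supp c d h).1, (hn.supp c d h).2, Quotient.sound (hs c d h)⟩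
    · intro f hf
      simp only [Finset.coe_filter, Finset.mem_filter, Finset.mem_univ, true_and,
        Set.mem_ofPred_eq] at hf hlam ⊢
      exact ⟨⟨⟨hlam, fun c d h => ⟨(hf c d h).1, (hf c d h).2.1⟩⟩,
        fun c d h => Quotient.exact (hf c d h).2.2⟩, trivial⟩
    · rintro ⟨lam', f⟩ hx
      simp only [Finset.coe_filter, Finset.mem_filter, Finset.mem_univ, true_and,
        Set.mem_ofPred_eq] at hx
      rw [hx.2]
    · intro f _
      rfl
  · intro x hx
    simp only [Finset.coe_filter, Finset.mem_univ, true_and, Set.mem_ofPred_eq] at hx ⊢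
    exact hx.1.content

end Single

variable {ι : Type*} [Fintype ι] {Λ : ι → Type*} [∀ i, Fintype (Λ i)]

/-- The number of linked tuples of normal forms does not depend on the orders of the steps. -/
theorem card_linked_eq (ρ ρ' m : ∀ i, Λ i → ℕ) (hρ : ∀ i, Function.Injective (ρ i))
    (hρ' : ∀ i, Function.Injective (ρ' i)) :
    (Finset.univ.filter fun x : ∀ i, (Fin r → Λ i) × (Fin r → Fin r → F) =>
        (∀ i, IsNormal (ρ i) (m i) (x i)) ∧ Linked fun i c d => (x i).2 c d ≠ 0).card =
      (Finset.univ.filter fun x : ∀ i, (Fin r → Λ i) × (Fin r → Fin r → F) =>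
        (∀ i, IsNormal (ρ' i) (m i) (x i)) ∧ Linked fun i c d => (x i).2 c d ≠ 0).card := by
  simp only [linked_iff]
  -- Unlike linkedness, the condition that all entries stay inside the classes of `s` can be tested
  -- leg by leg, so the count is a product.
  have hcount : ∀ (σ : ∀ i, Λ i → ℕ) (s : Setoid (Fin r)),
      ((Finset.univ.filter fun x : ∀ i, (Fin r → Λ i) × (Fin r → Fin r → F) =>
        ∀ i, IsNormal (σ i) (m i) (x i)).filter fun x =>
          Relation.EqvGen.setoid (fun c d => ∃ i, (x i).2 c d ≠ 0) ≤ s).card =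
        ∏ i, ∑ lam : Fin r → Λ i with
          (∀ b, (Finset.univ.filter fun c => lam c = b).card = m i b),
            Fintype.card F ^ gradedInv (σ i) (Quotient.mk s) lam := by
    intro σ s
    simp only [← card_isNormal_compatible]
    rw [← Fintype.card_piFinset]
    congr 1
    ext x
    simp only [Finset.mem_filter, Finset.mem_univ, true_and, Fintype.mem_piFinset, forall_and]
    refine and_congr_right fun _ => ⟨fun h i c d hcd => h (.rel _ _ ⟨i, hcd⟩), fun h => ?_⟩
    exact Setoid.eqvGen_le fun c d ⟨i, hcd⟩ => h i c d hcd
  rw [← Finset.filter_filter, ← Finset.filter_filter]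
  refine card_filter_eq_of_card_filter_le _ _ _ _ (fun s => ?_) ⊤
  rw [hcount, hcount]
  exact Finset.prod_congr rfl fun i _ => sum_gradedInv_eq _ _ (hρ i) (hρ' i) _ _ _

end Counting

/-! ### Words and permutations in row echelon form -/

section Echelon

open Classical

variable {r d : ℕ}

/-- Row `a` lies in the block `p`. -/
def InBlock (c : Fin d → ℕ) (p : Fin d) (a : ℕ) : Prop :=
  ∑ f ∈ Finset.Ioi p, c f ≤ a ∧ a < ∑ f ∈ Finset.Ici p, c f

/-- Blocks with larger index lie higher up, that is, at smaller row numbers. -/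
lemma InBlock.le_of_le {c : Fin d → ℕ} {p p' : Fin d} {a b : ℕ} (h : InBlock c p a)
    (h' : InBlock c p' b) (hab : a ≤ b) : p' ≤ p := by
  by_contra hlt
  have hsub : Finset.Ici p' ⊆ Finset.Ioi p := by
    intro x hx
    rw [Finset.mem_Ici] at hx
    rw [Finset.mem_Ioi]
    exact (not_le.1 hlt).trans_le hx
  have := Finset.sum_le_sum_of_subset (f := c) hsub
  have h1 := h.1
  have h2 := h'.2
  omega

lemma InBlock.unique {c : Fin d → ℕ} {p p' : Fin d} {a : ℕ} (h : InBlock c p a)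
    (h' : InBlock c p' a) : p = p' :=
  le_antisymm (h'.le_of_le h le_rfl) (h.le_of_le h' le_rfl)

/-- The block is the largest `p` whose tail sum still exceeds `a`; the next tail sum is the lower
bound of that block. -/
lemma exists_inBlock {c : Fin d → ℕ} {a : ℕ} (ha : a < ∑ f, c f) : ∃ p, InBlock c p a := by
  have hex : ∃ p, a < ∑ f ∈ Finset.Ici p, c f := by
    have hd : 0 < d := by
      rcases Nat.eq_zero_or_pos d with rfl | h
      · simp at ha
      · exact h
    refine ⟨⟨0, hd⟩, ?_⟩
    have : Finset.Ici (⟨0, hd⟩ : Fin d) = Finset.univ := by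
      ext x
      simp [Fin.le_def]
    rwa [this]
  obtain ⟨p₀, hp₀⟩ := hex
  obtain ⟨p, hp, hmax⟩ := Finset.exists_max_image
    (Finset.univ.filter fun p => a < ∑ f ∈ Finset.Ici p, c f) id ⟨p₀, by simpa using hp₀⟩
  simp only [Finset.mem_filter, Finset.mem_univ, true_and, id] at hp hmax
  refine ⟨p, ?_, hp⟩
  by_contra! hlt
  have hne : (Finset.Ioi p).Nonempty := by
    rw [Finset.nonempty_iff_ne_empty]
    intro h
    simp [h] at hlt
  have hmin := Finset.min'_mem _ hne
  have hIci : Finset.Ici ((Finset.Ioi p).min' hne) = Finset.Ioi p := by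
    ext x
    rw [Finset.mem_Ici]
    refine ⟨fun h => ?_, fun h => Finset.min'_le _ _ h⟩
    rw [Finset.mem_Ioi] at hmin ⊢
    exact hmin.trans_le h
  rw [← hIci] at hlt
  exact absurd (hmax _ hlt) (not_le.2 (Finset.mem_Ioi.1 hmin))

/-- The order on positions by decreasing letters, then by increasing positions. -/
def WordLT (lam : Fin r → Fin d) (y x : Fin r) : Prop :=
  lam x < lam y ∨ (lam y = lam x ∧ y < x)

lemma WordLT.trans {lam : Fin r → Fin d} {x y z : Fin r} (h : WordLT lam x y)
    (h' : WordLT lam y z) : WordLT lam x z := by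
  rcases h with h | ⟨h, h1⟩ <;> rcases h' with h' | ⟨h', h1'⟩
  · exact Or.inl (h'.trans h)
  · exact Or.inl (h' ▸ h)
  · exact Or.inl (h ▸ h')
  · exact Or.inr ⟨h.trans h', h1.trans h1'⟩

lemma not_wordLT_self (lam : Fin r → Fin d) (x : Fin r) : ¬ WordLT lam x x := by
  simp [WordLT]

lemma wordLT_trichotomy (lam : Fin r → Fin d) {x y : Fin r} (h : x ≠ y) :
    WordLT lam x y ∨ WordLT lam y x := by
  unfold WordLT
  rcases lt_trichotomy (lam x) (lam y) with h1 | h1 | h1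
  · exact Or.inr (Or.inl h1)
  · rcases lt_or_gt_of_ne h with h2 | h2
    · exact Or.inl (Or.inr ⟨h1, h2⟩)
    · exact Or.inr (Or.inr ⟨h1.symm, h2⟩)
  · exact Or.inl (Or.inl h1)

/-- The number of positions before `x`. -/
def wordRank (lam : Fin r → Fin d) (x : Fin r) : ℕ :=
  (Finset.univ.filter fun y => WordLT lam y x).card

lemma wordRank_lt (lam : Fin r → Fin d) (x : Fin r) : wordRank lam x < r := by
  have : (Finset.univ.filter fun y => WordLT lam y x).card <
      (Finset.univ : Finset (Fin r)).card := by
    apply Finset.card_lt_card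
    rw [Finset.ssubset_univ_iff]
    intro h
    have := Finset.mem_univ x
    rw [← h] at this
    exact not_wordLT_self lam x (Finset.mem_filter.1 this).2
  rwa [Finset.card_univ, Fintype.card_fin] at this

lemma wordRank_lt_of_wordLT {lam : Fin r → Fin d} {x y : Fin r} (h : WordLT lam y x) :
    wordRank lam y < wordRank lam x := by
  apply Finset.card_lt_card
  refine ⟨fun z hz => ?_, fun hsub => ?_⟩
  · simp only [Finset.mem_filter, Finset.mem_univ, true_and] at hz ⊢
    exact hz.trans h
  · have := hsub (Finset.mem_filter.2 ⟨Finset.mem_univ y, h⟩)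
    exact not_wordLT_self lam y (Finset.mem_filter.1 this).2

/-- The permutation that sorts a word. -/
def wordPerm (lam : Fin r → Fin d) : Equiv.Perm (Fin r) :=
  Equiv.ofBijective (fun x => ⟨wordRank lam x, wordRank_lt lam x⟩) <| by
    rw [← Finite.injective_iff_bijective]
    intro x y hxy
    by_contra hne
    have h : wordRank lam x = wordRank lam y := by simpa using hxy
    rcases wordLT_trichotomy lam hne with h1 | h1 <;> have := wordRank_lt_of_wordLT h1 <;> omega

lemma wordPerm_apply (lam : Fin r → Fin d) (x : Fin r) :
    (wordPerm lam x : ℕ) = wordRank lam x := rfl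

lemma wordPerm_lt_iff (lam : Fin r → Fin d) (y x : Fin r) :
    wordPerm lam y < wordPerm lam x ↔ WordLT lam y x := by
  rw [Fin.lt_def, wordPerm_apply, wordPerm_apply]
  refine ⟨fun h => ?_, wordRank_lt_of_wordLT⟩
  by_contra hn
  have hne : y ≠ x := by rintro rfl; omega
  rcases wordLT_trichotomy lam hne with h1 | h1
  · exact hn h1
  · have := wordRank_lt_of_wordLT h1
    omega

/-- The words of content `c`. -/
def wordsOfContent (r : ℕ) {d : ℕ} (c : Fin d → ℕ) : Finset (Fin r → Fin d) :=
  Finset.univ.filter fun lam => ∀ b, (Finset.univ.filter fun x => lam x = b).card = c b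

variable {c : Fin d → ℕ}

lemma card_filter_mem_eq_sum {lam : Fin r → Fin d} (hlam : lam ∈ wordsOfContent r c)
    (s : Finset (Fin d)) : (Finset.univ.filter fun x => lam x ∈ s).card = ∑ f ∈ s, c f := by
  rw [Finset.card_eq_sum_card_fiberwise (f := lam) (t := s)]
  · refine Finset.sum_congr rfl fun b hb => ?_
    rw [← (Finset.mem_filter.1 hlam).2 b, Finset.filter_filter]
    congr 1
    ext x
    simp only [Finset.mem_filter, Finset.mem_univ, true_and]
    exact ⟨fun h => h.2, fun h => ⟨h ▸ hb, h⟩⟩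
  · intro x hx
    simpa using hx

/-- Before `x` come all positions with a larger letter, and besides them only positions with the
same letter. -/
lemma inBlock_wordPerm {lam : Fin r → Fin d} (hlam : lam ∈ wordsOfContent r c) (x : Fin r) :
    InBlock c (lam x) (wordPerm lam x) := by
  rw [wordPerm_apply, InBlock, ← card_filter_mem_eq_sum hlam, ← card_filter_mem_eq_sum hlam]
  constructor
  · apply Finset.card_le_card
    intro y hy
    simp only [Finset.mem_filter, Finset.mem_univ, true_and, Finset.mem_Ioi] at hy ⊢
    exact Or.inl hy
  · apply Finset.card_lt_card
    refine ⟨fun y hy => ?_, fun hsub => ?_⟩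
    · simp only [Finset.mem_filter, Finset.mem_univ, true_and, Finset.mem_Ici] at hy ⊢
      rcases hy with h | h
      · exact h.le
      · exact h.1.ge
    · have := hsub (Finset.mem_filter.2 ⟨Finset.mem_univ x, Finset.mem_Ici.2 le_rfl⟩)
      exact not_wordLT_self lam x (Finset.mem_filter.1 this).2

lemma mem_echelonPerms {w : Equiv.Perm (Fin r)} : w ∈ echelonPerms r c ↔
    ∀ (x y : Fin r) (p : Fin d), InBlock c p (w x) → InBlock c p (w y) → w x < w y → x < y := by
  rw [echelonPerms, Finset.mem_filter]
  simp only [Finset.mem_univ, true_and]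
  constructor
  · intro h x y p hx hy hxy
    simpa using h (w x) (w y) hxy ⟨p, hx, hy⟩
  · rintro h a b hab ⟨p, ha, hb⟩
    refine h (w.symm a) (w.symm b) p ?_ ?_ ?_
    · simpa [InBlock] using ha
    · simpa [InBlock] using hb
    · simpa using hab

lemma wordPerm_mem_echelonPerms {lam : Fin r → Fin d} (hlam : lam ∈ wordsOfContent r c) :
    wordPerm lam ∈ echelonPerms r c := by
  rw [mem_echelonPerms]
  intro x y p hx hy hxy
  have h1 := (inBlock_wordPerm hlam x).unique hx
  have h2 := (inBlock_wordPerm hlam y).unique hy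
  rcases (wordPerm_lt_iff lam x y).1 hxy with h | h
  · rw [h1, h2] at h
    exact absurd h (lt_irrefl _)
  · exact h.2

lemma wordPerm_injOn {lam lam' : Fin r → Fin d} (hlam : lam ∈ wordsOfContent r c)
    (hlam' : lam' ∈ wordsOfContent r c) (h : wordPerm lam = wordPerm lam') : lam = lam' := by
  funext x
  have := inBlock_wordPerm hlam' x
  rw [← h] at this
  exact (inBlock_wordPerm hlam x).unique this

lemma card_inBlock (hc : ∑ f, c f = r) (p : Fin d) :
    (Finset.univ.filter fun a : Fin r => InBlock c p a).card = c p := by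
  have hIci : Finset.Ici p = insert p (Finset.Ioi p) := by
    ext x
    simp only [Finset.mem_Ici, Finset.mem_insert, Finset.mem_Ioi, le_iff_eq_or_lt, eq_comm]
  have hsum : ∑ f ∈ Finset.Ici p, c f = c p + ∑ f ∈ Finset.Ioi p, c f := by
    rw [hIci, Finset.sum_insert (by simp)]
  have hle : ∑ f ∈ Finset.Ici p, c f ≤ r :=
    (Finset.sum_le_univ_sum_of_nonneg fun _ => Nat.zero_le _).trans hc.le
  have hmap : (Finset.univ.filter fun a : Fin r => InBlock c p a).map Fin.valEmbedding =
      Finset.Ico (∑ f ∈ Finset.Ioi p, c f) (∑ f ∈ Finset.Ici p, c f) := by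
    ext a
    simp only [Finset.mem_map, Finset.mem_filter, Finset.mem_univ, true_and, Fin.valEmbedding_apply,
      Finset.mem_Ico]
    constructor
    · rintro ⟨b, hb, rfl⟩
      exact hb
    · intro ha
      exact ⟨⟨a, ha.2.trans_le hle⟩, ha, rfl⟩
  rw [← Finset.card_map Fin.valEmbedding, hmap, Nat.card_Ico, hsum, Nat.add_sub_cancel]

/-- Give position `x` the block containing row `w x` as its letter. The echelon condition makes `w`
increasing on positions with equal letters, so `w` sorts positions just as the word order does. -/
lemma exists_wordPerm_eq (hc : ∑ f, c f = r) {w : Equiv.Perm (Fin r)}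
    (hw : w ∈ echelonPerms r c) : ∃ lam ∈ wordsOfContent r c, wordPerm lam = w := by
  choose lam hlam using fun x : Fin r => exists_inBlock (c := c) (a := w x) (by
    rw [hc]; exact (w x).2)
  refine ⟨lam, ?_, ?_⟩
  · rw [wordsOfContent, Finset.mem_filter]
    refine ⟨Finset.mem_univ _, fun b => ?_⟩
    rw [← card_inBlock hc b]
    refine Finset.card_bijective w w.bijective fun x => ?_
    simp only [Finset.mem_filter, Finset.mem_univ, true_and]
    exact ⟨fun h => h ▸ hlam x, fun h => (hlam x).unique h⟩
  · rw [mem_echelonPerms] at hw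
    have hiff : ∀ y x, WordLT lam y x ↔ w y < w x := by
      have h1 : ∀ y x, WordLT lam y x → w y < w x := by
        intro y x h
        by_contra hn
        rw [not_lt] at hn
        rcases h with h | ⟨h, h'⟩
        · exact absurd ((hlam x).le_of_le (hlam y) (Fin.le_def.1 hn)) (not_le.2 h)
        · rcases hn.eq_or_lt with h2 | h2
          · exact h'.ne (w.injective h2.symm)
          · exact absurd (hw x y (lam x) (hlam x) (h ▸ hlam y) h2) (not_lt.2 h'.le)
      intro y x
      refine ⟨h1 y x, fun h => ?_⟩
      have hne : y ≠ x := by rintro rfl; exact lt_irrefl _ h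
      rcases wordLT_trichotomy lam hne with h2 | h2
      · exact h2
      · exact absurd (h1 x y h2) (not_lt.2 h.le)
    ext x
    rw [wordPerm_apply, wordRank]
    have h3 : (Finset.univ.filter fun y => WordLT lam y x).card = (Finset.Iio (w x)).card := by
      refine Finset.card_bijective w w.bijective fun y => ?_
      simp [hiff]
    rw [h3, Fin.card_Iio]

end Echelon

/-! ### Counting by inversion graphs -/

section InversionCount

open Classical

variable {r k : ℕ}

lemma linked_iff_connectedBy (hr : 0 < r) (w : Fin k → Equiv.Perm (Fin r))
    (A : Set (InversionEdge w)) :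
    ConnectedBy (inversionGraph w) A ↔
      Linked fun t c d => ∃ e ∈ A, e.1 = (t, c, d) := by
  rw [connectedBy_iff_saturated]
  have hne : Nonempty (inversionGraph w).vertexSet := ⟨⟨⟨0, hr⟩, Set.mem_univ _⟩⟩
  simp only [hne, true_and]
  constructor
  · intro h S hS c d hc
    refine h {x | x.1 ∈ S} ?_ ⟨c, Set.mem_univ _⟩ ⟨d, Set.mem_univ _⟩ hc
    rintro e he x y (⟨h1, h2⟩ | ⟨h1, h2⟩)
    · simp only [Set.mem_ofPred_eq, h1, h2]
      exact hS e.1.1 _ _ ⟨e, he, rfl⟩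
    · simp only [Set.mem_ofPred_eq, h1, h2]
      exact (hS e.1.1 _ _ ⟨e, he, rfl⟩).symm
  · intro h S hS x y hx
    have hy := h (Subtype.val '' S) ?_ x.1 y.1 ⟨x, hx, rfl⟩
    · obtain ⟨z, hz, hzy⟩ := hy
      rwa [← Subtype.ext hzy]
    · rintro t c d ⟨e, he, hecd⟩
      have hlink : (inversionGraph w).IsLink e c d := Or.inl (by simp [hecd])
      have := hS e he ⟨c, Set.mem_univ _⟩ ⟨d, Set.mem_univ _⟩ hlink
      constructor
      · rintro ⟨z, hz, rfl⟩
        exact ⟨_, this.1 hz, rfl⟩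
      · rintro ⟨z, hz, rfl⟩
        exact ⟨_, this.2 hz, rfl⟩

variable (F : Type*) [Field F] [Fintype F]

/-- Sort the families of entries by their support `A`, a set of edges of the inversion graph; each
edge of `A` carries an arbitrary non-zero scalar. -/
lemma card_linked_supported (hr : 0 < r) (w : Fin k → Equiv.Perm (Fin r)) :
    (Finset.univ.filter fun f : Fin k → Fin r → Fin r → F =>
        (∀ t c d, f t c d ≠ 0 → d < c ∧ w t c < w t d) ∧
          Linked fun t c d => f t c d ≠ 0).card =
      ∑ A ∈ Finset.univ.filter fun A : Finset (InversionEdge w) =>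
          ConnectedBy (inversionGraph w) (A : Set (InversionEdge w)),
        (Fintype.card F - 1) ^ A.card := by
  have h1 : (Finset.univ.filter fun f : Fin k → Fin r → Fin r → F =>
        (∀ t c d, f t c d ≠ 0 → d < c ∧ w t c < w t d) ∧
          Linked fun t c d => f t c d ≠ 0).card =
      (Finset.univ.filter fun g : InversionEdge w → F => ConnectedBy (inversionGraph w)
        ((Finset.univ.filter fun e => g e ≠ 0 : Finset (InversionEdge w)) : Set _)).card := by
    simp only [linked_iff_connectedBy hr]
    refine Finset.card_nbij' (fun f e => f e.1.1 e.1.2.1 e.1.2.2)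
      (fun g t c d => if h : d < c ∧ w t c < w t d then g ⟨(t, c, d), h⟩ else 0) ?_ ?_ ?_ ?_
    · intro f hf
      simp only [Finset.coe_filter, Finset.mem_univ, true_and, Set.mem_ofPred_eq] at hf ⊢
      convert hf.2 using 4 with t c d
      constructor
      · rintro ⟨e, he, hecd⟩
        simpa [hecd] using he
      · intro h
        exact ⟨⟨(t, c, d), hf.1 t c d h⟩, h, rfl⟩
    · intro g hg
      simp only [Finset.coe_filter, Finset.mem_univ, true_and, Set.mem_ofPred_eq] at hg ⊢
      refine ⟨fun t c d h => ?_, ?_⟩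
      · by_contra hn
        rw [dif_neg hn] at h
        exact h rfl
      · convert hg using 4 with t c d
        constructor
        · intro h
          by_cases hn : d < c ∧ w t c < w t d
          · rw [dif_pos hn] at h
            exact ⟨_, h, rfl⟩
          · rw [dif_neg hn] at h
            exact absurd rfl h
        · rintro ⟨e, he, hecd⟩
          have hn : d < c ∧ w t c < w t d := by
            have := e.2
            simpa [hecd] using this
          rw [dif_pos hn]
          have : e = ⟨(t, c, d), hn⟩ := Subtype.ext hecd
          rwa [← this]
    · intro f hf
      simp only [Finset.coe_filter, Finset.mem_univ, true_and, Set.mem_ofPred_eq] at hf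
      funext t c d
      dsimp only
      split_ifs with h
      · rfl
      · by_contra hn
        exact h (hf.1 t c d (Ne.symm hn))
    · intro g _
      funext e
      dsimp only
      rw [dif_pos e.2]
  rw [h1, Finset.card_eq_sum_card_fiberwise (f := fun g : InversionEdge w → F =>
      (Finset.univ.filter fun e => g e ≠ 0))
    (t := Finset.univ.filter fun A : Finset (InversionEdge w) =>
      ConnectedBy (inversionGraph w) (A : Set _))]
  · refine Finset.sum_congr rfl fun A hA => ?_
    have h2 : ((Finset.univ.filter fun g : InversionEdge w → F => ConnectedBy (inversionGraph w)
        ((Finset.univ.filter fun e => g e ≠ 0 : Finset (InversionEdge w)) : Set _)).filter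
          fun g => (Finset.univ.filter fun e => g e ≠ 0) = A) =
        Fintype.piFinset fun e => if e ∈ A then Finset.univ.erase (0 : F) else {0} := by
      ext g
      simp only [Finset.mem_filter, Finset.mem_univ, true_and, Fintype.mem_piFinset] at hA ⊢
      constructor
      · rintro ⟨-, rfl⟩ e
        by_cases he : g e = 0 <;> simp [he]
      · intro h
        have : (Finset.univ.filter fun e => g e ≠ 0) = A := by
          ext e
          have := h e
          by_cases he : e ∈ A
          · rw [if_pos he] at this
            simpa [he] using this
          · rw [if_neg he] at this
            simpa [he] using this
        exact ⟨this ▸ hA, this⟩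
    rw [h2, Fintype.card_piFinset, ← Finset.prod_subset (Finset.subset_univ A)]
    · rw [Finset.prod_congr rfl (g := fun _ => Fintype.card F - 1), Finset.prod_const]
      intro e he
      rw [if_pos he, Finset.card_erase_of_mem (Finset.mem_univ _), Finset.card_univ]
    · intro e _ he
      rw [if_neg he, Finset.card_singleton]
  · intro g hg
    simpa using hg

/-- The number of linked tuples of normal forms, by permutations in row echelon form. -/
theorem card_linked_eq_sum_echelon (hr : 0 < r) {d : Fin k → ℕ} (m ρ : ∀ i, Fin (d i) → ℕ)
    (hm : ∀ i, ∑ f, m i f = r) (hρ : ∀ i a b, ρ i a < ρ i b ↔ b < a) :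
    (Finset.univ.filter fun x : ∀ i, (Fin r → Fin (d i)) × (Fin r → Fin r → F) =>
        (∀ i, IsNormal (ρ i) (m i) (x i)) ∧ Linked fun i c d => (x i).2 c d ≠ 0).card =
      ∑ w ∈ Fintype.piFinset fun i => echelonPerms r (m i),
        ∑ A ∈ Finset.univ.filter fun A : Finset (InversionEdge w) =>
          ConnectedBy (inversionGraph w) (A : Set (InversionEdge w)),
          (Fintype.card F - 1) ^ A.card := by
  simp only [← card_linked_supported F hr]
  rw [Finset.card_eq_sum_card_fiberwise (f := fun x i => (x i).1)
    (t := Fintype.piFinset fun i => wordsOfContent r (m i))]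
  · refine Finset.sum_bij (fun lam _ i => wordPerm (lam i)) ?_ ?_ ?_ ?_
    · intro lam hlam
      rw [Fintype.mem_piFinset] at hlam ⊢
      exact fun i => wordPerm_mem_echelonPerms (hlam i)
    · intro lam hlam lam' hlam' h
      rw [Fintype.mem_piFinset] at hlam hlam'
      funext i
      exact wordPerm_injOn (hlam i) (hlam' i) (congrFun h i)
    · intro w hw
      rw [Fintype.mem_piFinset] at hw
      choose lam hlam h using fun i => exists_wordPerm_eq (hm i) (hw i)
      exact ⟨lam, Fintype.mem_piFinset.2 hlam, funext h⟩
    · intro lam hlam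
      rw [Fintype.mem_piFinset] at hlam
      -- Equal letters are sorted by position, so they create no inversion; and `ρ` reverses the
      -- order of the letters.
      have hinv : ∀ i c d, (d < c ∧ wordPerm (lam i) c < wordPerm (lam i) d) ↔
          (d < c ∧ ρ i (lam i c) < ρ i (lam i d)) := by
        intro i c d
        rw [hρ, wordPerm_lt_iff]
        refine and_congr_right fun h => ⟨?_, Or.inl⟩
        rintro (h' | h')
        · exact h'
        · exact absurd h'.2 (not_lt.2 h.le)
      simp only [hinv]
      refine Finset.card_nbij' (fun x i => (x i).2) (fun f i => (lam i, f i)) ?_ ?_ ?_ ?_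
      · intro x hx
        simp only [Finset.coe_filter, Finset.mem_filter, Finset.mem_univ, true_and,
          Set.mem_ofPred_eq] at hx ⊢
        obtain ⟨⟨h1, h2⟩, rfl⟩ := hx
        exact ⟨fun i => (h1 i).supp, h2⟩
      · intro f hf
        simp only [Finset.coe_filter, Finset.mem_filter, Finset.mem_univ, true_and,
          Set.mem_ofPred_eq] at hf ⊢
        exact ⟨⟨fun i => ⟨fun b => by
          convert (Finset.mem_filter.1 (hlam i)).2 b, hf.1 i⟩, hf.2⟩, trivial⟩
      · intro x hx
        simp only [Finset.coe_filter, Finset.mem_filter, Finset.mem_univ, true_and,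
          Set.mem_ofPred_eq] at hx
        rw [← hx.2]
      · intro f _
        rfl
  · intro x hx
    simp only [Finset.coe_filter, Finset.mem_univ, true_and, Set.mem_ofPred_eq] at hx
    rw [Finset.mem_coe, Fintype.mem_piFinset]
    exact fun i => Finset.mem_filter.2 ⟨Finset.mem_univ _, fun b => by
      convert (hx.1 i).content b⟩

end InversionCount

/-! ### Idempotents and decompositions of representations -/

section Idempotents

variable {κ : Type*} [Field κ]

lemma vecMulVec_zero_right {m n : Type*} (w : m → κ) : Matrix.vecMulVec w (0 : n → κ) = 0 := by
  ext
  simp [Matrix.vecMulVec_apply]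

lemma exists_left_inverse {m n : Type*} [Fintype m] [Fintype n] [DecidableEq m] [DecidableEq n]
    (A : Matrix m n κ) (h : ∀ x, A.mulVec x = 0 → x = 0) : ∃ R : Matrix n m κ, R * A = 1 := by
  obtain ⟨g, hg⟩ := LinearMap.exists_leftInverse_of_injective A.mulVecLin
    (LinearMap.ker_eq_bot'.2 h)
  refine ⟨LinearMap.toMatrix' g, ?_⟩
  have := congrArg LinearMap.toMatrix' hg
  rwa [LinearMap.toMatrix'_comp, LinearMap.toMatrix'_id, ← Matrix.toLin'_apply',
    LinearMap.toMatrix'_toLin'] at this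

lemma exists_right_inverse {m n : Type*} [Fintype m] [Fintype n] [DecidableEq m] [DecidableEq n]
    (A : Matrix m n κ) (h : ∀ f, Matrix.vecMul f A = 0 → f = 0) :
    ∃ D : Matrix n m κ, A * D = 1 := by
  obtain ⟨R, hR⟩ := exists_left_inverse A.transpose fun x hx => h x (by
    rwa [Matrix.mulVec_transpose] at hx)
  refine ⟨R.transpose, ?_⟩
  have := congrArg Matrix.transpose hR
  rwa [Matrix.transpose_mul, Matrix.transpose_transpose, Matrix.transpose_one] at this

/-- A linear form separating `x` from `p`, scaled to be 1 at `x` and written as a row vector. -/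
lemma exists_dotProduct_eq_one {n : Type*} [Fintype n] [DecidableEq n]
    (p : Submodule κ (n → κ)) {x : n → κ} (hx : x ∉ p) :
    ∃ f : n → κ, dotProduct f x = 1 ∧ ∀ y ∈ p, dotProduct f y = 0 := by
  obtain ⟨L, hL, hp⟩ := Submodule.exists_le_ker_of_notMem hx
  have hdot : ∀ y, dotProduct (fun c => (L x)⁻¹ * L (Pi.single c 1)) y = (L x)⁻¹ * L y := by
    intro y
    conv_rhs => rw [LinearMap.pi_apply_eq_sum_univ L y]
    rw [dotProduct, Finset.mul_sum]
    refine Finset.sum_congr rfl fun c _ => ?_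
    have : (fun j => if c = j then (1 : κ) else 0) = Pi.single c 1 := by
      ext j
      simp [Pi.single_apply, eq_comm]
    rw [this, smul_eq_mul]
    ring
  refine ⟨_, (hdot x).trans (inv_mul_cancel₀ hL), fun y hy => ?_⟩
  rw [hdot y, LinearMap.mem_ker.1 (hp hy), mul_zero]

/-- Factor `e` through its image, in coordinates: `P` is `e` onto the image and `Q` is the
inclusion. -/
lemma exists_idempotent_splitting {n : Type*} [Fintype n] [DecidableEq n] (e : Matrix n n κ)
    (he : e * e = e) : ∃ (d : ℕ) (P : Matrix (Fin d) n κ) (Q : Matrix n (Fin d) κ),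
      P * Q = 1 ∧ Q * P = e := by
  let R := LinearMap.range (Matrix.toLin' e)
  let b := (Module.finBasis κ R).equivFun
  refine ⟨Module.finrank κ R,
    LinearMap.toMatrix' (b.toLinearMap ∘ₗ (Matrix.toLin' e).rangeRestrict),
    LinearMap.toMatrix' (R.subtype ∘ₗ b.symm.toLinearMap), ?_, ?_⟩
  · rw [← LinearMap.toMatrix'_comp, ← LinearMap.toMatrix'_id]
    congr 1
    ext1 c
    ext1
    simp only [LinearMap.comp_apply, LinearEquiv.coe_coe, LinearMap.id_apply]
    have : (Matrix.toLin' e).rangeRestrict (R.subtype (b.symm (LinearMap.single κ _ c 1))) =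
        b.symm (LinearMap.single κ _ c 1) := by
      apply Subtype.ext
      obtain ⟨y, hy⟩ := (b.symm (LinearMap.single κ _ c 1)).2
      change Matrix.toLin' e (b.symm (LinearMap.single κ _ c 1) : n → κ) = _
      rw [← hy, ← LinearMap.comp_apply, ← Matrix.toLin'_mul, he]
    rw [this, LinearEquiv.apply_symm_apply]
  · rw [← LinearMap.toMatrix'_comp]
    conv_rhs => rw [← LinearMap.toMatrix'_toLin' e]
    congr 1
    ext1 c
    ext1
    simp

variable {I : Type*} [Quiver I]

/-- The family `g` intertwines the representations `φ` and `ψ`. -/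
def IsMorphism {n m : I → Type*} [∀ i, Fintype (n i)] [∀ i, Fintype (m i)]
    (φ : MatRep κ n) (ψ : MatRep κ m) (g : ∀ i, Matrix (m i) (n i) κ) : Prop :=
  ∀ ⦃i j : I⦄ (a : i ⟶ j), g j * φ a = ψ a * g i

lemma isMorphism_mul {n m p : I → Type*} [∀ i, Fintype (n i)] [∀ i, Fintype (m i)]
    [∀ i, Fintype (p i)] {φ : MatRep κ n} {ψ : MatRep κ m} {χ : MatRep κ p}
    {g : ∀ i, Matrix (m i) (n i) κ} {h : ∀ i, Matrix (p i) (m i) κ}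
    (hg : IsMorphism φ ψ g) (hh : IsMorphism ψ χ h) :
    IsMorphism φ χ fun i => h i * g i := by
  intro i j a
  rw [Matrix.mul_assoc, hg a, ← Matrix.mul_assoc, hh a, Matrix.mul_assoc]

/-- A representation is indecomposable if and only if it is non-zero and has no non-trivial
idempotent endomorphism. -/
theorem indecomposable_iff {v : I → ℕ} (φ : Rep κ v) : Indecomposable φ ↔ v ≠ 0 ∧
    ∀ e : ∀ i, Matrix (Fin (v i)) (Fin (v i)) κ, IsMorphism φ φ e → (∀ i, e i * e i = e i) →
      (∀ i, e i = 0) ∨ ∀ i, e i = 1 := by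
  unfold Indecomposable
  refine and_congr_right fun _ => ⟨fun h e he hee => ?_, fun h v₁ v₂ φ₁ φ₂ => ?_⟩
  · have hee' : ∀ i, (1 - e i) * (1 - e i) = 1 - e i := by
      intro i
      rw [Matrix.mul_sub, Matrix.mul_one, Matrix.sub_mul, Matrix.one_mul, hee, sub_self, sub_zero]
    -- The images of `e` and of `1 - e` are the two summands.
    choose d₁ P Q hPQ hQP using fun i => exists_idempotent_splitting (e i) (hee i)
    choose d₂ P' Q' hPQ' hQP' using fun i => exists_idempotent_splitting (1 - e i) (hee' i)
    have h1 : ∀ i, P i * Q' i = 0 := by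
      intro i
      calc P i * Q' i = P i * Q i * (P i * Q' i) * (P' i * Q' i) := by
            rw [hPQ, hPQ', Matrix.one_mul, Matrix.mul_one]
        _ = P i * ((Q i * P i) * (Q' i * P' i)) * Q' i := by simp only [Matrix.mul_assoc]
        _ = 0 := by
            rw [hQP, hQP', Matrix.mul_sub, Matrix.mul_one, hee, sub_self, Matrix.mul_zero,
              Matrix.zero_mul]
    have h2 : ∀ i, P' i * Q i = 0 := by
      intro i
      calc P' i * Q i = P' i * Q' i * (P' i * Q i) * (P i * Q i) := by
            rw [hPQ, hPQ', Matrix.one_mul, Matrix.mul_one]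
        _ = P' i * ((Q' i * P' i) * (Q i * P i)) * Q i := by simp only [Matrix.mul_assoc]
        _ = 0 := by
            rw [hQP, hQP', Matrix.sub_mul, Matrix.one_mul, hee, sub_self, Matrix.mul_zero,
              Matrix.zero_mul]
    have hiso : Isomorphic φ (directSum (n := fun i => Fin (d₁ i)) (m := fun i => Fin (d₂ i))
        (fun i j a => P j * φ a * Q i) (fun i j a => P' j * φ a * Q' i)) := by
      refine ⟨fun i => Matrix.fromRows (P i) (P' i), fun i => Matrix.fromCols (Q i) (Q' i),
        fun i => ?_, fun i => ?_, fun i j a => ?_⟩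
      · rw [Matrix.fromRows_mul_fromCols, hPQ, hPQ', h1, h2, Matrix.fromBlocks_one]
      · rw [Matrix.fromCols_mul_fromRows, hQP, hQP', add_sub_cancel]
      · change Matrix.fromRows (P j) (P' j) * φ a =
          Matrix.fromBlocks (P j * φ a * Q i) 0 0 (P' j * φ a * Q' i) *
            Matrix.fromRows (P i) (P' i)
        rw [Matrix.fromRows_mul, Matrix.fromBlocks_mul_fromRows, Matrix.zero_mul,
          Matrix.zero_mul, add_zero, zero_add]
        congr 1
        · calc P j * φ a = (P j * Q j) * P j * φ a := by rw [hPQ, Matrix.one_mul]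
            _ = P j * ((Q j * P j) * φ a) := by simp only [Matrix.mul_assoc]
            _ = P j * (φ a * (Q i * P i)) := by rw [hQP, he a, hQP]
            _ = _ := by simp only [Matrix.mul_assoc]
        · have hcomm : (1 - e j) * φ a = φ a * (1 - e i) := by
            rw [Matrix.sub_mul, Matrix.mul_sub, he a, Matrix.one_mul, Matrix.mul_one]
          calc P' j * φ a = (P' j * Q' j) * P' j * φ a := by rw [hPQ', Matrix.one_mul]
            _ = P' j * ((Q' j * P' j) * φ a) := by simp only [Matrix.mul_assoc]
            _ = P' j * (φ a * (Q' i * P' i)) := by rw [hQP', hQP', hcomm]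
            _ = _ := by simp only [Matrix.mul_assoc]
    have hzero : ∀ {n m : ℕ} (A : Matrix (Fin m) (Fin n) κ) (B : Matrix (Fin n) (Fin m) κ),
        n = 0 → A * B = 0 := by
      intro n m A B hn
      subst hn
      ext a b
      simp [Matrix.mul_apply]
    rcases h d₁ d₂ _ _ hiso with h0 | h0
    · left
      intro i
      rw [← hQP i]
      exact hzero _ _ (congrFun h0 i)
    · right
      intro i
      have : 1 - e i = 0 := by
        rw [← hQP' i]
        exact hzero _ _ (congrFun h0 i)
      exact (sub_eq_zero.1 this).symm
  · rintro ⟨g, g', hgg', hg'g, hg⟩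
    have hg' : IsMorphism (directSum φ₁ φ₂) φ g' := by
      intro i j a
      calc g' j * directSum φ₁ φ₂ a = g' j * ((directSum φ₁ φ₂ a * g i) * g' i) := by
            rw [Matrix.mul_assoc, hgg', Matrix.mul_one]
        _ = (g' j * g j) * φ a * g' i := by rw [← hg a]; simp only [Matrix.mul_assoc]
        _ = φ a * g' i := by rw [hg'g, Matrix.one_mul]
    -- The projection to the first summand, carried over to `φ` by the isomorphism; it is 0 or 1
    -- only if one of the summands is zero.
    let p : ∀ i, Matrix (Fin (v₁ i) ⊕ Fin (v₂ i)) (Fin (v₁ i) ⊕ Fin (v₂ i)) κ :=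
      fun i => Matrix.fromBlocks 1 0 0 0
    have hpp : ∀ i, p i * p i = p i := fun i => by
      simp [p, Matrix.fromBlocks_multiply]
    have hp : IsMorphism (directSum φ₁ φ₂) (directSum φ₁ φ₂) p := by
      intro i j a
      simp [p, directSum, Matrix.fromBlocks_multiply]
    have hmor : IsMorphism φ φ fun i => g' i * (p i * g i) :=
      isMorphism_mul (isMorphism_mul hg hp) hg'
    have hback : ∀ i, g i * (g' i * (p i * g i)) * g' i = p i := by
      intro i
      calc _ = (g i * g' i) * p i * (g i * g' i) := by
            simp only [Matrix.mul_assoc]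
        _ = _ := by rw [hgg', Matrix.one_mul, Matrix.mul_one]
    have hempty : ∀ n : ℕ, (1 : Matrix (Fin n) (Fin n) κ) = 0 → n = 0 := by
      intro n hn
      by_contra h0
      have h1 := congrFun (congrFun hn ⟨0, Nat.pos_of_ne_zero h0⟩) ⟨0, Nat.pos_of_ne_zero h0⟩
      simp at h1
    have hid : ∀ i, g' i * (p i * g i) * (g' i * (p i * g i)) = g' i * (p i * g i) := by
      intro i
      calc _ = g' i * (p i * (g i * g' i) * p i * g i) := by
            simp only [Matrix.mul_assoc]
        _ = _ := by rw [hgg', Matrix.mul_one, hpp]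
    rcases h _ hmor hid with h0 | h0
    · left
      funext i
      have h1 := hback i
      rw [h0 i, Matrix.mul_zero, Matrix.zero_mul] at h1
      exact hempty _ (congrArg Matrix.toBlocks₁₁ h1).symm
    · right
      funext i
      have h1 := hback i
      rw [h0 i, Matrix.mul_one, hgg', ← Matrix.fromBlocks_one] at h1
      exact hempty _ (congrArg Matrix.toBlocks₂₂ h1)

end Idempotents

/-! ### Representations of supernova quivers -/

section Legs

variable {r k : ℕ} {s : Fin k → ℕ}

/-- The arrow `(l) → (i; 0)`. -/
def tipArrow (s : Fin k → ℕ) (l : Fin r) (i : Fin k) :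
    (Sum.inl l : Vertex r k s) ⟶ (Sum.inr ⟨i, 0⟩ : Vertex r k s) := ⟨rfl⟩

/-- The arrow `(i; j + 1) → (i; j)`. -/
def legArrow (r : ℕ) {s : Fin k → ℕ} (i : Fin k) (j : Fin (s i)) :
    (Sum.inr ⟨i, j.succ⟩ : Vertex r k s) ⟶ (Sum.inr ⟨i, j.castSucc⟩ : Vertex r k s) :=
  ⟨⟨rfl, rfl⟩⟩

lemma arrow_cases {P : ∀ x y : Vertex r k s, (x ⟶ y) → Prop}
    (h1 : ∀ l i, P _ _ (tipArrow s l i)) (h2 : ∀ i j, P _ _ (legArrow r i j)) :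
    ∀ x y a, P x y a := by
  rintro (l | ⟨i, j⟩) (l' | ⟨i', j'⟩) ⟨h⟩
  · exact h.elim
  · have hj : j' = 0 := Fin.ext h
    subst hj
    exact h1 l i'
  · exact h.elim
  · obtain ⟨rfl, hj⟩ := h
    have hlt : (j' : ℕ) < s i := by omega
    obtain rfl : j = Fin.succ ⟨j', hlt⟩ := Fin.ext hj
    exact h2 i ⟨j', hlt⟩

variable {κ : Type*} [Field κ] {v : Vertex r k s → ℕ}

/-- The map from `(i; j + 1)` to `(i; j)`. -/
def legMatrix (φ : Rep κ v) (i : Fin k) (j : Fin (s i)) :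
    Matrix (Fin (v (Sum.inr ⟨i, j.castSucc⟩))) (Fin (v (Sum.inr ⟨i, j.succ⟩))) κ :=
  φ (legArrow r i j)

/-- The composite of the maps from `(i; j)` to `(i; a)` along the leg, `0` for `j < a`. -/
def legComp (φ : Rep κ v) (i : Fin k) (a : Fin (s i + 1)) (j : Fin (s i + 1)) :
    Matrix (Fin (v (Sum.inr ⟨i, a⟩))) (Fin (v (Sum.inr ⟨i, j⟩))) κ :=
  Fin.induction
    (motive := fun j => Matrix (Fin (v (Sum.inr ⟨i, a⟩))) (Fin (v (Sum.inr ⟨i, j⟩))) κ)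
    -- The identity matrix, to be used at `j = a`. It is written by comparing values in ℕ because
    -- the index types agree only when `j = a`.
    (Matrix.of fun x y => if a = 0 ∧ (x : ℕ) = y then 1 else 0)
    (fun j M => M * legMatrix φ i j +
      Matrix.of fun (x : Fin (v (Sum.inr ⟨i, a⟩))) (y : Fin (v (Sum.inr ⟨i, j.succ⟩))) =>
        if a = j.succ ∧ (x : ℕ) = y then (1 : κ) else 0) j

lemma legComp_zero (φ : Rep κ v) (i : Fin k) (a : Fin (s i + 1)) :
    legComp φ i a 0 = Matrix.of fun (x : Fin (v (Sum.inr ⟨i, a⟩))) (y : Fin (v (Sum.inr ⟨i, 0⟩))) =>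
      if a = 0 ∧ (x : ℕ) = y then (1 : κ) else 0 := rfl

lemma legComp_succ_aux (φ : Rep κ v) (i : Fin k) (a : Fin (s i + 1)) (j : Fin (s i)) :
    legComp φ i a j.succ = legComp φ i a j.castSucc * legMatrix φ i j +
      Matrix.of fun (x : Fin (v (Sum.inr ⟨i, a⟩))) (y : Fin (v (Sum.inr ⟨i, j.succ⟩))) =>
        if a = j.succ ∧ (x : ℕ) = y then (1 : κ) else 0 := by
  unfold legComp
  rw [Fin.induction_succ]

lemma legComp_of_lt (φ : Rep κ v) (i : Fin k) {a j : Fin (s i + 1)} (h : j < a) :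
    legComp φ i a j = 0 := by
  induction j using Fin.induction with
  | zero =>
    rw [legComp_zero]
    ext x y
    simp [h.ne']
  | succ j ih =>
    rw [legComp_succ_aux, ih (Fin.castSucc_lt_succ.trans h), Matrix.zero_mul, zero_add]
    ext x y
    simp [h.ne']

lemma legComp_self (φ : Rep κ v) (i : Fin k) (a : Fin (s i + 1)) : legComp φ i a a = 1 := by
  cases a using Fin.cases with
  | zero =>
    rw [legComp_zero]
    ext x y
    simp [Matrix.one_apply, Fin.ext_iff]
  | succ j =>
    rw [legComp_succ_aux, legComp_of_lt _ _ Fin.castSucc_lt_succ, Matrix.zero_mul, zero_add]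
    ext x y
    simp [Matrix.one_apply, Fin.ext_iff]

lemma legComp_succ (φ : Rep κ v) (i : Fin k) {a : Fin (s i + 1)} {j : Fin (s i)}
    (h : a ≤ j.castSucc) :
    legComp φ i a j.succ = legComp φ i a j.castSucc * legMatrix φ i j := by
  rw [legComp_succ_aux, add_eq_left]
  ext x y
  simp [(h.trans_lt Fin.castSucc_lt_succ).ne]

lemma legComp_mul (φ : Rep κ v) (i : Fin k) {a b c : Fin (s i + 1)} (hab : a ≤ b) (hbc : b ≤ c) :
    legComp φ i a b * legComp φ i b c = legComp φ i a c := by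
  induction c using Fin.induction with
  | zero =>
    obtain rfl : b = 0 := le_antisymm hbc (Fin.zero_le b)
    rw [legComp_self, Matrix.mul_one]
  | succ c ih =>
    rcases hbc.eq_or_lt with rfl | h
    · rw [legComp_self, Matrix.mul_one]
    · have h' : b ≤ c.castSucc := Fin.le_castSucc_iff.2 h
      rw [legComp_succ _ _ h', legComp_succ _ _ (hab.trans h'), ← ih h', Matrix.mul_assoc]

lemma legComp_castSucc (φ : Rep κ v) (i : Fin k) {j : Fin (s i)} {c : Fin (s i + 1)}
    (h : j.succ ≤ c) :
    legMatrix φ i j * legComp φ i j.succ c = legComp φ i j.castSucc c := by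
  rw [← legComp_mul φ i Fin.castSucc_lt_succ.le h, legComp_succ _ _ le_rfl, legComp_self,
    Matrix.one_mul]

variable [∀ l, Unique (Fin (v (Sum.inl l)))]

/-- The maps from the vertices `(l)` to `(i; 0)`, assembled to one matrix. -/
def tipMatrix (φ : Rep κ v) (i : Fin k) : Matrix (Fin (v (Sum.inr ⟨i, 0⟩))) (Fin r) κ :=
  Matrix.of fun a l => φ (tipArrow s l i) a default

/-- The scalars by which an endomorphism acts at the vertices `(l)`. -/
def tipScalars (g : ∀ x, Matrix (Fin (v x)) (Fin (v x)) κ) (l : Fin r) : κ :=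
  g (Sum.inl l) default default

lemma isMorphism_iff (φ ψ : Rep κ v) (g : ∀ x, Matrix (Fin (v x)) (Fin (v x)) κ) :
    IsMorphism φ ψ g ↔
      (∀ i, g (Sum.inr ⟨i, 0⟩) * tipMatrix φ i =
        tipMatrix ψ i * Matrix.diagonal (tipScalars g)) ∧
      ∀ i (j : Fin (s i)), g (Sum.inr ⟨i, j.castSucc⟩) * legMatrix φ i j =
        legMatrix ψ i j * g (Sum.inr ⟨i, j.succ⟩) := by
  constructor
  · intro h
    refine ⟨fun i => ?_, fun i j => h (legArrow r i j)⟩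
    ext a l
    have := congrFun (congrFun (h (tipArrow s l i)) a) default
    rw [Matrix.mul_apply, Matrix.mul_apply,
      Fintype.sum_unique (ι := Fin (v (Sum.inl l)))] at this
    rw [Matrix.mul_apply, Matrix.mul_diagonal]
    exact this
  · rintro ⟨h1, h2⟩
    refine arrow_cases (P := fun x y a => g y * φ a = ψ a * g x) (fun l i => ?_) h2
    ext a b
    obtain rfl : b = default := Unique.eq_default b
    have := congrFun (congrFun (h1 i) a) l
    rw [Matrix.mul_apply, Matrix.mul_diagonal] at this
    rw [Matrix.mul_apply, Matrix.mul_apply, Fintype.sum_unique (ι := Fin (v (Sum.inl l)))]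
    exact this

/-- A chain of vectors and a chain of linear forms on a leg that split off a direct summand. -/
lemma not_indecomposable_of_chain (hr : 0 < r) (φ : Rep κ v) (i : Fin k) (a m : Fin (s i + 1))
    (w : Fin (v (Sum.inr ⟨i, m⟩)) → κ) (f : Fin (v (Sum.inr ⟨i, a⟩)) → κ)
    (h1 : dotProduct f ((legComp φ i a m).mulVec w) = 1)
    (h2 : ∀ j : Fin (s i), m = j.castSucc → Matrix.vecMul f (legComp φ i a j.succ) = 0)
    (h3 : Matrix.vecMul (Matrix.vecMul f (legComp φ i a 0)) (tipMatrix φ i) = 0)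
    (h4 : ∀ j : Fin (s i), a = j.succ →
      (legMatrix φ i j).mulVec ((legComp φ i j.succ m).mulVec w) = 0) :
    ¬ Indecomposable φ := by
  rw [indecomposable_iff]
  rintro ⟨-, hind⟩
  have ham : a ≤ m := by
    by_contra hlt
    rw [legComp_of_lt _ _ (not_le.1 hlt), Matrix.zero_mulVec, dotProduct_zero] at h1
    exact zero_ne_one h1
  -- At `(i; j)` the endomorphism has rank at most one: the image of `w` times the pullback of `f`.
  -- As `legComp` vanishes against the direction of the leg, it lives only on `a ≤ j ≤ m`.
  let W : ∀ i' (j : Fin (s i' + 1)), Fin (v (Sum.inr ⟨i', j⟩)) → κ :=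
    Function.update (fun _ _ => 0) i fun j => (legComp φ i j m).mulVec w
  let f' : ∀ i' (j : Fin (s i' + 1)), Fin (v (Sum.inr ⟨i', j⟩)) → κ :=
    Function.update (fun _ _ => 0) i fun j => Matrix.vecMul f (legComp φ i a j)
  have hWi : ∀ j, W i j = (legComp φ i j m).mulVec w := fun j => by
    simp [W]
  have hfi : ∀ j, f' i j = Matrix.vecMul f (legComp φ i a j) := fun j => by
    simp [f']
  have hWn : ∀ i' j, i' ≠ i → W i' j = 0 := fun i' j h => by
    simp [W, Function.update_of_ne h]
  obtain ⟨e, heinr, heinl⟩ : ∃ e : ∀ x, Matrix (Fin (v x)) (Fin (v x)) κ,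
      (∀ i' j, e (Sum.inr ⟨i', j⟩) = Matrix.vecMulVec (W i' j) (f' i' j)) ∧
        ∀ l, e (Sum.inl l) = 0 :=
    ⟨fun x => match x with
      | Sum.inl _ => 0
      | Sum.inr ⟨i', j⟩ => Matrix.vecMulVec (W i' j) (f' i' j), fun _ _ => rfl, fun _ => rfl⟩
  have hmor : IsMorphism φ φ e := by
    rw [isMorphism_iff]
    constructor
    · intro i'
      have h0 : tipScalars e = 0 := by
        funext l
        rw [tipScalars, heinl]
        rfl
      rw [h0, heinr]
      by_cases hi : i' = i
      · subst hi
        rw [Matrix.vecMulVec_mul, hfi, h3]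
        simp [vecMulVec_zero_right]
      · rw [hWn _ _ hi]
        simp
    · intro i' x
      rw [heinr, heinr]
      by_cases hi : i' = i
      · subst hi
        rw [Matrix.vecMulVec_mul, Matrix.mul_vecMulVec, hWi, hWi, hfi, hfi]
        -- Inside the chain both sides agree; at its ends `h4` (below `a`) and `h2` (beyond `m`)
        -- make the square commute, and elsewhere both sides vanish.
        by_cases hxm : x.succ ≤ m
        · by_cases hax : a ≤ x.castSucc
          · rw [Matrix.mulVec_mulVec, legComp_castSucc _ _ hxm, Matrix.vecMul_vecMul,
              ← legComp_succ _ _ hax]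
          · rw [legComp_of_lt _ _ (not_le.1 hax), Matrix.vecMul_zero, Matrix.zero_vecMul,
              vecMulVec_zero_right]
            rcases (Fin.castSucc_lt_iff_succ_le.1 (not_le.1 hax)).eq_or_lt with h | h
            · rw [h4 x h.symm, Matrix.zero_vecMulVec]
            · rw [legComp_of_lt _ _ h, Matrix.vecMul_zero, vecMulVec_zero_right]
        · rw [legComp_of_lt (a := x.succ) _ _ (not_le.1 hxm), Matrix.zero_mulVec,
            Matrix.mulVec_zero, Matrix.zero_vecMulVec]
          rcases (Fin.le_castSucc_iff.2 (not_le.1 hxm)).eq_or_lt with h | h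
          · rw [Matrix.vecMul_vecMul, ← legComp_succ _ _ (h ▸ ham), h2 x h,
              vecMulVec_zero_right]
          · rw [legComp_of_lt _ _ h, Matrix.zero_mulVec, Matrix.zero_vecMulVec]
      · rw [hWn _ _ hi, hWn _ _ hi]
        simp
  have hidem : ∀ x, e x * e x = e x := by
    rintro (l | ⟨i', j⟩)
    · rw [heinl, Matrix.mul_zero]
    · rw [heinr, Matrix.vecMulVec_mul_vecMulVec]
      by_cases hi : i' = i
      · subst hi
        rw [hWi, hfi]
        by_cases haj : a ≤ j
        · by_cases hjm : j ≤ m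
          · have : dotProduct (Matrix.vecMul f (legComp φ i' a j))
                ((legComp φ i' j m).mulVec w) = 1 := by
              rw [← Matrix.dotProduct_mulVec, Matrix.mulVec_mulVec, legComp_mul _ _ haj hjm, h1]
            rw [this]
            simp
          · rw [legComp_of_lt (a := j) _ _ (not_le.1 hjm)]
            simp
        · rw [legComp_of_lt (j := j) _ _ (not_le.1 haj)]
          simp
      · rw [hWn _ _ hi]
        simp
  -- The endomorphism is not 0, since it fixes `w` at `m`, and not 1, since it is 0 at the tips.
  rcases hind e hmor hidem with h0 | h0
  · have h5 := heinr i m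
    rw [h0, hWi, hfi, legComp_self, Matrix.one_mulVec] at h5
    have h6 : dotProduct (Matrix.vecMul f (legComp φ i a m)) w = 1 := by
      rw [← Matrix.dotProduct_mulVec, h1]
    have h7 := congrArg (fun M => Matrix.mulVec M w) h5
    simp only [Matrix.zero_mulVec, Matrix.vecMulVec_mulVec, h6] at h7
    have h8 : w = 0 := by simpa using h7.symm
    rw [h8, dotProduct_zero] at h6
    exact zero_ne_one h6
  · have h5 := h0 (Sum.inl ⟨0, hr⟩)
    rw [heinl] at h5
    have := congrFun (congrFun h5 default) default
    simp at this

/-- All maps along the legs are injective, and the sums of the maps into `(i; 0)` are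
surjective. -/
structure IsNondegenerate (φ : Rep κ v) : Prop where
  tip : ∀ i, ∃ D : Matrix (Fin r) (Fin (v (Sum.inr ⟨i, 0⟩))) κ, tipMatrix φ i * D = 1
  leg : ∀ i (j : Fin (s i)),
    ∃ R : Matrix (Fin (v (Sum.inr ⟨i, j.succ⟩))) (Fin (v (Sum.inr ⟨i, j.castSucc⟩))) κ,
      R * legMatrix φ i j = 1

/-- If a form on V(i;0) kills the images of the tips, pull it back along the leg as long as it stays
non-zero and pair it with a vector there. If a vector is killed by a leg map, lift it outward as far
as possible and take a form that is 1 on it and vanishes on what comes from the next vertex. Either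
way a chain splits off. -/
lemma Indecomposable.isNondegenerate (hr : 0 < r) {φ : Rep κ v} (h : Indecomposable φ) :
    IsNondegenerate φ := by
  classical
  constructor
  · intro i
    apply exists_right_inverse
    intro f hf
    by_contra hf0
    obtain ⟨m, hm, hmax⟩ := Finset.exists_max_image
      (Finset.univ.filter fun m => Matrix.vecMul f (legComp φ i 0 m) ≠ 0) id
      ⟨0, by simpa [legComp_self] using hf0⟩
    simp only [Finset.mem_filter, Finset.mem_univ, true_and, id] at hm hmax
    obtain ⟨c, hc⟩ := Function.ne_iff.1 hm
    refine not_indecomposable_of_chain hr φ i 0 m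
      (Pi.single c (Matrix.vecMul f (legComp φ i 0 m) c)⁻¹) f ?_ ?_ ?_ ?_ h
    · rw [Matrix.dotProduct_mulVec, dotProduct_single]
      exact mul_inv_cancel₀ hc
    · rintro j rfl
      by_contra hne
      exact absurd (hmax _ hne) (not_le.2 Fin.castSucc_lt_succ)
    · rw [legComp_self, Matrix.vecMul_one, hf]
    · intro j hj
      exact absurd hj (Fin.succ_ne_zero j).symm
  · intro i j
    apply exists_left_inverse
    intro w₀ hw₀
    by_contra hne
    -- `m` is the farthest vertex of the leg from which the kernel vector comes.
    obtain ⟨m, hm, hmax⟩ := Finset.exists_max_image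
      (Finset.univ.filter fun m => j.succ ≤ m ∧ ∃ w, (legComp φ i j.succ m).mulVec w = w₀) id
      ⟨j.succ, by simp [legComp_self]⟩
    simp only [Finset.mem_filter, Finset.mem_univ, true_and, id, and_imp] at hm hmax
    obtain ⟨hjm, w, hw⟩ := hm
    have hf : ∃ f, dotProduct f w₀ = 1 ∧ ∀ x : Fin (s i), m = x.castSucc →
        Matrix.vecMul f (legComp φ i j.succ x.succ) = 0 := by
      cases m using Fin.lastCases with
      | last =>
        obtain ⟨f, hf, -⟩ := exists_dotProduct_eq_one (⊥ : Submodule κ _) (x := w₀) (by simpa)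
        exact ⟨f, hf, fun x hx => absurd hx.symm (Fin.castSucc_lt_last x).ne⟩
      | cast y =>
        obtain ⟨f, hf, hf'⟩ := exists_dotProduct_eq_one
          (LinearMap.range (legComp φ i j.succ y.succ).mulVecLin) (x := w₀) (by
            rintro ⟨z, hz⟩
            exact absurd (hmax y.succ (hjm.trans Fin.castSucc_lt_succ.le) ⟨z, hz⟩)
              (not_le.2 Fin.castSucc_lt_succ))
        refine ⟨f, hf, fun x hx => ?_⟩
        obtain rfl := Fin.castSucc_injective _ hx
        ext c
        have := hf' _ ⟨Pi.single c 1, rfl⟩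
        rw [Matrix.mulVecLin_apply, Matrix.dotProduct_mulVec, dotProduct_single, mul_one] at this
        exact this
    obtain ⟨f, hf1, hf2⟩ := hf
    refine not_indecomposable_of_chain hr φ i j.succ m w f (by rw [hw, hf1]) hf2 ?_ ?_ h
    · rw [legComp_of_lt _ _ (Fin.succ_pos j)]
      simp
    · intro x hx
      obtain rfl := Fin.succ_injective _ hx
      rw [hw, hw₀]

end Legs

/-! ### Flags of non-degenerate representations -/

section RepFlags

variable {r k : ℕ} {s : Fin k → ℕ} {κ : Type*} [Field κ] {v : Vertex r k s → ℕ}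
  [∀ l, Unique (Fin (v (Sum.inl l)))]

lemma diagonal_mulVec_eq (t x : Fin r → κ) : (Matrix.diagonal t).mulVec x = t * x := by
  ext l
  rw [Matrix.mulVec_diagonal, Pi.mul_apply]

/-- The flag of a leg: the kernel of `κ ^ r → V (i; 0)`, and the preimages of the images of the
spaces `V (i; j)`. -/
def legFlag (φ : Rep κ v) (i : Fin k) : Fin (s i + 2) → Submodule κ (Fin r → κ) :=
  Fin.cons (LinearMap.ker (tipMatrix φ i).mulVecLin) fun j =>
    (LinearMap.range (legComp φ i 0 j).mulVecLin).comap (tipMatrix φ i).mulVecLin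

lemma mem_legFlag_zero {φ : Rep κ v} {i : Fin k} {x : Fin r → κ} :
    x ∈ legFlag φ i 0 ↔ (tipMatrix φ i).mulVec x = 0 := Iff.rfl

lemma mem_legFlag_succ {φ : Rep κ v} {i : Fin k} {j : Fin (s i + 1)} {x : Fin r → κ} :
    x ∈ legFlag φ i j.succ ↔ ∃ y, (legComp φ i 0 j).mulVec y = (tipMatrix φ i).mulVec x := Iff.rfl

variable {φ ψ : Rep κ v}

omit [∀ l, Unique (Fin (v (Sum.inl l)))] in
lemma exists_left_inverse_legComp (h : ∀ i (j : Fin (s i)),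
    ∃ R : Matrix (Fin (v (Sum.inr ⟨i, j.succ⟩))) (Fin (v (Sum.inr ⟨i, j.castSucc⟩))) κ,
      R * legMatrix φ i j = 1) (i : Fin k) (j : Fin (s i + 1)) :
    ∃ R : Matrix (Fin (v (Sum.inr ⟨i, j⟩))) (Fin (v (Sum.inr ⟨i, 0⟩))) κ,
      R * legComp φ i 0 j = 1 := by
  induction j using Fin.induction with
  | zero => exact ⟨1, by rw [legComp_self, Matrix.one_mul]⟩
  | succ j ih =>
    obtain ⟨R, hR⟩ := ih
    obtain ⟨R', hR'⟩ := h i j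
    refine ⟨R' * R, ?_⟩
    rw [legComp_succ _ _ (Fin.zero_le _)]
    calc R' * R * (legComp φ i 0 j.castSucc * legMatrix φ i j) =
        R' * ((R * legComp φ i 0 j.castSucc) * legMatrix φ i j) := by simp only [Matrix.mul_assoc]
      _ = 1 := by rw [hR, Matrix.one_mul, hR']

lemma IsMorphism.legComp {g : ∀ x, Matrix (Fin (v x)) (Fin (v x)) κ} (hg : IsMorphism φ ψ g)
    (i : Fin k) (j : Fin (s i + 1)) :
    g (Sum.inr ⟨i, 0⟩) * legComp φ i 0 j = Supernova.legComp ψ i 0 j * g (Sum.inr ⟨i, j⟩) := by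
  induction j using Fin.induction with
  | zero => rw [legComp_self, legComp_self, Matrix.mul_one, Matrix.one_mul]
  | succ j ih =>
    rw [legComp_succ _ _ (Fin.zero_le _), legComp_succ _ _ (Fin.zero_le _), ← Matrix.mul_assoc, ih,
      Matrix.mul_assoc, ((isMorphism_iff φ ψ g).1 hg).2 i j, Matrix.mul_assoc]

/-- On κ^r a morphism is the diagonal matrix of its tip scalars; commuting with the maps, it sends
kernels to kernels and preimages of images to preimages of images. -/
lemma IsMorphism.mul_mem_legFlag {g : ∀ x, Matrix (Fin (v x)) (Fin (v x)) κ}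
    (hg : IsMorphism φ ψ g) {i : Fin k} {a : Fin (s i + 2)} {x : Fin r → κ}
    (hx : x ∈ legFlag φ i a) : tipScalars g * x ∈ legFlag ψ i a := by
  have hC : (tipMatrix ψ i).mulVec (tipScalars g * x) =
      (g (Sum.inr ⟨i, 0⟩)).mulVec ((tipMatrix φ i).mulVec x) := by
    rw [← diagonal_mulVec_eq, Matrix.mulVec_mulVec, Matrix.mulVec_mulVec,
      ((isMorphism_iff φ ψ g).1 hg).1 i]
  cases a using Fin.cases with
  | zero =>
    rw [mem_legFlag_zero] at hx ⊢
    rw [hC, hx, Matrix.mulVec_zero]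
  | succ j =>
    rw [mem_legFlag_succ] at hx ⊢
    obtain ⟨y, hy⟩ := hx
    refine ⟨(g (Sum.inr ⟨i, j⟩)).mulVec y, ?_⟩
    rw [hC, ← hy, Matrix.mulVec_mulVec, Matrix.mulVec_mulVec, hg.legComp]

omit [Field κ] in
lemma tipScalars_eq_iff {g g' : ∀ x, Matrix (Fin (v x)) (Fin (v x)) κ} :
    tipScalars g = tipScalars g' ↔ ∀ l, g (Sum.inl l) = g' (Sum.inl l) := by
  constructor
  · intro h l
    ext a b
    rw [Unique.eq_default a, Unique.eq_default b]
    exact congrFun h l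
  · intro h
    funext l
    rw [tipScalars, tipScalars, h]

lemma tipScalars_mul (g g' : ∀ x, Matrix (Fin (v x)) (Fin (v x)) κ) :
    tipScalars (fun x => g x * g' x) = tipScalars g * tipScalars g' := by
  funext l
  rw [tipScalars, Matrix.mul_apply, Fintype.sum_unique]
  rfl

lemma tipScalars_one : tipScalars (fun x => (1 : Matrix (Fin (v x)) (Fin (v x)) κ)) = 1 := by
  funext l
  simp [tipScalars]

omit [∀ l, Unique (Fin (v (Sum.inl l)))] in
lemma isMorphism_one (φ : Rep κ v) : IsMorphism φ φ fun _ => 1 := fun _ _ _ => by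
  rw [Matrix.one_mul, Matrix.mul_one]

omit [∀ l, Unique (Fin (v (Sum.inl l)))] in
lemma isMorphism_zero (φ ψ : Rep κ v) : IsMorphism φ ψ fun _ => 0 := fun _ _ _ => by
  rw [Matrix.zero_mul, Matrix.mul_zero]

/-- Morphisms of non-degenerate representations are determined at the vertices `(l)`. -/
lemma IsMorphism.eq_of_tipScalars (hφ : IsNondegenerate φ) (hψ : IsNondegenerate ψ)
    {g g' : ∀ x, Matrix (Fin (v x)) (Fin (v x)) κ} (hg : IsMorphism φ ψ g)
    (hg' : IsMorphism φ ψ g') (h : tipScalars g = tipScalars g') : ∀ x, g x = g' x := by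
  rintro (l | ⟨i, j⟩)
  · exact tipScalars_eq_iff.1 h l
  · induction j using Fin.induction with
    | zero =>
      obtain ⟨D, hD⟩ := hφ.tip i
      have h1 := ((isMorphism_iff φ ψ g).1 hg).1 i
      rw [h, ← ((isMorphism_iff φ ψ g').1 hg').1 i] at h1
      have h2 := congrArg (· * D) h1
      simpa only [Matrix.mul_assoc, hD, Matrix.mul_one] using h2
    | succ j ih =>
      obtain ⟨R, hR⟩ := hψ.leg i j
      have h1 := ((isMorphism_iff φ ψ g).1 hg).2 i j
      rw [ih, ((isMorphism_iff φ ψ g').1 hg').2 i j] at h1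
      have h2 := congrArg (R * ·) h1
      simp only [← Matrix.mul_assoc, hR, Matrix.one_mul] at h2
      exact h2.symm

/-- A diagonal matrix that maps flags to flags extends to a morphism. -/
lemma exists_isMorphism (hφ : IsNondegenerate φ) (hψ : IsNondegenerate ψ) (t : Fin r → κ)
    (ht : ∀ i a, ∀ x ∈ legFlag φ i a, t * x ∈ legFlag ψ i a) :
    ∃ g, IsMorphism φ ψ g ∧ tipScalars g = t := by
  choose D hD using hφ.tip
  choose R hR using exists_left_inverse_legComp hψ.leg
  -- The map induced by `t` on the quotient V(i;0) of κ^r. The choice of section `D` does not matter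
  -- because `t` preserves the kernels, which are step 0 of the flags.
  let g₀ : ∀ i, Matrix (Fin (v (Sum.inr ⟨i, 0⟩))) (Fin (v (Sum.inr ⟨i, 0⟩))) κ :=
    fun i => tipMatrix ψ i * Matrix.diagonal t * D i
  have hg₀ : ∀ i x, (g₀ i).mulVec ((tipMatrix φ i).mulVec x) = (tipMatrix ψ i).mulVec (t * x) := by
    intro i x
    have h1 : x - (D i).mulVec ((tipMatrix φ i).mulVec x) ∈ legFlag φ i 0 := by
      rw [mem_legFlag_zero, Matrix.mulVec_sub, Matrix.mulVec_mulVec, hD, Matrix.one_mulVec,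
        sub_self]
    have h2 := ht i 0 _ h1
    rw [mem_legFlag_zero, mul_sub, Matrix.mulVec_sub, sub_eq_zero] at h2
    rw [h2, ← diagonal_mulVec_eq]
    simp only [g₀, Matrix.mulVec_mulVec, Matrix.mul_assoc]
  obtain ⟨g, hginr, hginl⟩ : ∃ g : ∀ x, Matrix (Fin (v x)) (Fin (v x)) κ,
      (∀ i j, g (Sum.inr ⟨i, j⟩) = R i j * (g₀ i * legComp φ i 0 j)) ∧
        ∀ l, g (Sum.inl l) = Matrix.of fun _ _ => t l :=
    ⟨fun x => match x with
      | Sum.inl l => Matrix.of fun _ _ => t l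
      | Sum.inr ⟨i, j⟩ => R i j * (g₀ i * legComp φ i 0 j), fun _ _ => rfl, fun _ => rfl⟩
  have hgt : tipScalars g = t := by
    funext l
    rw [tipScalars, hginl]
    rfl
  -- `R` inverts the leg map only on its image; the condition at step `j.succ` says that the vectors
  -- in question lie there.
  have hcomp : ∀ i j, legComp ψ i 0 j * g (Sum.inr ⟨i, j⟩) = g₀ i * legComp φ i 0 j := by
    intro i j
    rw [Matrix.ext_iff_mulVec]
    intro y
    have hx : (D i).mulVec ((legComp φ i 0 j).mulVec y) ∈ legFlag φ i j.succ := by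
      rw [mem_legFlag_succ]
      refine ⟨y, ?_⟩
      rw [Matrix.mulVec_mulVec _ (tipMatrix φ i), hD, Matrix.one_mulVec]
    obtain ⟨z, hz⟩ := mem_legFlag_succ.1 (ht i j.succ _ hx)
    rw [← hg₀, Matrix.mulVec_mulVec _ (tipMatrix φ i), hD, Matrix.one_mulVec,
      Matrix.mulVec_mulVec] at hz
    rw [hginr, ← Matrix.mulVec_mulVec, ← Matrix.mulVec_mulVec, ← hz,
      Matrix.mulVec_mulVec _ (R i j), hR, Matrix.one_mulVec]
  refine ⟨g, ?_, hgt⟩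
  rw [isMorphism_iff, hgt]
  constructor
  · intro i
    have h0 := hcomp i 0
    rw [legComp_self, legComp_self, Matrix.one_mul, Matrix.mul_one] at h0
    rw [h0, Matrix.ext_iff_mulVec]
    intro x
    rw [← Matrix.mulVec_mulVec, hg₀, ← Matrix.mulVec_mulVec, diagonal_mulVec_eq]
  · intro i j
    have h1 : legComp ψ i 0 j.castSucc * (g (Sum.inr ⟨i, j.castSucc⟩) * legMatrix φ i j) =
        legComp ψ i 0 j.castSucc * (legMatrix ψ i j * g (Sum.inr ⟨i, j.succ⟩)) := by
      rw [← Matrix.mul_assoc, hcomp, Matrix.mul_assoc, ← legComp_succ _ _ (Fin.zero_le _),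
        ← Matrix.mul_assoc, ← legComp_succ _ _ (Fin.zero_le _), hcomp]
    have h2 := congrArg (R i j.castSucc * ·) h1
    simpa only [← Matrix.mul_assoc, hR, Matrix.one_mul] using h2

/-- No proper non-empty set of coordinates is a union of parts of a decomposition of all flags. -/
def FlagsLinked (E : ∀ i, Fin (s i + 2) → Submodule κ (Fin r → κ)) : Prop :=
  ∀ S : Set (Fin r), (∀ i, FlagStable (E i) S) → ∀ c d, c ∈ S → d ∈ S

omit [∀ l, Unique (Fin (v (Sum.inl l)))] in
lemma indicator_eq_mul (S : Set (Fin r)) (x : Fin r → κ) : S.indicator x = S.indicator 1 * x := by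
  funext c
  by_cases hc : c ∈ S <;> simp [hc]

/-- An endomorphism is determined by its tip scalars. It is idempotent exactly when these are 0 or
1, hence the indicator of a set `S`, and it exists exactly when the projection to `S` preserves all
flags. -/
theorem indecomposable_iff_flagsLinked (hr : 0 < r) (φ : Rep κ v) :
    Indecomposable φ ↔ IsNondegenerate φ ∧ FlagsLinked (legFlag φ) := by
  constructor
  · intro h
    have hnd := h.isNondegenerate hr
    refine ⟨hnd, fun S hS c d hc => ?_⟩
    obtain ⟨g, hg, hgS⟩ := exists_isMorphism hnd hnd (S.indicator 1) fun i a x hx => by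
      rw [← indicator_eq_mul]
      exact hS i a x hx
    have hgg : ∀ x, g x * g x = g x := by
      refine (isMorphism_mul hg hg).eq_of_tipScalars hnd hnd hg ?_
      rw [tipScalars_mul, hgS, ← indicator_eq_mul, Set.indicator_indicator, Set.inter_self]
    rcases ((indecomposable_iff φ).1 h).2 g hg hgg with h0 | h0
    · have h1 := congrFun hgS c
      rw [tipScalars, h0, Set.indicator_of_mem hc] at h1
      simp at h1
    · by_contra hd
      have h1 := congrFun hgS d
      rw [tipScalars, h0, Set.indicator_of_notMem hd] at h1
      simp at h1
  · rintro ⟨hnd, h⟩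
    rw [indecomposable_iff]
    refine ⟨fun h0 => ?_, fun e he hee => ?_⟩
    · have h1 := congrFun h0 (Sum.inl ⟨0, hr⟩)
      have h2 := (default : Fin (v (Sum.inl ⟨0, hr⟩))).2
      rw [Pi.zero_apply] at h1
      omega
    · set t := tipScalars e with ht
      have htt : ∀ l, t l * t l = t l := by
        have : t * t = t := by
          rw [ht, ← tipScalars_mul]
          exact tipScalars_eq_iff.2 fun l => hee _
        exact congrFun this
      have ht01 : ∀ l, t l = 0 ∨ t l = 1 := fun l => by
        rcases eq_or_ne (t l) 0 with h0 | h0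
        · exact Or.inl h0
        · exact Or.inr (mul_left_cancel₀ h0 (by rw [htt, mul_one]))
      have hS := h {l | t l = 1} fun i a x hx => by
        have : Set.indicator {l | t l = 1} x = t * x := by
          funext l
          rcases ht01 l with h0 | h0 <;> simp [h0]
        rw [this, ht]
        exact he.mul_mem_legFlag hx
      by_cases hex : ∃ c, t c = 1
      · right
        obtain ⟨c, hc⟩ := hex
        refine he.eq_of_tipScalars hnd hnd (isMorphism_one φ) ?_
        rw [tipScalars_one, ← ht]
        funext d
        exact hS c d hc
      · left
        refine he.eq_of_tipScalars hnd hnd (isMorphism_zero φ φ) ?_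
        rw [← ht]
        funext d
        rcases ht01 d with h0 | h0
        · rw [h0]
          rfl
        · exact absurd ⟨d, h0⟩ hex

/-- Rank-nullity for V → V'/W, which is onto with kernel the preimage of W. -/
lemma finrank_comap_add {V V' : Type*} [AddCommGroup V] [Module κ V] [AddCommGroup V']
    [Module κ V'] [FiniteDimensional κ V] [FiniteDimensional κ V'] (f : V →ₗ[κ] V')
    (hf : Function.Surjective f) (W : Submodule κ V') :
    Module.finrank κ (W.comap f) + Module.finrank κ V' =
      Module.finrank κ V + Module.finrank κ W := by
  have h1 := LinearMap.finrank_range_add_finrank_ker (W.mkQ ∘ₗ f)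
  have h2 : LinearMap.range (W.mkQ ∘ₗ f) = ⊤ := by
    rw [LinearMap.range_eq_top]
    exact (Submodule.mkQ_surjective W).comp hf
  rw [h2, finrank_top, LinearMap.ker_comp, Submodule.ker_mkQ] at h1
  have h3 := Submodule.finrank_quotient_add_finrank W
  omega

lemma IsNondegenerate.tip_surjective (hφ : IsNondegenerate φ) (i : Fin k) :
    Function.Surjective (tipMatrix φ i).mulVecLin := by
  intro y
  obtain ⟨D, hD⟩ := hφ.tip i
  exact ⟨D.mulVec y, by rw [Matrix.mulVecLin_apply, Matrix.mulVec_mulVec, hD, Matrix.one_mulVec]⟩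

lemma IsNondegenerate.finrank_legFlag_zero (hφ : IsNondegenerate φ) (i : Fin k) :
    Module.finrank κ (legFlag φ i 0) + v (Sum.inr ⟨i, 0⟩) = r := by
  have h := finrank_comap_add _ (hφ.tip_surjective i) ⊥
  change Module.finrank κ (LinearMap.ker (tipMatrix φ i).mulVecLin) + _ = _
  rwa [Module.finrank_fin_fun, Module.finrank_fin_fun, finrank_bot, add_zero] at h

lemma IsNondegenerate.finrank_legFlag_succ (hφ : IsNondegenerate φ) (i : Fin k)
    (j : Fin (s i + 1)) :
    Module.finrank κ (legFlag φ i j.succ) + v (Sum.inr ⟨i, 0⟩) = r + v (Sum.inr ⟨i, j⟩) := by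
  have h := finrank_comap_add _ (hφ.tip_surjective i) (LinearMap.range (legComp φ i 0 j).mulVecLin)
  have hinj : Function.Injective (legComp φ i 0 j).mulVecLin := by
    obtain ⟨R, hR⟩ := exists_left_inverse_legComp hφ.leg i j
    intro x y hxy
    have := congrArg R.mulVec hxy
    simpa [Matrix.mulVec_mulVec, hR] using this
  rw [LinearMap.finrank_range_of_inj hinj] at h
  change Module.finrank κ ((LinearMap.range (legComp φ i 0 j).mulVecLin).comap
    (tipMatrix φ i).mulVecLin) + _ = _
  simpa using h

lemma legFlag_zero_le (φ : Rep κ v) (i : Fin k) (a : Fin (s i + 2)) :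
    legFlag φ i 0 ≤ legFlag φ i a := by
  cases a using Fin.cases with
  | zero => exact le_rfl
  | succ j =>
    intro x hx
    rw [mem_legFlag_zero] at hx
    exact mem_legFlag_succ.2 ⟨0, by rw [hx, Matrix.mulVec_zero]⟩

lemma legFlag_succ_le (φ : Rep κ v) (i : Fin k) {j j' : Fin (s i + 1)} (h : j ≤ j') :
    legFlag φ i j'.succ ≤ legFlag φ i j.succ := by
  intro x hx
  obtain ⟨y, hy⟩ := mem_legFlag_succ.1 hx
  refine mem_legFlag_succ.2 ⟨(legComp φ i j j').mulVec y, ?_⟩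
  rw [Matrix.mulVec_mulVec, legComp_mul _ _ (Fin.zero_le _) h, hy]

-- Coordinates on G/K: `Q` embeds a complement of `K` in `G`, and `P` is the quotient map by `K` in
-- these coordinates, extended from `G` to all of κ^r.
omit [∀ l, Unique (Fin (v (Sum.inl l)))] in
lemma exists_subquotient_matrices {n : ℕ} {K G : Submodule κ (Fin r → κ)} (hKG : K ≤ G)
    (hn : Module.finrank κ G = Module.finrank κ K + n) :
    ∃ (P : Matrix (Fin n) (Fin r) κ) (Q : Matrix (Fin r) (Fin n) κ), P * Q = 1 ∧
      (∀ x ∈ K, P.mulVec x = 0) ∧ (∀ y, Q.mulVec y ∈ G) ∧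
        ∀ x ∈ G, x - Q.mulVec (P.mulVec x) ∈ K := by
  obtain ⟨H₀, hH₀⟩ := Submodule.exists_isCompl K
  set H := H₀ ⊓ G with hH
  have hsup : K ⊔ H = G := by
    rw [hH, ← sup_inf_assoc_of_le _ hKG, hH₀.sup_eq_top, top_inf_eq]
  have hinf : K ⊓ H = ⊥ := by
    rw [hH, ← inf_assoc, hH₀.inf_eq_bot, bot_inf_eq]
  have hfin : Module.finrank κ H = n := by
    have := Submodule.finrank_sup_add_finrank_inf_eq K H
    rw [hsup, hinf, finrank_bot] at this
    omega
  let b : H ≃ₗ[κ] (Fin n → κ) := (Module.finBasisOfFinrankEq κ H hfin).equivFun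
  obtain ⟨l, hl⟩ := LinearMap.exists_leftInverse_of_injective (K.mkQ ∘ₗ H.subtype) (by
    rw [LinearMap.ker_eq_bot']
    rintro ⟨x, hx⟩ h0
    have hxK : x ∈ K := (Submodule.Quotient.mk_eq_zero K).1 h0
    have h1 : x ∈ K ⊓ H := ⟨hxK, hx⟩
    rw [hinf, Submodule.mem_bot] at h1
    exact Subtype.ext h1)
  have hl' : ∀ x : H, l (K.mkQ x) = x := fun x => LinearMap.congr_fun hl x
  let P := LinearMap.toMatrix' (b.toLinearMap ∘ₗ l ∘ₗ K.mkQ)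
  let Q := LinearMap.toMatrix' (H.subtype ∘ₗ b.symm.toLinearMap)
  have hP : ∀ x, P.mulVec x = b (l (K.mkQ x)) := LinearMap.toMatrix'_mulVec _
  have hQ : ∀ y, Q.mulVec y = b.symm y := LinearMap.toMatrix'_mulVec _
  have hPQ : ∀ y, P.mulVec (Q.mulVec y) = y := fun y => by
    rw [hP, hQ, hl', LinearEquiv.apply_symm_apply]
  have hPK : ∀ x ∈ K, P.mulVec x = 0 := fun x hx => by
    rw [hP, Submodule.mkQ_apply, (Submodule.Quotient.mk_eq_zero K).2 hx, map_zero, map_zero]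
  refine ⟨P, Q, ?_, hPK, fun y => ?_, fun x hx => ?_⟩
  · rw [Matrix.ext_iff_mulVec]
    intro y
    rw [← Matrix.mulVec_mulVec, hPQ, Matrix.one_mulVec]
  · rw [hQ]
    exact (b.symm y).2.2
  · rw [← hsup] at hx
    obtain ⟨x', hx', h, hh, rfl⟩ := Submodule.mem_sup.1 hx
    have h1 : P.mulVec h = b ⟨h, hh⟩ := by
      rw [hP]
      exact congrArg b (hl' ⟨h, hh⟩)
    rw [Matrix.mulVec_add, hPK x' hx', zero_add, h1, hQ, LinearEquiv.symm_apply_apply,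
      add_sub_cancel_right]
    exact hx'

end RepFlags

/-! ### Realization of flags, extension of scalars -/

section Realization

variable {r k : ℕ} {s : Fin k → ℕ} {κ : Type*} [Field κ] {v : Vertex r k s → ℕ}
  [∀ l, Unique (Fin (v (Sum.inl l)))]

/-- Flags of the right dimensions come from a non-degenerate representation. -/
theorem exists_legFlag_eq (E : ∀ i, Fin (s i + 2) → Submodule κ (Fin r → κ))
    (h0 : ∀ i a, E i 0 ≤ E i a) (hanti : ∀ i j j', j ≤ j' → E i (Fin.succ j') ≤ E i j.succ)
    (hd0 : ∀ i, Module.finrank κ (E i 0) + v (Sum.inr ⟨i, 0⟩) = r)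
    (hd : ∀ i (j : Fin (s i + 1)),
      Module.finrank κ (E i j.succ) + v (Sum.inr ⟨i, 0⟩) = r + v (Sum.inr ⟨i, j⟩)) :
    ∃ φ : Rep κ v, IsNondegenerate φ ∧ legFlag φ = E := by
  choose P Q hPQ hPK hQG hQP using fun i (j : Fin (s i + 1)) =>
    exists_subquotient_matrices (n := v (Sum.inr ⟨i, j⟩)) (h0 i j.succ)
      (by have := hd0 i; have := hd i j; omega)
  -- Step `Fin.succ 0` belongs to V(i;0), and the dimensions force it to be the whole space.
  have htop : ∀ i, E i (Fin.succ 0) = ⊤ := fun i => by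
    refine Submodule.eq_top_of_finrank_eq ?_
    have := hd i 0
    rw [Module.finrank_fin_fun]
    omega
  -- V(i;j) is modelled on step `j.succ` modulo step 0: tips map by the quotient map, and legs by
  -- the inclusions of the steps.
  let φ : Rep κ v := fun x y _ => match x, y with
    | Sum.inl l, Sum.inr ⟨i, j⟩ => Matrix.of fun a _ => P i j a l
    | Sum.inr ⟨i', j'⟩, Sum.inr ⟨i, j⟩ => P i j * Q i' j'
    | _, Sum.inl _ => 0
  have htip : ∀ i, tipMatrix φ i = P i 0 := fun i => rfl
  have hleg : ∀ i (j : Fin (s i)), legMatrix φ i j = P i j.castSucc * Q i j.succ := fun i j => rfl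
  -- Passing through a larger step is the identity modulo step 0, which `P` kills; so composites of
  -- inclusions are inclusions.
  have hskip : ∀ i (a : Fin (s i + 1)) (b c : Fin (s i + 1)), b ≤ c →
      P i a * Q i b * (P i b * Q i c) = P i a * Q i c := by
    intro i a b c hbc
    rw [Matrix.ext_iff_mulVec]
    intro y
    have h1 := hPK i a _ (hQP i b _ (hanti i b c hbc (hQG i c y)))
    rw [Matrix.mulVec_sub, sub_eq_zero] at h1
    simp only [← Matrix.mulVec_mulVec]
    exact h1.symm
  have hcomp : ∀ i j, legComp φ i 0 j = P i 0 * Q i j := by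
    intro i j
    induction j using Fin.induction with
    | zero => rw [legComp_self, hPQ]
    | succ j ih =>
      rw [legComp_succ _ _ (Fin.zero_le _), ih, hleg, hskip _ _ _ _ Fin.castSucc_lt_succ.le]
  have hker : ∀ i x, (P i 0).mulVec x = 0 → x ∈ E i 0 := by
    intro i x hx
    have h1 := hQP i 0 x (by rw [htop]; trivial)
    rwa [hx, Matrix.mulVec_zero, sub_zero] at h1
  refine ⟨φ, ⟨fun i => ⟨Q i 0, by rw [htip, hPQ]⟩,
    fun i j => ⟨P i j.succ * Q i j.castSucc, ?_⟩⟩, ?_⟩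
  · rw [hleg, hskip _ _ _ _ Fin.castSucc_lt_succ.le, hPQ]
  · funext i a
    ext x
    cases a using Fin.cases with
    | zero =>
      rw [mem_legFlag_zero, htip]
      exact ⟨hker i x, hPK i 0 x⟩
    | succ j =>
      rw [mem_legFlag_succ, htip, hcomp]
      constructor
      · rintro ⟨y, hy⟩
        rw [← Matrix.mulVec_mulVec, eq_comm, ← sub_eq_zero, ← Matrix.mulVec_sub] at hy
        have h1 := Submodule.add_mem _ (h0 i j.succ (hker i _ hy)) (hQG i j y)
        rwa [sub_add_cancel] at h1
      · intro hx
        refine ⟨(P i j).mulVec x, ?_⟩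
        have h1 := hPK i 0 _ (hQP i j x hx)
        rw [Matrix.mulVec_sub, sub_eq_zero] at h1
        rw [← Matrix.mulVec_mulVec, ← h1]

end Realization

/-! ### Flags and non-degeneracy under extension of scalars. -/

section Extension

variable {r k : ℕ} {s : Fin k → ℕ} {κ : Type*} [Field κ] {v : Vertex r k s → ℕ}
  (L : Type*) [Field L] [Algebra κ L]

lemma legComp_extendScalars (φ : Rep κ v) (i : Fin k) (j : Fin (s i + 1)) :
    legComp (v := v) (extendScalars L φ) i 0 j = (legComp φ i 0 j).map (algebraMap κ L) := by
  induction j using Fin.induction with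
  | zero => rw [legComp_self, legComp_self, Matrix.map_one _ (map_zero _) (map_one _)]
  | succ j ih =>
    rw [legComp_succ _ _ (Fin.zero_le _), legComp_succ _ _ (Fin.zero_le _), ih, Matrix.map_mul]
    rfl

variable [∀ l, Unique (Fin (v (Sum.inl l)))]

lemma tipMatrix_extendScalars (φ : Rep κ v) (i : Fin k) :
    tipMatrix (v := v) (extendScalars L φ) i = (tipMatrix φ i).map (algebraMap κ L) := rfl

variable {φ : Rep κ v}

lemma IsNondegenerate.extendScalars (hφ : IsNondegenerate φ) :
    IsNondegenerate (v := v) (extendScalars L φ) := by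
  constructor
  · intro i
    obtain ⟨D, hD⟩ := hφ.tip i
    refine ⟨D.map (algebraMap κ L), ?_⟩
    rw [tipMatrix_extendScalars, ← Matrix.map_mul, hD, Matrix.map_one _ (map_zero _) (map_one _)]
  · intro i j
    obtain ⟨R, hR⟩ := hφ.leg i j
    refine ⟨R.map (algebraMap κ L), ?_⟩
    have : legMatrix (v := v) (Supernova.extendScalars L φ) i j =
      (legMatrix φ i j).map (algebraMap κ L) := rfl
    rw [this, ← Matrix.map_mul, hR, Matrix.map_one _ (map_zero _) (map_one _)]

/-- The flag over `L` has the same κ-rational points: a solution over `L` can be replaced by the one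
that a left inverse over κ produces. -/
lemma IsNondegenerate.mem_legFlag_extendScalars (hφ : IsNondegenerate φ) {i : Fin k}
    {a : Fin (s i + 2)} {x : Fin r → κ} :
    algebraMap κ L ∘ x ∈ legFlag (v := v) (Supernova.extendScalars L φ) i a ↔
      x ∈ legFlag φ i a := by
  have hmap : ∀ {m n : ℕ} (M : Matrix (Fin m) (Fin n) κ) (y : Fin n → κ),
      (M.map (algebraMap κ L)).mulVec (algebraMap κ L ∘ y) = algebraMap κ L ∘ M.mulVec y :=
    fun M y => funext fun c => (RingHom.map_mulVec _ M y c).symm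
  have hinj : ∀ {m : ℕ} {y y' : Fin m → κ}, algebraMap κ L ∘ y = algebraMap κ L ∘ y' → y = y' :=
    fun h => (algebraMap κ L).injective.comp_left h
  cases a using Fin.cases with
  | zero =>
    rw [mem_legFlag_zero, mem_legFlag_zero, tipMatrix_extendScalars, hmap]
    refine ⟨fun h => hinj (h.trans ?_), fun h => ?_⟩
    · ext
      simp
    · rw [h]
      ext
      simp
  | succ j =>
    rw [mem_legFlag_succ, mem_legFlag_succ, tipMatrix_extendScalars, legComp_extendScalars, hmap]
    constructor
    · rintro ⟨y, hy⟩
      obtain ⟨R, hR⟩ := exists_left_inverse_legComp hφ.leg i j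
      refine ⟨R.mulVec ((tipMatrix φ i).mulVec x), hinj ?_⟩
      rw [← hmap, ← hmap, ← hy, Matrix.mulVec_mulVec _ (R.map _), ← Matrix.map_mul, hR,
        Matrix.map_one _ (map_zero _) (map_one _), Matrix.one_mulVec]
    · rintro ⟨y, hy⟩
      exact ⟨algebraMap κ L ∘ y, by rw [hmap, hy]⟩

omit [∀ l, Unique (Fin (v (Sum.inl l)))] in
lemma extendScalars_self (φ : Rep κ v) : extendScalars κ φ = φ := by
  funext x y a
  ext
  simp [extendScalars]

end Extension

/-! ### Indecomposable is the same as absolutely indecomposable. -/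

section Absolute

variable {r k : ℕ} {s : Fin k → ℕ} {κ : Type} [Field κ] {v : Vertex r k s → ℕ}
  [∀ l, Unique (Fin (v (Sum.inl l)))]

/-- Coordinate projections are defined over κ, so a set that is stable for the flags over `L` is
stable for their κ-rational points, which are the flags over κ. Linkedness therefore survives
extension. -/
theorem absolutelyIndecomposable_iff (hr : 0 < r) (φ : Rep κ v) :
    AbsolutelyIndecomposable φ ↔ IsNondegenerate φ ∧ FlagsLinked (legFlag φ) := by
  constructor
  · intro h
    have h1 := h κ inferInstance
    rw [extendScalars_self] at h1
    exact (indecomposable_iff_flagsLinked hr φ).1 h1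
  · rintro ⟨hφ, h⟩ L _ _ _
    refine (indecomposable_iff_flagsLinked hr _).2 ⟨hφ.extendScalars L, fun S hS => h S ?_⟩
    intro i a x hx
    rw [← hφ.mem_legFlag_extendScalars L] at hx ⊢
    have := hS i a _ hx
    rwa [Set.indicator_comp_of_zero (map_zero _)] at this

end Absolute

/-! ### The action of the torus on flags -/

open Pointwise

section Torus

variable {r : ℕ} {κ : Type*} [Field κ]

instance torusSMulCommClass : SMulCommClass (Fin r → κˣ) κ (Fin r → κ) :=
  ⟨fun t c x => funext fun l => smul_comm (t l) c (x l)⟩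

lemma torus_smul_eq (t : Fin r → κˣ) (x : Fin r → κ) : t • x = (fun l => (t l : κ)) * x := rfl

lemma mem_torus_smul {t : Fin r → κˣ} {p : Submodule κ (Fin r → κ)} {x : Fin r → κ} :
    x ∈ t • p ↔ t⁻¹ • x ∈ p := by
  rw [Submodule.mem_smul_pointwise_iff_exists]
  constructor
  · rintro ⟨y, hy, rfl⟩
    rwa [inv_smul_smul]
  · intro h
    exact ⟨_, h, smul_inv_smul _ _⟩

lemma finrank_torus_smul (t : Fin r → κˣ) (p : Submodule κ (Fin r → κ)) :
    Module.finrank κ (t • p : Submodule κ (Fin r → κ)) = Module.finrank κ p :=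
  (LinearEquiv.finrank_eq (Submodule.equivMapOfInjective
    (DistribSMul.toLinearMap κ (Fin r → κ) t) (MulAction.injective t) p)).symm

lemma FlagStable.torus_smul {Λ : Type*} {E : Λ → Submodule κ (Fin r → κ)} {S : Set (Fin r)}
    (h : FlagStable E S) (t : Fin r → κˣ) : FlagStable (t • E) S := by
  intro a x hx
  rw [Pi.smul_apply, mem_torus_smul] at hx ⊢
  have : t⁻¹ • S.indicator x = S.indicator (t⁻¹ • x) := by
    funext c
    by_cases hc : c ∈ S <;> simp [Pi.smul_apply', hc]
  rw [this]
  exact h a _ hx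

lemma IsFlag.torus_smul {Λ : Type*} [Fintype Λ] {ρ m : Λ → ℕ}
    {E : Λ → Submodule κ (Fin r → κ)} (h : IsFlag ρ m E) (t : Fin r → κˣ) :
    IsFlag ρ m (t • E) where
  mono a b hab x hx := by
    rw [Pi.smul_apply, mem_torus_smul] at hx ⊢
    exact h.mono a b hab hx
  finrank a := by rw [Pi.smul_apply, finrank_torus_smul, h.finrank]

/-- The coordinate projection to a level set of `t` is a polynomial in the multiplication by
`t`. -/
lemma indicator_level_mem {p : Submodule κ (Fin r → κ)} {t : Fin r → κ}
    (ht : ∀ x ∈ p, t * x ∈ p) (c : κ) {x : Fin r → κ} (hx : x ∈ p) :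
    Set.indicator {d | t d = c} x ∈ p := by
  classical
  have h1 : ∀ B : Finset κ, (fun l => ∏ b ∈ B, (t l - b)) * x ∈ p := by
    intro B
    induction B using Finset.induction_on with
    | empty => convert hx using 1; ext; simp
    | insert b B hb ih =>
      have : (fun l => ∏ b ∈ insert b B, (t l - b)) * x =
          t * ((fun l => ∏ b ∈ B, (t l - b)) * x) - b • ((fun l => ∏ b ∈ B, (t l - b)) * x) := by
        funext l
        simp only [Pi.mul_apply, Pi.sub_apply, Pi.smul_apply, smul_eq_mul,
          Finset.prod_insert hb]
        ring
      rw [this]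
      exact p.sub_mem (ht _ ih) (p.smul_mem _ ih)
  -- Lagrange interpolation: the polynomial that is 1 at `c` and 0 at the other values of `t`.
  have h2 : Set.indicator {d | t d = c} x = (∏ b ∈ (Finset.univ.image t).erase c, (c - b))⁻¹ •
      ((fun l => ∏ b ∈ (Finset.univ.image t).erase c, (t l - b)) * x) := by
    funext l
    rw [Pi.smul_apply, Pi.mul_apply, smul_eq_mul]
    by_cases hl : t l = c
    · have h0 : ∏ b ∈ (Finset.univ.image t).erase c, (c - b) ≠ 0 :=
        Finset.prod_ne_zero_iff.2 fun b hb => sub_ne_zero.2 (Finset.ne_of_mem_erase hb).symm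
      rw [Set.indicator_of_mem (by exact hl), hl, inv_mul_cancel_left₀ h0]
    · rw [Set.indicator_of_notMem (by exact hl), Finset.prod_eq_zero
        (Finset.mem_erase.2 ⟨hl, Finset.mem_image_of_mem t (Finset.mem_univ l)⟩) (sub_self (t l)),
        zero_mul, mul_zero]
  rw [h2]
  exact p.smul_mem _ (h1 _)

variable {k : ℕ} {s : Fin k → ℕ} {E : ∀ i, Fin (s i + 2) → Submodule κ (Fin r → κ)}

lemma FlagsLinked.torus_smul (h : FlagsLinked E) (t : Fin r → κˣ) : FlagsLinked (t • E) := by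
  intro S hS
  refine h S fun i => ?_
  have := (hS i).torus_smul t⁻¹
  rwa [Pi.smul_apply, inv_smul_smul] at this

/-- The tuples of flags that are linked. -/
def linkedFlags (ρ m : ∀ i, Fin (s i + 2) → ℕ) :
    SubMulAction (Fin r → κˣ) (∀ i, Fin (s i + 2) → Submodule κ (Fin r → κ)) where
  carrier := {E | (∀ i, IsFlag (ρ i) (m i) (E i)) ∧ FlagsLinked E}
  smul_mem' t _ h := ⟨fun i => (h.1 i).torus_smul t, h.2.torus_smul t⟩

lemma mem_linkedFlags {ρ m : ∀ i, Fin (s i + 2) → ℕ} :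
    E ∈ linkedFlags ρ m ↔ (∀ i, IsFlag (ρ i) (m i) (E i)) ∧ FlagsLinked E := Iff.rfl

/-- If `t` fixes the flags, the projections to its level sets preserve them, so linkedness leaves
only one level set. -/
lemma FlagsLinked.smul_eq_iff (hr : 0 < r) (h : FlagsLinked E) (t : Fin r → κˣ) :
    t • E = E ↔ ∃ c : κˣ, t = fun _ => c := by
  constructor
  · intro ht
    refine ⟨t ⟨0, hr⟩, funext fun d => ?_⟩
    have hst : ∀ i a, ∀ x ∈ E i a, (fun l => (t l : κ)) * x ∈ E i a := by
      intro i a x hx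
      rw [← ht, Pi.smul_apply, Pi.smul_apply, mem_torus_smul, ← torus_smul_eq, inv_smul_smul]
      exact hx
    exact Units.ext (h {d | (t d : κ) = t ⟨0, hr⟩}
      (fun i a x hx => indicator_level_mem (hst i a) _ hx) ⟨0, hr⟩ d rfl)
  · rintro ⟨c, rfl⟩
    funext i a
    ext x
    rw [Pi.smul_apply, Pi.smul_apply, mem_torus_smul]
    exact Submodule.smul_mem_iff _ (c⁻¹).ne_zero

lemma card_stabilizer_linkedFlags [Fintype κ] (hr : 0 < r) {ρ m : ∀ i, Fin (s i + 2) → ℕ}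
    (x : linkedFlags (κ := κ) (r := r) ρ m) :
    Nat.card (MulAction.stabilizer (Fin r → κˣ) x) = Fintype.card κ - 1 := by
  classical
  rw [← Fintype.card_units, ← Nat.card_eq_fintype_card]
  have hx : ∀ t : Fin r → κˣ, t ∈ MulAction.stabilizer (Fin r → κˣ) x ↔
      ∃ c : κˣ, t = fun _ => c := by
    intro t
    rw [← FlagsLinked.smul_eq_iff hr x.2.2 t, MulAction.mem_stabilizer_iff, Subtype.ext_iff]
    rfl
  refine (Nat.card_congr (Equiv.ofBijective
    (fun c : κˣ => (⟨fun _ => c, (hx _).2 ⟨c, rfl⟩⟩ : MulAction.stabilizer (Fin r → κˣ) x))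
    ⟨fun c c' h => congrFun (congrArg Subtype.val h) ⟨0, hr⟩, fun ⟨t, ht⟩ => ?_⟩)).symm
  obtain ⟨c, rfl⟩ := (hx t).1 ht
  exact ⟨c, rfl⟩

/-- Orbit-stabilizer: the torus has (q - 1)^r elements and every stabilizer consists of the q - 1
scalars. -/
theorem card_linkedFlags [Fintype κ] (hr : 0 < r) (ρ m : ∀ i, Fin (s i + 2) → ℕ) :
    Nat.card (linkedFlags (κ := κ) (r := r) ρ m) =
      Nat.card (MulAction.orbitRel.Quotient (Fin r → κˣ) (linkedFlags (κ := κ) (r := r) ρ m)) *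
        (Fintype.card κ - 1) ^ (r - 1) := by
  classical
  have : Finite (linkedFlags (κ := κ) (r := r) ρ m) :=
    inferInstanceAs (Finite {E // E ∈ linkedFlags (κ := κ) (r := r) ρ m})
  let _ := Fintype.ofFinite (linkedFlags (κ := κ) (r := r) ρ m)
  let _ := Fintype.ofFinite
    (Quotient (MulAction.orbitRel (Fin r → κˣ) (linkedFlags (κ := κ) (r := r) ρ m)))
  have hq : 0 < Fintype.card κ - 1 := by
    have := Fintype.one_lt_card (α := κ)
    omega
  rw [Nat.card_eq_fintype_card, MulAction.card_eq_sum_card_group_div_card_stabilizer (Fin r → κˣ)]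
  simp only [← Nat.card_eq_fintype_card (α := MulAction.stabilizer _ _),
    card_stabilizer_linkedFlags hr]
  rw [Finset.sum_const, Finset.card_univ, smul_eq_mul, Fintype.card_pi_const, Fintype.card_units,
    ← Nat.card_eq_fintype_card (α := Quotient _)]
  congr 1
  obtain ⟨n, rfl⟩ := Nat.exists_eq_succ_of_ne_zero hr.ne'
  rw [Nat.succ_eq_add_one, pow_succ, Nat.mul_div_cancel _ hq, Nat.add_sub_cancel]

end Torus

/-! ### Isomorphism classes as torus orbits. -/

section Orbits

variable {r k : ℕ} {s : Fin k → ℕ} {κ : Type*} [Field κ] {v : Vertex r k s → ℕ}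
  [∀ l, Unique (Fin (v (Sum.inl l)))] {φ ψ : Rep κ v}

/-- The tip scalars of an isomorphism form a torus element carrying one flag tuple to the other.
Conversely `t` and its inverse extend to morphisms, which are mutually inverse because morphisms are
determined at the tips. -/
theorem isomorphic_iff_torus (hφ : IsNondegenerate φ) (hψ : IsNondegenerate ψ) :
    Isomorphic φ ψ ↔ ∃ t : Fin r → κˣ, t • legFlag φ = legFlag ψ := by
  constructor
  · rintro ⟨g, h, hgh, hhg, hg⟩
    have hh : IsMorphism ψ φ h := by
      intro x y a
      calc h y * ψ a = h y * (ψ a * g x) * h x := by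
            rw [Matrix.mul_assoc, Matrix.mul_assoc, hgh, Matrix.mul_one]
        _ = φ a * h x := by rw [← hg a, ← Matrix.mul_assoc, hhg, Matrix.one_mul]
    have h1 : tipScalars g * tipScalars h = 1 := by
      rw [← tipScalars_mul, ← tipScalars_one (v := v)]
      exact tipScalars_eq_iff.2 fun l => hgh _
    have h2 : ∀ l, tipScalars g l * tipScalars h l = 1 := congrFun h1
    refine ⟨fun l => ⟨tipScalars g l, tipScalars h l, h2 l, by rw [mul_comm, h2]⟩, ?_⟩
    funext i a
    ext x
    rw [Pi.smul_apply, Pi.smul_apply, mem_torus_smul]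
    change tipScalars h * x ∈ _ ↔ _
    constructor
    · intro hx
      have := IsMorphism.mul_mem_legFlag (show IsMorphism φ ψ g from hg) hx
      rwa [← mul_assoc, h1, one_mul] at this
    · exact hh.mul_mem_legFlag
  · rintro ⟨t, ht⟩
    have ht' : ∀ i a x, x ∈ legFlag ψ i a ↔ t⁻¹ • x ∈ legFlag φ i a := fun i a x => by
      rw [← ht, Pi.smul_apply, Pi.smul_apply, mem_torus_smul]
    obtain ⟨g, hg, hgt⟩ := exists_isMorphism hφ hψ (fun l => (t l : κ)) fun i a x hx => by
      rw [ht', ← torus_smul_eq, inv_smul_smul]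
      exact hx
    obtain ⟨h, hh, hht⟩ := exists_isMorphism hψ hφ (fun l => (t⁻¹ l : κ)) fun i a x hx => by
      rwa [ht'] at hx
    refine ⟨g, h, ?_, ?_, hg⟩
    · refine (isMorphism_mul hh hg).eq_of_tipScalars hψ hψ (isMorphism_one ψ) ?_
      rw [tipScalars_mul, tipScalars_one, hgt, hht]
      funext l
      simp
    · refine (isMorphism_mul hg hh).eq_of_tipScalars hφ hφ (isMorphism_one φ) ?_
      rw [tipScalars_mul, tipScalars_one, hgt, hht]
      funext l
      simp

end Orbits

/-! ### Counting absolutely indecomposable representations -/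

section Counting

open Pointwise

/-- The order of the steps of the flag of a leg of length `n`. -/
def legOrder (n : ℕ) : Fin (n + 2) → ℕ := Fin.cons 0 fun j : Fin (n + 1) => n + 1 - j

lemma legOrder_zero (n : ℕ) : legOrder n 0 = 0 := rfl

lemma legOrder_succ {n : ℕ} (j : Fin (n + 1)) : legOrder n j.succ = n + 1 - j := rfl

lemma legOrder_injective (n : ℕ) : Function.Injective (legOrder n) := by
  intro a b h
  cases a using Fin.cases with
  | zero =>
    cases b using Fin.cases with
    | zero => rfl
    | succ j => rw [legOrder_zero, legOrder_succ] at h; omega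
  | succ i =>
    cases b using Fin.cases with
    | zero => rw [legOrder_zero, legOrder_succ] at h; omega
    | succ j =>
      rw [legOrder_succ, legOrder_succ] at h
      congr 1
      ext
      omega

lemma sum_legOrder_zero {n : ℕ} (m : Fin (n + 2) → ℕ) :
    ∑ b with legOrder n b ≤ legOrder n 0, m b = m 0 := by
  rw [Finset.sum_filter, Fin.sum_univ_succ, legOrder_zero, if_pos le_rfl, add_eq_left]
  refine Finset.sum_eq_zero fun j _ => if_neg ?_
  rw [legOrder_succ]
  omega

lemma sum_legOrder_succ {n : ℕ} (m : Fin (n + 2) → ℕ) (j : Fin (n + 1)) :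
    ∑ b with legOrder n b ≤ legOrder n j.succ, m b =
      m 0 + ∑ f ∈ Finset.Ici j, m f.succ := by
  rw [Finset.sum_filter, Fin.sum_univ_succ, legOrder_zero, if_pos (Nat.zero_le _),
    ← Finset.sum_filter]
  congr 1
  refine Finset.sum_congr ?_ fun _ _ => rfl
  ext f
  rw [Finset.mem_filter, Finset.mem_Ici, legOrder_succ, legOrder_succ, Fin.le_def]
  simp only [Finset.mem_univ, true_and]
  omega

variable {r k : ℕ} {s : Fin k → ℕ} {μ : ∀ i : Fin k, Fin (s i + 1) → ℕ}

lemma dimVec_zero (i : Fin k) :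
    dimVec r μ (Sum.inr ⟨i, 0⟩) = ∑ f, μ i f := by
  change ∑ f ∈ Finset.Ici 0, μ i f = _
  congr 1
  ext f
  simp

instance dimVecUnique (r : ℕ) (μ : ∀ i : Fin k, Fin (s i + 1) → ℕ) (l : Fin r) :
    Unique (Fin (dimVec r μ (Sum.inl l))) := inferInstanceAs (Unique (Fin 1))

variable {F : Type} [Field F]

/-- The kernel has dimension r - |μ|, and step `j.succ` exceeds it by dim V(i;j), the sum of the
parts from `j` on. The bound on |μ| makes the natural subtraction genuine. -/
lemma isFlag_legOrder_iff {i : Fin k} (hle : ∑ f, μ i f ≤ r)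
    {E : Fin (s i + 2) → Submodule F (Fin r → F)} :
    IsFlag (legOrder (s i)) (completed r (μ i)) E ↔
      (∀ a, E 0 ≤ E a) ∧ (∀ j j', j ≤ j' → E (Fin.succ j') ≤ E j.succ) ∧
        Module.finrank F (E 0) + dimVec r μ (Sum.inr ⟨i, 0⟩) = r ∧
          ∀ j : Fin (s i + 1), Module.finrank F (E j.succ) + dimVec r μ (Sum.inr ⟨i, 0⟩) =
            r + dimVec r μ (Sum.inr ⟨i, j⟩) := by
  have hc0 : completed r (μ i) 0 = r - ∑ f, μ i f := rfl
  have hcs : ∀ j : Fin (s i + 1), ∑ f ∈ Finset.Ici j, completed r (μ i) f.succ =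
    dimVec r μ (Sum.inr ⟨i, j⟩) := fun j => rfl
  rw [dimVec_zero]
  constructor
  · intro h
    refine ⟨fun a => h.mono _ _ (Nat.zero_le _), fun j j' hj => h.mono _ _ ?_, ?_, fun j => ?_⟩
    · rw [legOrder_succ, legOrder_succ]
      exact Nat.sub_le_sub_left hj _
    · rw [h.finrank, sum_legOrder_zero, hc0]
      omega
    · rw [h.finrank, sum_legOrder_succ, hc0, hcs]
      omega
  · rintro ⟨h0, h1, h2, h3⟩
    constructor
    · intro a b hab
      cases a using Fin.cases with
      | zero => exact h0 b
      | succ j =>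
        cases b using Fin.cases with
        | zero => rw [legOrder_zero, legOrder_succ] at hab; omega
        | succ j' =>
          rw [legOrder_succ, legOrder_succ] at hab
          exact h1 j' j (by rw [Fin.le_def]; omega)
    · intro a
      cases a using Fin.cases with
      | zero => rw [sum_legOrder_zero, hc0]; omega
      | succ j =>
        have := h3 j
        rw [sum_legOrder_succ, hc0, hcs]
        omega

/-- Two surjections with the same fibres have targets of the same size. -/
lemma card_eq_of_surjective {A B C : Type*} {f : A → B} {g : A → C} (hf : Function.Surjective f)
    (hg : Function.Surjective g) (h : ∀ a a', f a = f a' ↔ g a = g a') :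
    Nat.card B = Nat.card C := by
  have hker : Setoid.ker f = Setoid.ker g := Setoid.ext fun a a' => h a a'
  exact Nat.card_congr ((Setoid.quotientKerEquivOfSurjective f hf).symm.trans
    ((Quotient.congrRight (by rw [hker]; exact fun _ _ => Iff.rfl)).trans
      (Setoid.quotientKerEquivOfSurjective g hg)))

lemma legFlag_mem_linkedFlags (hr : 0 < r) (hle : ∀ i, ∑ f, μ i f ≤ r)
    {φ : Rep F (dimVec r μ)} (hφ : AbsolutelyIndecomposable φ) :
    legFlag φ ∈ linkedFlags (fun i => legOrder (s i)) fun i => completed r (μ i) := by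
  obtain ⟨h1, h2⟩ := (absolutelyIndecomposable_iff hr φ).1 hφ
  exact ⟨fun i => (isFlag_legOrder_iff (hle i)).2 ⟨legFlag_zero_le φ i,
    fun _ _ => legFlag_succ_le φ i, h1.finrank_legFlag_zero i, h1.finrank_legFlag_succ i⟩, h2⟩

/-- Absolutely indecomposable representations map onto their isomorphism classes and onto the torus
orbits of linked flags, with the same fibres. -/
theorem numAbsolutelyIndecomposable_eq (hr : 0 < r) (hle : ∀ i, ∑ f, μ i f ≤ r) :
    numAbsolutelyIndecomposable F (dimVec r μ) =
      Nat.card (MulAction.orbitRel.Quotient (Fin r → Fˣ)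
        (linkedFlags (κ := F) (r := r) (fun i => legOrder (s i)) fun i => completed r (μ i))) := by
  refine card_eq_of_surjective (A := {φ : Rep F (dimVec r μ) // AbsolutelyIndecomposable φ})
    (f := fun φ => ⟨Quotient.mk _ φ.1, φ.1, φ.2, rfl⟩)
    (g := fun φ => Quotient.mk _ ⟨legFlag φ.1, legFlag_mem_linkedFlags hr hle φ.2⟩) ?_ ?_ ?_
  · rintro ⟨_, φ, hφ, rfl⟩
    exact ⟨⟨φ, hφ⟩, rfl⟩
  · intro c
    induction c using Quotient.inductionOn with
    | h E =>
      obtain ⟨E, hE⟩ := E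
      have hE' := fun i => (isFlag_legOrder_iff (hle i)).1 (hE.1 i)
      obtain ⟨φ, hφ, rfl⟩ := exists_legFlag_eq (v := dimVec r μ) E (fun i => (hE' i).1)
        (fun i => (hE' i).2.1) (fun i => (hE' i).2.2.1) (fun i => (hE' i).2.2.2)
      exact ⟨⟨φ, (absolutelyIndecomposable_iff hr φ).2 ⟨hφ, hE.2⟩⟩, rfl⟩
  · rintro ⟨φ, hφ⟩ ⟨ψ, hψ⟩
    rw [Subtype.mk_eq_mk, eq_comm, Quotient.eq, Quotient.eq]
    change Isomorphic ψ φ ↔ _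
    rw [isomorphic_iff_torus ((absolutelyIndecomposable_iff hr ψ).1 hψ).1
      ((absolutelyIndecomposable_iff hr φ).1 hφ).1]
    change _ ↔ _ ∈ MulAction.orbit _ _
    simp only [MulAction.mem_orbit_iff, Subtype.ext_iff]
    rfl

-- Echelon form legwise: stability of all flags under S becomes the absence of entries crossing S.
open Classical in
lemma card_linkedFlags_eq_linked [Fintype F] (ρ m : ∀ i, Fin (s i + 2) → ℕ)
    (hρ : ∀ i, Function.Injective (ρ i)) (hm : ∀ i, ∑ b, m i b = r) :
    Nat.card (linkedFlags (κ := F) (r := r) ρ m) =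
      (Finset.univ.filter fun x : ∀ i, (Fin r → Fin (s i + 2)) × (Fin r → Fin r → F) =>
        (∀ i, IsNormal (ρ i) (m i) (x i)) ∧ Linked fun i c d => (x i).2 c d ≠ 0).card := by
  have key : ∀ x : ∀ i, (Fin r → Fin (s i + 2)) × (Fin r → Fin r → F),
      (∀ i, IsNormal (ρ i) (m i) (x i)) → (FlagsLinked (fun i => normalFlag (ρ i) (x i)) ↔
        Linked fun i c d => (x i).2 c d ≠ 0) := by
    intro x hx
    unfold FlagsLinked Linked
    simp only [fun i S => (hx i).flagStable_iff S]
  rw [← Fintype.card_subtype, ← Nat.card_eq_fintype_card]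
  have hmem : ∀ x : {x : ∀ i, (Fin r → Fin (s i + 2)) × (Fin r → Fin r → F) //
      (∀ i, IsNormal (ρ i) (m i) (x i)) ∧ Linked fun i c d => (x i).2 c d ≠ 0},
      (fun i => normalFlag (ρ i) (x.1 i)) ∈ linkedFlags ρ m := fun x =>
    mem_linkedFlags.2 ⟨fun i => (x.2.1 i).isFlag, (key x.1 x.2.1).2 x.2.2⟩
  refine (Nat.card_congr (Equiv.ofBijective (fun x => ⟨_, hmem x⟩) ⟨?_, ?_⟩)).symm
  · rintro ⟨x, hx⟩ ⟨y, hy⟩ h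
    refine Subtype.ext (funext fun i => (hx.1 i).eq_of_normalFlag_eq (hρ i) (hy.1 i) ?_)
    exact congrFun (congrArg Subtype.val h) i
  · rintro ⟨E, hE⟩
    choose x hx hxE using fun i => exists_isNormal (hρ i) (hm i) (hE.1 i)
    have hxE' : (fun i => normalFlag (ρ i) (x i)) = E := funext hxE
    subst hxE'
    exact ⟨⟨x, hx, (key x hx).1 hE.2⟩, rfl⟩

lemma sum_completed {d : ℕ} {ν : Fin d → ℕ} (h : ∑ f, ν f ≤ r) : ∑ f, completed r ν f = r := by
  rw [Fin.sum_univ_succ]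
  change r - ∑ f, ν f + ∑ f, ν f = r
  omega

open Classical in
theorem numAbsolutelyIndecomposable_mul_eq [Fintype F] (hr : 0 < r)
    (hle : ∀ i, ∑ f, μ i f ≤ r) :
    numAbsolutelyIndecomposable F (dimVec r μ) * (Fintype.card F - 1) ^ (r - 1) =
      ∑ w ∈ echelonTuples r μ, ∑ A ∈ Finset.univ.filter fun A : Finset (InversionEdge w) =>
        ConnectedBy (inversionGraph w) (A : Set (InversionEdge w)),
          (Fintype.card F - 1) ^ A.card := by
  rw [numAbsolutelyIndecomposable_eq hr hle, ← card_linkedFlags hr,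
    card_linkedFlags_eq_linked _ _ (fun i => legOrder_injective (s i))
      fun i => sum_completed (hle i)]
  -- Change from the geometric order, with the kernel as first step, to decreasing letters, where
  -- letter 0 comes last.
  have h1 := card_linked_eq (r := r) F (fun i => legOrder (s i)) (fun i a => s i + 1 - a)
    (fun i => completed r (μ i)) (fun i => legOrder_injective (s i))
    fun i a b h => Fin.ext (by simp only at h; omega)
  have h2 := card_linked_eq_sum_echelon F hr (fun i => completed r (μ i))
    (fun i a => s i + 1 - a) (fun i => sum_completed (hle i)) fun i a b => by
      rw [Fin.lt_def]
      omega
  refine Eq.trans ?_ h2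
  convert h1

instance inversionGraphFintype {w : Fin k → Equiv.Perm (Fin r)} :
    Fintype (inversionGraph w).vertexSet := inferInstanceAs (Fintype (Set.univ : Set (Fin r)))

lemma card_vertexSet_inversionGraph (w : Fin k → Equiv.Perm (Fin r)) :
    Nat.card (inversionGraph w).vertexSet = r := by
  change Nat.card (Set.univ : Set (Fin r)) = r
  simp

-- A connected spanning subgraph has at least r - 1 edges, so the truncated exponent |A| + 1 - r is
-- the true Betti number and the powers combine to |A|.
open Classical in
theorem eval_rPoly_mul (hr : 0 < r) (w : Fin k → Equiv.Perm (Fin r)) (q : ℤ) :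
    (rPoly w).eval q * (q - 1) ^ (r - 1) =
      ∑ A ∈ Finset.univ.filter fun A : Finset (InversionEdge w) =>
        ConnectedBy (inversionGraph w) (A : Set (InversionEdge w)), (q - 1) ^ A.card := by
  have hsub : (edgeSubsets (inversionGraph w)).filter
      (fun A : Finset (InversionEdge w) => ConnectedBy (inversionGraph w) (A : Set _)) =
      Finset.univ.filter fun A : Finset (InversionEdge w) =>
        ConnectedBy (inversionGraph w) (A : Set (InversionEdge w)) := by
    ext A
    rw [Finset.mem_filter, Finset.mem_filter, mem_edgeSubsets]
    exact and_congr_left fun _ => ⟨fun _ => Finset.mem_univ _, fun _ => Set.subset_univ _⟩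
  rw [rPoly, bettiSum, hsub, eval_finsetSum, Finset.sum_mul]
  refine Finset.sum_congr rfl fun A hA => ?_
  have hA' := (Finset.mem_filter.1 hA).2
  have hcard : r ≤ A.card + 1 := by
    have : Nonempty (inversionGraph w).vertexSet := ⟨⟨⟨0, hr⟩, trivial⟩⟩
    have h1 := ((spansAll_iff_connectedBy (inversionGraph w) A (Set.subset_univ _)).2
      hA').finrank_le_card
    have h2 := finrank_ker_coordSum (inversionGraph w)
    rw [card_vertexSet_inversionGraph] at h2
    omega
  rw [eval_pow, eval_sub, eval_X, eval_one, card_vertexSet_inversionGraph, ← pow_add]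
  congr 1
  omega

/-- Both counts carry the factor (q - 1)^(r - 1), which is non-zero since q ≥ 2 and can be
cancelled. -/
theorem isKacPolynomial_sum_rPoly (hr : 0 < r) (hle : ∀ i, ∑ f, μ i f ≤ r) :
    IsKacPolynomial (dimVec r μ) (∑ w ∈ echelonTuples r μ, rPoly w) := by
  intro F _ _
  have h1 := Fintype.one_lt_card (α := F)
  have h2 : ((Fintype.card F : ℤ) - 1) = ((Fintype.card F - 1 : ℕ) : ℤ) := by
    rw [Nat.cast_sub h1.le, Nat.cast_one]
  have h3 : ((Fintype.card F : ℤ) - 1) ^ (r - 1) ≠ 0 := by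
    refine pow_ne_zero _ ?_
    omega
  refine mul_right_cancel₀ h3 ?_
  rw [eval_finsetSum, Finset.sum_mul, Finset.sum_congr rfl fun w _ => eval_rPoly_mul hr w _, h2]
  exact_mod_cast (numAbsolutelyIndecomposable_mul_eq (F := F) hr hle).symm

end Counting

/-! ### Consequences of the root condition and uniqueness of the Kac polynomial -/

section Conclusion

/-- Two such polynomials agree at every prime, by the fields `ZMod p`. -/
lemma IsKacPolynomial.unique {I : Type*} [Quiver I] {v : I → ℕ} {A B : ℤ[X]}
    (hA : IsKacPolynomial v A) (hB : IsKacPolynomial v B) : A = B := by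
  refine Polynomial.eq_of_infinite_eval_eq A B ?_
  have hinf : Set.Infinite ((fun p : ℕ => (p : ℤ)) '' {p | p.Prime}) :=
    Nat.infinite_setOfPred_prime.image (Nat.cast_injective.injOn)
  refine hinf.mono ?_
  rintro _ ⟨p, hp, rfl⟩
  have : Fact p.Prime := ⟨hp⟩
  have h := (hA (ZMod p)).trans (hB (ZMod p)).symm
  rwa [ZMod.card] at h

lemma IsKacPolynomial.kacPolynomial_eq {I : Type*} [Quiver I] {v : I → ℕ} {A : ℤ[X]}
    (hA : IsKacPolynomial v A) : kacPolynomial v = A := by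
  have h : ∃ A : ℤ[X], IsKacPolynomial v A := ⟨A, hA⟩
  rw [kacPolynomial, dif_pos h]
  exact h.choose_spec.unique hA

variable {r k : ℕ} {s : Fin k → ℕ} {μ : ∀ i : Fin k, Fin (s i + 1) → ℕ}

lemma cartanForm_single {I : Type*} [Quiver I] [Fintype I] [DecidableEq I] (x : I) (v : I → ℤ) :
    cartanForm (Pi.single x 1) v = ∑ y, cartan x y * v y := by
  rw [cartanForm, Finset.sum_eq_single x]
  · simp
  · intro y _ hy
    simp [Pi.single_eq_of_ne hy]
  · simp

lemma cartan_of_isEmpty {I : Type*} [Quiver I] [DecidableEq I] {x y : I} (hxy : x ≠ y)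
    [IsEmpty (x ⟶ y)] [IsEmpty (y ⟶ x)] : cartan x y = 0 := by
  simp [cartan, hxy]

lemma cartan_center_tip (i : Fin k) (l : Fin r) :
    cartan (Sum.inr ⟨i, 0⟩ : Vertex r k s) (Sum.inl l) = -1 := by
  have h1 : Nat.card ((Sum.inr ⟨i, 0⟩ : Vertex r k s) ⟶ Sum.inl l) = 0 := by
    rw [Nat.card_eq_zero]
    exact Or.inl ⟨fun a => a.down⟩
  have h2 : Nat.card ((Sum.inl l : Vertex r k s) ⟶ Sum.inr ⟨i, 0⟩) = 1 := by
    rw [Nat.card_eq_one_iff_unique]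
    exact ⟨⟨fun ⟨_⟩ ⟨_⟩ => rfl⟩, ⟨tipArrow s l i⟩⟩
  rw [cartan, if_neg (by simp), h1, h2]
  norm_num

lemma cartan_center_leg (i : Fin k) (y : Σ i : Fin k, Fin (s i + 1)) (h0 : y ≠ ⟨i, 0⟩)
    (h1 : ¬ (y.1 = i ∧ (y.2 : ℕ) = 1)) :
    cartan (Sum.inr ⟨i, 0⟩ : Vertex r k s) (Sum.inr y) = 0 := by
  have e1 : IsEmpty ((Sum.inr ⟨i, 0⟩ : Vertex r k s) ⟶ Sum.inr y) :=
    ⟨fun a => by have := a.down.2; simp at this⟩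
  have e2 : IsEmpty ((Sum.inr y : Vertex r k s) ⟶ Sum.inr ⟨i, 0⟩) :=
    ⟨fun a => h1 ⟨a.down.1, by simpa using a.down.2⟩⟩
  exact cartan_of_isEmpty (by simpa using h0.symm)

lemma cartan_center_one_ge (i : Fin k) (j : Fin (s i + 1)) (hj : (j : ℕ) = 1) :
    -1 ≤ cartan (Sum.inr ⟨i, 0⟩ : Vertex r k s) (Sum.inr ⟨i, j⟩) := by
  have h1 : Nat.card ((Sum.inr ⟨i, 0⟩ : Vertex r k s) ⟶ Sum.inr ⟨i, j⟩) = 0 := by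
    rw [Nat.card_eq_zero]
    exact Or.inl ⟨fun a => by have := a.down.2; simp at this⟩
  have h2 : Nat.card ((Sum.inr ⟨i, j⟩ : Vertex r k s) ⟶ Sum.inr ⟨i, 0⟩) = 1 := by
    rw [Nat.card_eq_one_iff_unique]
    exact ⟨⟨fun ⟨_⟩ ⟨_⟩ => rfl⟩, ⟨⟨⟨rfl, by simpa using hj⟩⟩⟩⟩
  have h3 : (Sum.inr ⟨i, 0⟩ : Vertex r k s) ≠ Sum.inr ⟨i, j⟩ := by
    intro h
    have : (0 : Fin (s i + 1)) = j := by simpa using h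
    rw [← this] at hj
    simp at hj
  rw [cartan, if_neg h3, h1, h2]
  norm_num

/-- A fundamental imaginary root satisfies `|μ i| ≤ r`. -/
lemma IsFundamentalImaginary.sum_le (hM : IsFundamentalImaginary (dimVec r μ)) (i : Fin k) :
    ∑ f, μ i f ≤ r := by
  have h := hM.2.2 (Sum.inr ⟨i, 0⟩)
  rw [cartanForm_single, Fintype.sum_sum_type] at h
  have h1 : ∑ l : Fin r, cartan (Sum.inr ⟨i, 0⟩ : Vertex r k s) (Sum.inl l) *
      (dimVec r μ (Sum.inl l) : ℤ) = -r := by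
    simp only [cartan_center_tip]
    simp [dimVec]
  have h2 : (∑ f, μ i f : ℕ) ≤ ∑ y : Σ i : Fin k, Fin (s i + 1),
      cartan (Sum.inr ⟨i, 0⟩ : Vertex r k s) (Sum.inr y) * (dimVec r μ (Sum.inr y) : ℤ) := by
    rw [← Finset.add_sum_erase _ _ (Finset.mem_univ (⟨i, 0⟩ : Σ i : Fin k, Fin (s i + 1)))]
    have hd : ∀ j, dimVec r μ (Sum.inr ⟨i, j⟩) ≤ ∑ f, μ i f := fun j =>
      Finset.sum_le_sum_of_subset (Finset.subset_univ _)
    have hc : cartan (Sum.inr ⟨i, 0⟩ : Vertex r k s) (Sum.inr ⟨i, 0⟩) = 2 := if_pos rfl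
    rw [hc, dimVec_zero]
    -- Among the other vertices of the legs only (i;1), if present, is joined to (i;0), by one edge,
    -- and its dimension is at most |μ i|. Against the diagonal term 2|μ i| this leaves at least |μ
    -- i|.
    have h3 : -((∑ f, μ i f : ℕ) : ℤ) ≤
        ∑ y ∈ Finset.univ.erase (⟨i, 0⟩ : Σ i : Fin k, Fin (s i + 1)),
        cartan (Sum.inr ⟨i, 0⟩ : Vertex r k s) (Sum.inr y) * (dimVec r μ (Sum.inr y) : ℤ) := by
      by_cases hs : 1 < s i + 1
      · have hne : (⟨i, ⟨1, hs⟩⟩ : Σ i : Fin k, Fin (s i + 1)) ∈ Finset.univ.erase ⟨i, 0⟩ := by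
          simp [Fin.ext_iff]
        rw [← Finset.add_sum_erase _ _ hne,
          Finset.sum_eq_zero (s := (Finset.univ.erase _).erase _), add_zero]
        · have h4 := cartan_center_one_ge (r := r) i ⟨1, hs⟩ rfl
          have h5 := hd ⟨1, hs⟩
          have h6 : (dimVec r μ (Sum.inr ⟨i, ⟨1, hs⟩⟩) : ℤ) ≤ (∑ f, μ i f : ℕ) := by
            exact_mod_cast h5
          nlinarith [Int.natCast_nonneg (dimVec r μ (Sum.inr ⟨i, ⟨1, hs⟩⟩))]
        · rintro ⟨i', j⟩ hy
          rw [cartan_center_leg i _ (Finset.ne_of_mem_erase (Finset.mem_of_mem_erase hy)), zero_mul]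
          rintro ⟨rfl, hj⟩
          exact (Finset.ne_of_mem_erase hy) (Sigma.ext rfl (heq_of_eq (Fin.ext hj)))
      · rw [Finset.sum_eq_zero (s := Finset.univ.erase _)]
        · simp only [Left.neg_nonpos_iff]
          exact Int.natCast_nonneg _
        · rintro ⟨i', j⟩ hy
          rw [cartan_center_leg i _ (Finset.ne_of_mem_erase hy), zero_mul]
          rintro ⟨rfl, hj⟩
          have hlt := j.2
          dsimp only at hj hs hlt
          omega
    linarith
  have h7 : ((∑ f, μ i f : ℕ) : ℤ) ≤ r := by linarith
  exact_mod_cast h7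

/-- If r were 0, every |μ i| would be 0; as no partition is zero there would be no legs, hence no
vertices, and the root would be zero. -/
lemma IsFundamentalImaginary.rank_pos (hM : IsFundamentalImaginary (dimVec r μ))
    (hμ0 : ∀ i, μ i ≠ 0) : 0 < r := by
  rw [Nat.pos_iff_ne_zero]
  rintro rfl
  refine hM.1 (funext ?_)
  rintro (l | ⟨i, j⟩)
  · exact l.elim0
  · refine absurd (funext fun f => ?_) (hμ0 i)
    exact Nat.le_zero.1 ((Finset.single_le_sum (fun _ _ => Nat.zero_le _)
      (Finset.mem_univ f)).trans (hM.sum_le i))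

open Classical in
/-- The coefficients of a sum of external activity generating functions. -/
lemma coeff_sum_X_pow {γ : Type*} (B : Finset γ) (e : γ → ℕ) (m : ℕ) :
    (∑ A ∈ B, (X : ℤ[X]) ^ e A).coeff m = ((B.filter fun A => e A = m).card : ℤ) := by
  rw [finsetSum_coeff, Finset.card_filter, Nat.cast_sum]
  refine Finset.sum_congr rfl fun A _ => ?_
  rw [coeff_X_pow]
  split_ifs with h1 h2 h2 <;> simp_all

end Conclusion

end Supernova

end

/-! ### The main theorem. -/

open Supernova Polynomial in
open Classical in
theorem mainTheorem6 (r k : ℕ) (s : Fin k → ℕ) (μ : ∀ i : Fin k, Fin (s i + 1) → ℕ)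
    (hμ : ∀ i, Antitone (μ i)) (hμ0 : ∀ i, μ i ≠ 0)
    (hM : IsFundamentalImaginary (dimVec r μ)) :
    -- the Kac polynomial exists
    IsKacPolynomial (dimVec r μ) (kacPolynomial (dimVec r μ)) ∧
    -- connected inversion graphs: `R_w(q) = T_{K_w}(1, q)`
    (∀ w : Fin k → Equiv.Perm (Fin r), IsConnected (inversionGraph w) →
      rPoly w = tutteOne (inversionGraph w)) ∧
    -- disconnected inversion graphs
    (∀ w : Fin k → Equiv.Perm (Fin r), ¬ IsConnected (inversionGraph w) → rPoly w = 0) ∧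
    -- the Kac polynomial as a sum of specialized Tutte polynomials
    kacPolynomial (dimVec r μ) = ∑ w ∈ echelonTuples r μ, rPoly w ∧
    kacPolynomial (dimVec r μ) =
      ∑ w ∈ (echelonTuples r μ).filter (fun w => IsConnected (inversionGraph w)),
        tutteOne (inversionGraph w) ∧
    -- spanning tree expansion of each connected summand, for any ordering of the edges
    (∀ w : Fin k → Equiv.Perm (Fin r), IsConnected (inversionGraph w) →
      ∀ ord : LinearOrder (InversionEdge w),
        tutteOne (inversionGraph w) =
          ∑ A ∈ spanningTrees (inversionGraph w),
            (X : ℤ[X]) ^ externalActivity (inversionGraph w) ord A) ∧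
    -- the coefficients count spanning trees of given external activity
    (∀ (ord : ∀ w : Fin k → Equiv.Perm (Fin r), LinearOrder (InversionEdge w)) (m : ℕ),
      (kacPolynomial (dimVec r μ)).coeff m =
        ∑ w ∈ (echelonTuples r μ).filter (fun w => IsConnected (inversionGraph w)),
          (((spanningTrees (inversionGraph w)).filter
            (fun A => externalActivity (inversionGraph w) (ord w) A = m)).card : ℤ)) ∧
    -- non-negativity
    (∀ m : ℕ, 0 ≤ (kacPolynomial (dimVec r μ)).coeff m) := by
  have hr : 0 < r := hM.rank_pos hμ0
  have hA : kacPolynomial (dimVec r μ) = ∑ w ∈ echelonTuples r μ, rPoly w :=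
    (isKacPolynomial_sum_rPoly hr hM.sum_le).kacPolynomial_eq
  have hconn : ∀ w : Fin k → Equiv.Perm (Fin r), IsConnected (inversionGraph w) →
      rPoly w = tutteOne (inversionGraph w) := fun w h => (tutteOne_eq_bettiSum _ h).symm
  have hdisc : ∀ w : Fin k → Equiv.Perm (Fin r), ¬ IsConnected (inversionGraph w) → rPoly w = 0 :=
    fun w h => bettiSum_eq_zero _ h
  have hB : kacPolynomial (dimVec r μ) =
      ∑ w ∈ (echelonTuples r μ).filter (fun w => IsConnected (inversionGraph w)),
        tutteOne (inversionGraph w) := by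
    rw [hA, Finset.sum_filter]
    refine Finset.sum_congr rfl fun w _ => ?_
    split_ifs with h
    exacts [hconn w h, hdisc w h]
  have htree : ∀ w : Fin k → Equiv.Perm (Fin r), IsConnected (inversionGraph w) →
      ∀ ord : LinearOrder (InversionEdge w), tutteOne (inversionGraph w) =
        ∑ A ∈ spanningTrees (inversionGraph w),
          (X : ℤ[X]) ^ externalActivity (inversionGraph w) ord A := by
    intro w h ord
    have : Nonempty (inversionGraph w).vertexSet := ⟨⟨⟨0, hr⟩, trivial⟩⟩
    rw [← hconn w h]
    exact bettiSum_eq_sum_externalActivity _ ord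
  have hcoeff : ∀ (ord : ∀ w : Fin k → Equiv.Perm (Fin r), LinearOrder (InversionEdge w)) (m : ℕ),
      (kacPolynomial (dimVec r μ)).coeff m =
        ∑ w ∈ (echelonTuples r μ).filter (fun w => IsConnected (inversionGraph w)),
          (((spanningTrees (inversionGraph w)).filter
            (fun A => externalActivity (inversionGraph w) (ord w) A = m)).card : ℤ) := by
    intro ord m
    rw [hB, finsetSum_coeff]
    refine Finset.sum_congr rfl fun w hw => ?_
    rw [htree w (Finset.mem_filter.1 hw).2 (ord w), coeff_sum_X_pow]
  refine ⟨?_, hconn, hdisc, hA, hB, htree, hcoeff, fun m => ?_⟩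
  · rw [hA]
    exact isKacPolynomial_sum_rPoly hr hM.sum_le
  · rw [hcoeff (fun w => linearOrderOfSTO WellOrderingRel) m]
    exact Finset.sum_nonneg fun w _ => Int.natCast_nonneg _
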